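/- Let $R$ be a Dedekind domain with fraction field $K$, and let $\mathfrak a \subset K$ be a nonzero fractional ideal of $R$. A *rank-2 lattice* is a finitely generated torsion-free $R$-module of rank $2$. An *oriented quadratic $R$-algebra of type $\mathfrak a$* is a commutative $R$-algebra $S$ that is a rank-2 lattice, together with an isomorphism $\alpha : \Lambda^2 S \to \mathfrak a$ of $R$-modules. Put $S_K = K \otimes_R S$. An *ideal* of $S$ is a finitely generated $S$-submodule of $S_K$ that spans $S_K$ over $K$. A triple $(I_1,I_2,I_3)$ of ideals of $S$ is *balanced* if $I_1I_2I_3 \subseteq S$ and the image of $\Lambda^2 I_1 \otimes \Lambda^2 I_2 \otimes \Lambda^2 I_3$ in $(\Lambda^2 S_K)^{\otimes 3}$ is precisely (the image of) $(\Lambda^2 S)^{\otimes 3}$. Two data $(S,\alpha,I_1,I_2,I_3)$ and $(S',\alpha',I'_1,I'_2,I'_3)$ of oriented quadratic algebras of type $\mathfrak a$ with balanced triples are *equivalent* if there are an $R$-algebra isomorphism $f : S \to S'$ with $\alpha' \circ \Lambda^2 f = \alpha$ and units $\gamma_1,\gamma_2,\gamma_3 \in (S'_K)^\times$ with $\gamma_1\gamma_2\gamma_3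 = 1$ such that $I'_i = \gamma_i f(I_i)$ for $i=1,2,3$. A *Bhargava box of type $\mathfrak a$* consists of three rank-2 lattices $M_1,M_2,M_3$, an isomorphism $\theta : \Lambda^2 M_1 \otimes \Lambda^2 M_2 \otimes \Lambda^2 M_3 \to \mathfrak a^3$ of $R$-modules, and an $R$-trilinear map $\beta : M_1 \times M_2 \times M_3 \to \mathfrak a$ such that for each $\{i,j,k\}=\{1,2,3\}$ the partial dual $\beta_i : M_j \otimes M_k \to \mathrm{Hom}_R(M_i,\mathfrak a) = \mathfrak a M_i^*$ has image of full rank. Two boxes are *isomorphic* if there are isomorphisms $M_i \cong M_i'$ of $R$-modules carrying $\theta$ to $\theta'$ and $\beta$ to $\beta'$. **Theorem.** There is a bijection between * equivalence classes of balanced triples $(I_1,I_2,I_3)$ of ideals in oriented quadratic $R$-algebras $(S,\alpha)$ of type $\mathfrak a$, and * isomorphism classes of Bhargava boxes of type $\mathfrak a$. Under this bijection the class of $(S,\alpha,I_1,I_2,I_3)$ corresponds to the class of $(M_1,M_2,M_3,\theta,\beta)$ if and only if there are $R$-module isomorphisms $M_i \cong I_i$ that turn $\beta$ into $(x,y,z)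 \mapsto \alpha(1 \wedge xyz)$ and $\theta$ into the restriction of $\alpha^{\otimes 3}$ to $\Lambda^2 I_1 \otimes \Lambda^2 I_2 \otimes \Lambda^2 I_3$ (where $\alpha$ is extended $K$-linearly to $\Lambda^2_K S_K$). No restriction is made on the characteristic of $R$, and $S_K$ may be degenerate (have discriminant zero). -/

import Mathlib

open scoped TensorProduct nonZeroDivisors

universe u

namespace IdealTriples

noncomputable section

/-- `x ∧ y`, as an element of the second exterior power. -/
def wedge (A : Type*) [CommRing A] {V : Type*} [AddCommGroup V] [Module A V] (x y : V) :
    ⋀[A]^2 V :=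
  exteriorPower.ιMulti A 2 ![x, y]

section

variable {A V : Type*} [CommRing A] [AddCommGroup V] [Module A V]

theorem update_zero_pair {V : Type*} (x y z : V) : Function.update ![x, y] 0 z = ![z, y] := by
  ext i; fin_cases i <;> rfl

theorem update_one_pair {V : Type*} (x y z : V) : Function.update ![x, y] 1 z = ![x, z] := by
  ext i; fin_cases i <;> rfl

theorem wedge_add_left (x x' y : V) : wedge A (x + x') y = wedge A x y + wedge A x' y := by
  have h := (exteriorPower.ιMulti A 2 (M := V)).map_update_add ![x, y] 0 x x'
  simpa only [wedge, Fin.isValue, update_zero_pair, update_one_pair] using h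

theorem wedge_smul_left (c : A) (x y : V) : wedge A (c • x) y = c • wedge A x y := by
  have h := (exteriorPower.ιMulti A 2 (M := V)).map_update_smul ![x, y] 0 c x
  simpa only [wedge, Fin.isValue, update_zero_pair, update_one_pair] using h

theorem wedge_add_right (x y y' : V) : wedge A x (y + y') = wedge A x y + wedge A x y' := by
  have h := (exteriorPower.ιMulti A 2 (M := V)).map_update_add ![x, y] 1 y y'
  simpa only [wedge, Fin.isValue, update_zero_pair, update_one_pair] using h

theorem wedge_smul_right (c : A) (x y : V) : wedge A x (c • y) = c • wedge A x y := by
  have h := (exteriorPower.ιMulti A 2 (M := V)).map_update_smul ![x, y] 1 c y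
  simpa only [wedge, Fin.isValue, update_zero_pair, update_one_pair] using h

end

/-- A lattice of rank 2 over a domain `R`: a finitely generated torsion-free module of rank 2. -/
structure IsRankTwoLattice (R M : Type*) [CommRing R] [AddCommGroup M] [Module R M] : Prop where
  finite : Module.Finite R M
  torsionFree : Module.IsTorsionFree R M
  finrank_eq : Module.finrank R M = 2

/-- A fractional ideal of an `R`-algebra `S` (of finite rank as an `R`-module): a finitely
generated `S`-submodule of `S_K = K ⊗ S` that spans `S_K` over `K`. It is recorded as an
`R`-submodule that is stable under `S`; since `S` is a finite `R`-module, finite generation over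
`R` and over `S` are the same. -/
structure FracIdeal (R K S : Type*) [CommRing R] [Field K] [Algebra R K]
    [CommRing S] [Algebra R S] where
  carrier : Submodule R (K ⊗[R] S)
  smul_mem : ∀ (s : S) (x : K ⊗[R] S), x ∈ carrier → ((1 : K) ⊗ₜ[R] s) * x ∈ carrier
  fg : carrier.FG
  span_eq_top : Submodule.span K (carrier : Set (K ⊗[R] S)) = ⊤

/-- The image of `S` in `S_K = K ⊗ S`. -/
def unitLattice (R K S : Type*) [CommRing R] [Field K] [Algebra R K]
    [CommRing S] [Algebra R S] : Submodule R (K ⊗[R] S) :=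
  LinearMap.range
    (Algebra.TensorProduct.includeRight : S →ₐ[R] K ⊗[R] S).toLinearMap

/-- The image of `Λ²L₁ ⊗ Λ²L₂ ⊗ Λ²L₃` in `(Λ²V)^{⊗3}` (over `K`), for `R`-submodules `Lᵢ` of a
`K`-vector space `V`; it is the `R`-span of the images of the pure tensors of wedge products. -/
def wedgeTriple (R K : Type*) [CommRing R] [Field K] [Algebra R K] {V : Type*} [AddCommGroup V]
    [Module K V] [Module R V] [IsScalarTower R K V] (L₁ L₂ L₃ : Submodule R V) :
    Submodule R ((⋀[K]^2 V) ⊗[K] (⋀[K]^2 V) ⊗[K] (⋀[K]^2 V)) :=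
  Submodule.span R {t | ∃ x₁ ∈ L₁, ∃ y₁ ∈ L₁, ∃ x₂ ∈ L₂, ∃ y₂ ∈ L₂, ∃ x₃ ∈ L₃, ∃ y₃ ∈ L₃,
    t = wedge K x₁ y₁ ⊗ₜ[K] wedge K x₂ y₂ ⊗ₜ[K] wedge K x₃ y₃}

/-- Balanced triples of fractional ideals of a quadratic algebra `S`. -/
structure IsBalanced {R K S : Type*} [CommRing R] [Field K] [Algebra R K]
    [CommRing S] [Algebra R S] (I₁ I₂ I₃ : FracIdeal R K S) : Prop where
  mul_le : I₁.carrier * I₂.carrier * I₃.carrier ≤ unitLattice R K S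
  wedge_eq : wedgeTriple R K I₁.carrier I₂.carrier I₃.carrier =
    wedgeTriple R K (unitLattice R K S) (unitLattice R K S) (unitLattice R K S)

/-- The partial dual `M₁ ⊗ M₂ → Hom(M₃, N)`, `x ⊗ y ↦ (z ↦ β x y z)`. -/
def partialDual₃ {R M₁ M₂ M₃ N : Type*} [CommRing R] [AddCommGroup M₁] [AddCommGroup M₂]
    [AddCommGroup M₃] [AddCommGroup N] [Module R M₁] [Module R M₂] [Module R M₃] [Module R N]
    (β : M₁ →ₗ[R] M₂ →ₗ[R] M₃ →ₗ[R] N) : M₁ ⊗[R] M₂ →ₗ[R] (M₃ →ₗ[R] N) :=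
  TensorProduct.lift β

/-- The partial dual `M₁ ⊗ M₃ → Hom(M₂, N)`, `x ⊗ z ↦ (y ↦ β x y z)`. -/
def partialDual₂ {R M₁ M₂ M₃ N : Type*} [CommRing R] [AddCommGroup M₁] [AddCommGroup M₂]
    [AddCommGroup M₃] [AddCommGroup N] [Module R M₁] [Module R M₂] [Module R M₃] [Module R N]
    (β : M₁ →ₗ[R] M₂ →ₗ[R] M₃ →ₗ[R] N) : M₁ ⊗[R] M₃ →ₗ[R] (M₂ →ₗ[R] N) :=
  TensorProduct.lift (LinearMap.lflip.toLinearMap ∘ₗ β)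

/-- The partial dual `M₂ ⊗ M₃ → Hom(M₁, N)`, `y ⊗ z ↦ (x ↦ β x y z)`. -/
def partialDual₁ {R M₁ M₂ M₃ N : Type*} [CommRing R] [AddCommGroup M₁] [AddCommGroup M₂]
    [AddCommGroup M₃] [AddCommGroup N] [Module R M₁] [Module R M₂] [Module R M₃] [Module R N]
    (β : M₁ →ₗ[R] M₂ →ₗ[R] M₃ →ₗ[R] N) : M₂ ⊗[R] M₃ →ₗ[R] (M₁ →ₗ[R] N) :=
  TensorProduct.lift (LinearMap.lflip.toLinearMap ∘ₗ β.flip)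

section

variable {R M₁ M₂ M₃ N : Type*} [CommRing R] [AddCommGroup M₁] [AddCommGroup M₂]
  [AddCommGroup M₃] [AddCommGroup N] [Module R M₁] [Module R M₂] [Module R M₃] [Module R N]
  (β : M₁ →ₗ[R] M₂ →ₗ[R] M₃ →ₗ[R] N)

theorem partialDual₁_tmul (x : M₁) (y : M₂) (z : M₃) :
    partialDual₁ β (y ⊗ₜ[R] z) x = β x y z := rfl

theorem partialDual₂_tmul (x : M₁) (y : M₂) (z : M₃) :
    partialDual₂ β (x ⊗ₜ[R] z) y = β x y z := rfl

theorem partialDual₃_tmul (x : M₁) (y : M₂) (z : M₃) :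
    partialDual₃ β (x ⊗ₜ[R] y) z = β x y z := rfl

end

/-- An `R`-linear map has image of full rank if its image has the same rank as its codomain. -/
def HasFullRankImage {R P Q : Type*} [CommRing R] [AddCommGroup P] [AddCommGroup Q] [Module R P]
    [Module R Q] (f : P →ₗ[R] Q) : Prop :=
  Module.finrank R (LinearMap.range f) = Module.finrank R Q

/-- Auxiliary fact for the equivalence relation: composing two scaled base changes. -/
theorem map_scaled_map {R K S S' S'' : Type*} [CommRing R] [Field K]
    [Algebra R K] [CommRing S] [CommRing S'] [CommRing S'']
    [Algebra R S] [Algebra R S'] [Algebra R S''] (f : S →ₐ[R] S') (g : S' →ₐ[R] S'')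
    (c : K ⊗[R] S') (d : K ⊗[R] S'') (L : Submodule R (K ⊗[R] S)) :
    (L.map (LinearMap.mulLeft R c ∘ₗ f.toLinearMap.lTensor K)).map
        (LinearMap.mulLeft R d ∘ₗ g.toLinearMap.lTensor K) =
      L.map (LinearMap.mulLeft R
        (d * Algebra.TensorProduct.map (AlgHom.id R K) g c) ∘ₗ
          (g.comp f).toLinearMap.lTensor K) := by
  rw [← Submodule.map_comp]
  congr 1
  have h : ∀ x, g.toLinearMap.lTensor K x = Algebra.TensorProduct.map (AlgHom.id R K) g x :=
    fun x => rfl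
  have h2 : ∀ x, (g.comp f).toLinearMap.lTensor K x =
      g.toLinearMap.lTensor K (f.toLinearMap.lTensor K x) := fun x => by
    rw [AlgHom.comp_toLinearMap, LinearMap.lTensor_comp_apply]
  refine LinearMap.ext fun x => ?_
  simp only [LinearMap.comp_apply, LinearMap.mulLeft_apply, h2, h, map_mul, mul_assoc]

theorem map_scaled_id {R K S : Type*} [CommRing R] [Field K] [Algebra R K] [CommRing S] [Algebra R S] (L : Submodule R (K ⊗[R] S)) :
    L.map (LinearMap.mulLeft R (1 : K ⊗[R] S) ∘ₗ
      (AlgHom.id R S).toLinearMap.lTensor K) = L := by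
  have : LinearMap.mulLeft R (1 : K ⊗[R] S) ∘ₗ
      (AlgHom.id R S).toLinearMap.lTensor K = LinearMap.id := by
    refine LinearMap.ext fun x => ?_
    simp
  rw [this, Submodule.map_id]

variable {R K : Type u} [CommRing R] [IsDomain R] [Field K] [Algebra R K] [IsFractionRing R K]

/-- An oriented quadratic algebra `S` of type `𝔞` together with a balanced triple of fractional
ideals of `S`. -/
structure BalancedTriple (𝔞 : FractionalIdeal R⁰ K) where
  S : Type u
  [commRing : CommRing S]
  [algebra : Algebra R S]
  lattice : IsRankTwoLattice R S
  orient : (⋀[R]^2 S) ≃ₗ[R] 𝔞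
  I₁ : FracIdeal R K S
  I₂ : FracIdeal R K S
  I₃ : FracIdeal R K S
  balanced : IsBalanced I₁ I₂ I₃

attribute [instance] BalancedTriple.commRing BalancedTriple.algebra

/-- A Bhargava box of type `𝔞`. The partial dual `βᵢ : Mⱼ ⊗ Mₖ → 𝔞 Mᵢ* = Hom(Mᵢ, 𝔞)` is
required to have as image a sublattice of full rank. -/
structure BhargavaBox (𝔞 : FractionalIdeal R⁰ K) where
  M₁ : Type u
  M₂ : Type u
  M₃ : Type u
  [addCommGroup₁ : AddCommGroup M₁]
  [addCommGroup₂ : AddCommGroup M₂]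
  [addCommGroup₃ : AddCommGroup M₃]
  [module₁ : Module R M₁]
  [module₂ : Module R M₂]
  [module₃ : Module R M₃]
  lattice₁ : IsRankTwoLattice R M₁
  lattice₂ : IsRankTwoLattice R M₂
  lattice₃ : IsRankTwoLattice R M₃
  θ : ((⋀[R]^2 M₁) ⊗[R] (⋀[R]^2 M₂) ⊗[R] (⋀[R]^2 M₃)) ≃ₗ[R] (𝔞 ^ 3 : FractionalIdeal R⁰ K)
  β : M₁ →ₗ[R] M₂ →ₗ[R] M₃ →ₗ[R] 𝔞
  nondeg₁ : HasFullRankImage (partialDual₁ β)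
  nondeg₂ : HasFullRankImage (partialDual₂ β)
  nondeg₃ : HasFullRankImage (partialDual₃ β)

attribute [instance] BhargavaBox.addCommGroup₁ BhargavaBox.addCommGroup₂
  BhargavaBox.addCommGroup₃ BhargavaBox.module₁ BhargavaBox.module₂ BhargavaBox.module₃

/-- Equivalence of balanced triples: an isomorphism `f : S ≃ S'` of oriented quadratic algebras
and scalars `γ₁, γ₂, γ₃ ∈ S'_K^×` with product `1` such that `Iᵢ' = γᵢ f(Iᵢ)`. -/
def BalancedTriple.Equivalent {𝔞 : FractionalIdeal R⁰ K} (T T' : BalancedTriple 𝔞) : Prop :=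
  ∃ f : T.S ≃ₐ[R] T'.S,
    (∀ ω, T'.orient (exteriorPower.map 2 f.toLinearMap ω) = T.orient ω) ∧
    ∃ γ₁ γ₂ γ₃ : (K ⊗[R] T'.S)ˣ, γ₁ * γ₂ * γ₃ = 1 ∧
      T'.I₁.carrier = T.I₁.carrier.map (LinearMap.mulLeft R (γ₁ : K ⊗[R] T'.S) ∘ₗ
        f.toLinearMap.lTensor K) ∧
      T'.I₂.carrier = T.I₂.carrier.map (LinearMap.mulLeft R (γ₂ : K ⊗[R] T'.S) ∘ₗ
        f.toLinearMap.lTensor K) ∧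
      T'.I₃.carrier = T.I₃.carrier.map (LinearMap.mulLeft R (γ₃ : K ⊗[R] T'.S) ∘ₗ
        f.toLinearMap.lTensor K)

/-- Isomorphism of Bhargava boxes: isomorphisms `Mᵢ ≃ Mᵢ'` carrying `θ` to `θ'` and `β` to
`β'`. -/
def BhargavaBox.Isomorphic {𝔞 : FractionalIdeal R⁰ K} (B B' : BhargavaBox 𝔞) : Prop :=
  ∃ (f₁ : B.M₁ ≃ₗ[R] B'.M₁) (f₂ : B.M₂ ≃ₗ[R] B'.M₂) (f₃ : B.M₃ ≃ₗ[R] B'.M₃),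
    (∀ ω, B'.θ (TensorProduct.map (TensorProduct.map
      (exteriorPower.map 2 f₁.toLinearMap) (exteriorPower.map 2 f₂.toLinearMap))
      (exteriorPower.map 2 f₃.toLinearMap) ω) = B.θ ω) ∧
    ∀ x y z, B'.β (f₁ x) (f₂ y) (f₃ z) = B.β x y z

instance BalancedTriple.setoid (𝔞 : FractionalIdeal R⁰ K) : Setoid (BalancedTriple 𝔞) where
  r := BalancedTriple.Equivalent
  iseqv := by
    refine ⟨fun T => ?_, fun {T T'} => ?_, fun {T T' T''} => ?_⟩
    · refine ⟨AlgEquiv.refl, fun ω => ?_, 1, 1, 1, by simp, ?_, ?_, ?_⟩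
      · have : (AlgEquiv.refl : T.S ≃ₐ[R] T.S).toLinearMap = LinearMap.id := rfl
        rw [this, exteriorPower.map_id]; rfl
      all_goals exact (map_scaled_id _).symm
    · rintro ⟨f, hf, γ₁, γ₂, γ₃, hγ, h₁, h₂, h₃⟩
      let F : K ⊗[R] T'.S →ₐ[R] K ⊗[R] T.S :=
        Algebra.TensorProduct.map (AlgHom.id R K) f.symm.toAlgHom
      have key : ∀ (γ : (K ⊗[R] T'.S)ˣ) (L : Submodule R (K ⊗[R] T.S)),
          L = (L.map (LinearMap.mulLeft R (γ : K ⊗[R] T'.S) ∘ₗ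
            f.toLinearMap.lTensor K)).map (LinearMap.mulLeft R
              ((Units.map (F : K ⊗[R] T'.S →* K ⊗[R] T.S) γ⁻¹ : (K ⊗[R] T.S)ˣ) :
                K ⊗[R] T.S) ∘ₗ f.symm.toLinearMap.lTensor K) := by
        intro γ L
        refine (map_scaled_id L).symm.trans (Eq.symm ((map_scaled_map f.toAlgHom
          f.symm.toAlgHom _ _ L).trans ?_))
        have e1 : ((Units.map (F : K ⊗[R] T'.S →* K ⊗[R] T.S) γ⁻¹ : (K ⊗[R] T.S)ˣ) :
            K ⊗[R] T.S) * F γ = 1 := by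
          change F (γ⁻¹ : (K ⊗[R] T'.S)ˣ) * F γ = 1
          rw [← map_mul, Units.inv_mul, map_one]
        have e2 : f.symm.toAlgHom.comp f.toAlgHom = AlgHom.id R T.S := by
          ext x; simp
        rw [e2]
        exact congrArg (fun c => L.map (LinearMap.mulLeft R c ∘ₗ
          (AlgHom.id R T.S).toLinearMap.lTensor K)) e1
      refine ⟨f.symm, fun ω => ?_, _, _, _, ?_, h₁ ▸ key γ₁ _, h₂ ▸ key γ₂ _, h₃ ▸ key γ₃ _⟩
      · rw [← hf]
        rw [← LinearMap.comp_apply, ← exteriorPower.map_comp]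
        have : f.toLinearMap ∘ₗ f.symm.toLinearMap = LinearMap.id := by ext x; simp
        rw [this, exteriorPower.map_id]; rfl
      · rw [← map_mul, ← map_mul, ← mul_inv, ← mul_inv, hγ, inv_one, map_one]
    · rintro ⟨f, hf, γ₁, γ₂, γ₃, hγ, h₁, h₂, h₃⟩ ⟨g, hg, δ₁, δ₂, δ₃, hδ, k₁, k₂, k₃⟩
      let G : K ⊗[R] T'.S →ₐ[R] K ⊗[R] T''.S :=
        Algebra.TensorProduct.map (AlgHom.id R K) g.toAlgHom
      have key : ∀ (γ : (K ⊗[R] T'.S)ˣ) (δ : (K ⊗[R] T''.S)ˣ) (L : Submodule R (K ⊗[R] T.S)),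
          (L.map (LinearMap.mulLeft R (γ : K ⊗[R] T'.S) ∘ₗ
            f.toLinearMap.lTensor K)).map (LinearMap.mulLeft R
              (δ : K ⊗[R] T''.S) ∘ₗ g.toLinearMap.lTensor K) =
          L.map (LinearMap.mulLeft R ((δ * Units.map (G : K ⊗[R] T'.S →* K ⊗[R] T''.S) γ :
            (K ⊗[R] T''.S)ˣ) : K ⊗[R] T''.S) ∘ₗ (f.trans g).toLinearMap.lTensor K) :=
        fun γ δ L => map_scaled_map f.toAlgHom g.toAlgHom _ _ L
      refine ⟨f.trans g, fun ω => ?_, _, _, _, ?_, (k₁.trans (h₁ ▸ key γ₁ δ₁ _)),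
        (k₂.trans (h₂ ▸ key γ₂ δ₂ _)), (k₃.trans (h₃ ▸ key γ₃ δ₃ _))⟩
      · have : (f.trans g).toLinearMap = g.toLinearMap ∘ₗ f.toLinearMap := rfl
        rw [this, exteriorPower.map_comp, LinearMap.comp_apply, hg, hf]
      · rw [mul_mul_mul_comm δ₁, mul_mul_mul_comm (δ₁ * δ₂), hδ, ← map_mul, ← map_mul, hγ, map_one, mul_one]

instance BhargavaBox.setoid (𝔞 : FractionalIdeal R⁰ K) : Setoid (BhargavaBox 𝔞) where
  r := BhargavaBox.Isomorphic
  iseqv := by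
    refine ⟨fun T => ?_, fun {T T'} => ?_, fun {T T' T''} => ?_⟩
    · refine ⟨LinearEquiv.refl R _, LinearEquiv.refl R _, LinearEquiv.refl R _, fun ω => ?_,
        fun x y z => rfl⟩
      simp [exteriorPower.map_id]
    · rintro ⟨f₁, f₂, f₃, hθ, hβ⟩
      refine ⟨f₁.symm, f₂.symm, f₃.symm, fun ω => ?_, fun x y z => ?_⟩
      · rw [← hθ]
        simp only [← LinearMap.comp_apply, ← TensorProduct.map_comp, ← exteriorPower.map_comp]
        simp [exteriorPower.map_id]
      · rw [← hβ]; simp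
    · rintro ⟨f₁, f₂, f₃, hθ, hβ⟩ ⟨g₁, g₂, g₃, kθ, kβ⟩
      refine ⟨f₁.trans g₁, f₂.trans g₂, f₃.trans g₃, fun ω => ?_, fun x y z => ?_⟩
      · rw [← hθ, ← kθ]
        simp only [← LinearMap.comp_apply, ← TensorProduct.map_comp, ← exteriorPower.map_comp]
        rfl
      · rw [← hβ, ← kβ]; rfl

/-- The alternating form `(s, t) ↦ α(s ∧ t) ∈ K` on `S` given by the orientation `α`. -/
def BalancedTriple.orientForm {𝔞 : FractionalIdeal R⁰ K} (T : BalancedTriple 𝔞) :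
    T.S →ₗ[R] T.S →ₗ[R] K :=
  LinearMap.mk₂ R (fun s t => (T.orient (wedge R s t) : K))
    (fun s s' t => by rw [wedge_add_left, map_add]; rfl)
    (fun c s t => by rw [wedge_smul_left, map_smul]; rfl)
    (fun s t t' => by rw [wedge_add_right, map_add]; rfl)
    (fun c s t => by rw [wedge_smul_right, map_smul]; rfl)

/-- The `K`-bilinear extension `(x, y) ↦ α(x ∧ y)` of the form `orientForm` to `S_K`. -/
def BalancedTriple.orientFormK {𝔞 : FractionalIdeal R⁰ K} (T : BalancedTriple 𝔞) :
    (K ⊗[R] T.S) →ₗ[K] (K ⊗[R] T.S) →ₗ[K] K :=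
  LinearMap.liftBaseChange K
    (((LinearMap.liftBaseChangeEquiv K).toLinearMap.restrictScalars R) ∘ₗ T.orientForm)

/-- The box `B` arises from the balanced triple `T` if, for suitable identifications
`ιᵢ : Mᵢ ≃ Iᵢ`, one has `β(x, y, z) = α(1 ∧ xyz)`, and `θ` is the restriction of `α^{⊗3}` to
`Λ²I₁ ⊗ Λ²I₂ ⊗ Λ²I₃`. -/
def BhargavaBox.ArisesFrom {𝔞 : FractionalIdeal R⁰ K} (B : BhargavaBox 𝔞)
    (T : BalancedTriple 𝔞) : Prop :=
  ∃ (ι₁ : B.M₁ ≃ₗ[R] T.I₁.carrier) (ι₂ : B.M₂ ≃ₗ[R] T.I₂.carrier)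
    (ι₃ : B.M₃ ≃ₗ[R] T.I₃.carrier),
    (∀ x y z, (B.β x y z : K) =
      T.orientFormK 1 ((ι₁ x : K ⊗[R] T.S) * (ι₂ y : K ⊗[R] T.S) * (ι₃ z : K ⊗[R] T.S))) ∧
    ∀ x₁ y₁ x₂ y₂ x₃ y₃,
      (B.θ (wedge R x₁ y₁ ⊗ₜ[R] wedge R x₂ y₂ ⊗ₜ[R] wedge R x₃ y₃) : K) =
        T.orientFormK (ι₁ x₁) (ι₁ y₁) * T.orientFormK (ι₂ x₂) (ι₂ y₂) *
          T.orientFormK (ι₃ x₃) (ι₃ y₃)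

end

end IdealTriples

/-!
A quadratic algebra `S` with an orientation `α` is, over `K`, an algebra `K[ω]` with
`ω² = a + b ω`, and `α` becomes the alternating form `area` that takes the value `1` at `(1, ω)`;
this holds in every characteristic and for degenerate algebras
(`exists_orientationForm_eq_area`). In these coordinates all statements about `(S, α)` are
statements about the two forms `area x y` and `area 1 (x * y * z)`. A balanced triple visibly gives
a box (`exists_arisesFrom`), unique up to isomorphism (`isomorphic_of_arisesFrom`). It remains to
see that a box determines its triple, and that every box comes from one.

*Uniqueness.* For fixed `x`, the determinant of the bilinear form `(y, z) ↦ area 1 (x * y * z)` is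
`-N(x)`, up to the discriminants of the chosen vectors (`area_one_mul_det`). Hence linear maps
`g₁, g₂, g₃` that preserve `area 1 (x * y * z)` and the product of the three discriminants multiply
the norm by constants. So `g₁ 1` and `g₂ 1` are units, even when the algebra is degenerate. After
division by these units one obtains a unital map that preserves norm and area, and such a map is
multiplicative (`exists_algEquiv_of_trilinear`). That this isomorphism over `K` carries `S` to `S'`
follows because `S` can be recovered from any one of its ideals: it consists of the multipliers `x`
of the ideal with `α(1 ∧ x) ∈ 𝔞` (`mem_unitLattice_iff`).

*Existence.* Every rank-two lattice is `b 0 • e 0 ⊕ b 1 • e 1` for fractional ideals `b 0, b 1`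
(`PseudoBasis`), and any nonzero vector of it can be taken as `e 0` (`exists_pseudoBasis`). In such
coordinates a box is a cube of eight coefficients together with the value `D` of `θ` at the basis
vectors. Each direction of the cube gives a binary quadratic form, whose value at `x` is minus the
determinant of `β x`, divided by `D`. Nondegeneracy of the box implies that these forms do not
vanish identically (`exists_cube_det_ne_zero`), so the bases can be chosen such that the forms of
the first two directions do not vanish at the first basis vector. Then there are explicit formulas
for the algebra, the generators of the three ideals and their products in terms of the cube, over
`K` (`cubeVec_mul`, `area_cubeVec`, `omega_mul_cubeVecOne` and its analogues). The formulas involve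
denominators, but the structure constants are polynomials in the coefficients times `D⁻¹`, and
counting the ideals `b` and `𝔞` in them shows that everything is integral (`IsIntegralCube`). So
`R ⊕ 𝔞 ω` is an order, the lattices become ideals in it, and the triple is balanced
(`exists_balancedTriple`).
-/

namespace IdealTriples

noncomputable section

/-! ### Lattices in vector spaces over the fraction field -/

section Rank

variable {R K : Type*} [CommRing R] [IsDomain R] [Field K] [Algebra R K] [IsFractionRing R K]

/-- A vector in the `K`-span of an `R`-submodule lies in it after clearing denominators. -/
theorem exists_smul_mem_of_mem_span {V : Type*} [AddCommGroup V] [Module K V] [Module R V]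
    [IsScalarTower R K V] (N : Submodule R V) {v : V}
    (hv : v ∈ Submodule.span K (N : Set V)) : ∃ r : R, r ≠ 0 ∧ r • v ∈ N := by
  induction hv using Submodule.span_induction with
  | mem x hx => exact ⟨1, one_ne_zero, by simpa using hx⟩
  | zero => exact ⟨1, one_ne_zero, by simp⟩
  | add x y _ _ hx hy =>
    obtain ⟨r, hr, hrx⟩ := hx
    obtain ⟨s, hs, hsy⟩ := hy
    refine ⟨r * s, mul_ne_zero hr hs, ?_⟩
    rw [smul_add, mul_comm, mul_smul, mul_comm, mul_smul]
    exact N.add_mem (N.smul_mem _ hrx) (N.smul_mem _ hsy)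
  | smul k x _ hx =>
    obtain ⟨r, hr, hrx⟩ := hx
    obtain ⟨⟨s, hs⟩, t, ht⟩ := IsLocalization.exists_integer_multiple R⁰ k
    refine ⟨s * r, mul_ne_zero (nonZeroDivisors.ne_zero hs) hr, ?_⟩
    have : (s * r) • k • x = t • r • x := by
      rw [← algebraMap_smul K t, ht, mul_smul, smul_assoc, smul_comm r k x]
    rw [this]
    exact N.smul_mem _ hrx

/-- The rank of an `R`-submodule of a `K`-vector space is the dimension of its `K`-span. -/
theorem finrank_eq_finrank_span {V : Type*} [AddCommGroup V] [Module K V] [Module R V]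
    [IsScalarTower R K V] (N : Submodule R V) :
    Module.finrank R N = Module.finrank K (Submodule.span K (N : Set V)) := by
  let f : N →ₗ[R] Submodule.span K (N : Set V) :=
    { toFun := fun x => ⟨x, Submodule.subset_span x.2⟩
      map_add' := fun _ _ => rfl
      map_smul' := fun _ _ => rfl }
  have hf : IsLocalizedModule R⁰ f :=
    { map_units := fun r => by
        have hr : algebraMap R K r ≠ 0 := by simp
        rw [Module.End.isUnit_iff]
        refine ⟨fun x y h => ?_, fun x => ⟨(algebraMap R K r)⁻¹ • x, ?_⟩⟩
        · have h' : (r : R) • x = (r : R) • y := h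
          rw [← algebraMap_smul K (r : R) x, ← algebraMap_smul K (r : R) y] at h'
          exact smul_right_injective _ hr h'
        · change (r : R) • (algebraMap R K r)⁻¹ • x = x
          rw [← algebraMap_smul K (r : R), smul_smul, mul_inv_cancel₀ hr, one_smul]
      surj := fun y => by
        obtain ⟨r, hr, h⟩ := exists_smul_mem_of_mem_span N y.2
        exact ⟨(⟨r • (y : V), h⟩, ⟨r, mem_nonZeroDivisors_of_ne_zero hr⟩), rfl⟩
      exists_of_eq := fun {x y} h => ⟨1, by
        have : (x : V) = y := congrArg (fun z : Submodule.span K (N : Set V) => (z : V)) h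
        rw [Subtype.ext this]⟩ }
  rw [IsLocalization.finrank_eq K R⁰ le_rfl, IsLocalizedModule.finrank_eq R⁰ f le_rfl]

theorem finrank_eq_of_span_eq_top {V : Type*} [AddCommGroup V] [Module K V] [Module R V]
    [IsScalarTower R K V] (N : Submodule R V) (h : Submodule.span K (N : Set V) = ⊤) :
    Module.finrank R N = Module.finrank K V := by
  rw [finrank_eq_finrank_span (K := K), h, finrank_top]

omit [IsDomain R] in
theorem finrank_baseChange (M : Type*) [AddCommGroup M] [Module R M] :
    Module.finrank K (K ⊗[R] M) = Module.finrank R M := by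
  rw [IsLocalization.finrank_eq K R⁰ le_rfl,
    IsLocalizedModule.finrank_eq R⁰ (TensorProduct.mk R K M 1) le_rfl]

theorem mk_one_injective (M : Type*) [AddCommGroup M] [Module R M] [Module.IsTorsionFree R M] :
    Function.Injective (TensorProduct.mk R K M 1) := by
  intro x y h
  obtain ⟨⟨c, hc⟩, h⟩ := (IsLocalizedModule.eq_iff_exists R⁰ (TensorProduct.mk R K M 1)).1 h
  exact smul_right_injective M (nonZeroDivisors.ne_zero hc) h

/-- A common denominator for two elements of the fraction field. -/
theorem exists_common_denominator (p : Fin 2 → K) :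
    ∃ r : R, r ≠ 0 ∧ ∃ s : Fin 2 → R, ∀ i, algebraMap R K (s i) = algebraMap R K r * p i := by
  obtain ⟨⟨r, hr⟩, h⟩ := IsLocalization.exist_integer_multiples_of_finite R⁰ p
  choose s hs using h
  exact ⟨r, nonZeroDivisors.ne_zero hr, s, fun i => by rw [hs, Algebra.smul_def]⟩

end Rank

theorem IsRankTwoLattice.projective {R M : Type*} [CommRing R] [IsDedekindDomain R]
    [AddCommGroup M] [Module R M] (h : IsRankTwoLattice R M) : Module.Projective R M := by
  have := h.finite
  have := h.torsionFree
  have := Module.finitePresentation_of_finite R M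
  exact Module.Flat.projective_of_finitePresentation

/-! ### Pseudo-bases of lattices of rank two -/

/-- A pseudo-basis of a lattice `M` of rank two: it identifies `M` with `b 0 ⊕ b 1` for two
fractional ideals `b i`, by means of coordinates `c i : M → K`. The ideals are normalized to
contain `1`, so that the vectors `e i` with coordinates `(1, 0)` and `(0, 1)` lie in `M`. -/
structure PseudoBasis (R K M : Type*) [CommRing R] [IsDomain R] [Field K] [Algebra R K]
    [AddCommGroup M] [Module R M] where
  e : Fin 2 → M
  c : Fin 2 → M →ₗ[R] K
  b : Fin 2 → FractionalIdeal R⁰ K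
  c_e : ∀ i j, c i (e j) = if i = j then 1 else 0
  c_mem : ∀ i m, c i m ∈ b i
  exists_eq : ∀ p : Fin 2 → K, (∀ i, p i ∈ b i) → ∃ m, ∀ i, c i m = p i
  eq_zero : ∀ m, (∀ i, c i m = 0) → m = 0

section Existence

variable {R K : Type*} [CommRing R] [IsDedekindDomain R] [Field K] [Algebra R K]
  [IsFractionRing R K]

/-- Every nonzero vector of a lattice of rank two is the first vector of a pseudo-basis: the
quotient by its saturated span is a torsion-free module of rank one, hence projective. -/
theorem exists_pseudoBasis {M : Type*} [AddCommGroup M] [Module R M] (hM : IsRankTwoLattice R M)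
    (v : M) (hv : v ≠ 0) : ∃ P : PseudoBasis R K M, P.e 0 = v := by
  have := hM.finite
  have := hM.torsionFree
  have hinj := mk_one_injective (R := R) (K := K) M
  have hdim : Module.finrank K (K ⊗[R] M) = 2 := (finrank_baseChange M).trans hM.finrank_eq
  set v' : K ⊗[R] M := TensorProduct.mk R K M 1 v with hv'
  have hv0 : v' ≠ 0 := fun h => hv (hinj (by rw [← hv', h, map_zero]))
  have : FiniteDimensional K (K ⊗[R] M) := Module.finite_of_finrank_eq_succ hdim
  obtain ⟨w', hw'⟩ := exists_linearIndependent_pair_of_one_lt_finrank (by rw [hdim]; norm_num) hv0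
  let B : Module.Basis (Fin 2) K (K ⊗[R] M) := basisOfLinearIndependentOfCardEqFinrank hw'
    (by simp [hdim])
  have hB0 : B 0 = v' := by simp [B]
  -- coordinates with respect to a `K`-basis extending `v`
  let d : Fin 2 → M →ₗ[R] K := fun i =>
    (B.coord i).restrictScalars R ∘ₗ TensorProduct.mk R K M 1
  have hd0 : d 0 v = 1 := by
    change B.coord 0 v' = 1
    rw [← hB0]; simp
  have hd1 : d 1 v = 0 := by
    change B.coord 1 v' = 0
    rw [← hB0]; simp
  have hdinj : ∀ m, d 0 m = 0 → d 1 m = 0 → m = 0 := by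
    intro m h0 h1
    apply hinj
    rw [map_zero]
    apply B.ext_elem
    intro i
    fin_cases i
    · exact (show B.repr _ 0 = 0 from h0).trans (by simp)
    · exact (show B.repr _ 1 = 0 from h1).trans (by simp)
  have hd1ne : ∃ m, d 1 m ≠ 0 := by
    by_contra! h
    have : B.coord 1 = 0 := by
      refine LinearMap.ext fun x => ?_
      induction x using TensorProduct.induction_on with
      | zero => simp
      | tmul k m =>
        have h1 : k ⊗ₜ[R] m = k • TensorProduct.mk R K M 1 m := by
          simp [TensorProduct.smul_tmul']
        rw [h1, map_smul]
        have := h m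
        change B.coord 1 _ = 0 at this
        rw [this]; simp
      | add x y hx hy => rw [map_add, hx, hy]; simp
    have h2 := congrArg (fun f => f (B 1)) this
    simp at h2
  -- the projection of `M` to the second coordinate splits
  have hproj : Module.Projective R (LinearMap.range (d 1)) := by
    have := Module.finitePresentation_of_finite R (LinearMap.range (d 1))
    have : Module.IsTorsionFree R K := inferInstance
    exact Module.Flat.projective_of_finitePresentation
  obtain ⟨s, hs⟩ := Module.projective_lifting_property (d 1).rangeRestrict LinearMap.id
    (LinearMap.surjective_rangeRestrict _)
  have hs' : ∀ x, d 1 (s x) = x := fun x => congrArg Subtype.val (LinearMap.congr_fun hs x)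
  obtain ⟨m₁, hm₁⟩ := hd1ne
  set u := d 1 m₁ with hu
  let w : M := s ⟨u, m₁, rfl⟩
  let c0 : M →ₗ[R] K := d 0 - d 0 ∘ₗ s ∘ₗ (d 1).rangeRestrict
  let c1 : M →ₗ[R] K := LinearMap.mulLeft R u⁻¹ ∘ₗ d 1
  have hfrac : ∀ f : M →ₗ[R] K, IsFractional R⁰ (LinearMap.range f) := fun f =>
    FractionalIdeal.isFractional_of_fg (Module.Finite.iff_fg.1 inferInstance)
  have hd1w : d 1 w = u := hs' _
  have hs0 : ∀ m, d 1 m = 0 → (d 1).rangeRestrict m = 0 := fun m hm => Subtype.ext hm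
  let c : Fin 2 → M →ₗ[R] K := ![c0, c1]
  have hc0 : ∀ m, c 0 m = d 0 m - d 0 (s ((d 1).rangeRestrict m)) := fun m => rfl
  have hc1 : ∀ m, c 1 m = u⁻¹ * d 1 m := fun m => rfl
  have hsw : (d 1).rangeRestrict w = ⟨u, m₁, rfl⟩ := Subtype.ext hd1w
  refine ⟨⟨![v, w], c, fun i => ⟨LinearMap.range (c i), hfrac _⟩, ?_, fun i m => ⟨m, rfl⟩, ?_, ?_⟩,
    rfl⟩
  · intro i j
    fin_cases i <;> fin_cases j
    · change c 0 v = 1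
      rw [hc0, hs0 v hd1, map_zero, map_zero, hd0, sub_zero]
    · change c 0 w = 0
      rw [hc0, hsw]
      exact sub_self _
    · change c 1 v = 0
      rw [hc1, hd1, mul_zero]
    · change c 1 w = 1
      rw [hc1, hd1w, inv_mul_cancel₀ hm₁]
  · intro p hp
    obtain ⟨m, hm⟩ := hp 0
    obtain ⟨m', hm'⟩ := hp 1
    refine ⟨m - s ((d 1).rangeRestrict m) + s ((d 1).rangeRestrict m'), fun i => ?_⟩
    have h1 : d 1 (m - s ((d 1).rangeRestrict m) + s ((d 1).rangeRestrict m')) = d 1 m' := by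
      rw [map_add, map_sub, hs', hs']
      simp
    fin_cases i
    · change c 0 _ = p 0
      have h2 : (d 1).rangeRestrict (m - s ((d 1).rangeRestrict m) + s ((d 1).rangeRestrict m')) =
        (d 1).rangeRestrict m' := Subtype.ext h1
      rw [hc0, h2, ← hm, hc0, map_add, map_sub]
      ring
    · change c 1 _ = p 1
      rw [hc1, h1, ← hm', hc1]
  · intro m hm
    have h1 : d 1 m = 0 := by
      have := hm 1
      rw [hc1] at this
      exact (mul_eq_zero.1 this).resolve_left (inv_ne_zero hm₁)
    refine hdinj m ?_ h1
    have := hm 0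
    rwa [hc0, hs0 m h1, map_zero, map_zero, sub_zero] at this

end Existence

namespace PseudoBasis

variable {R K M : Type*} [CommRing R] [IsDomain R] [Field K] [Algebra R K]
  [AddCommGroup M] [Module R M] (P : PseudoBasis R K M)

theorem c_self (i : Fin 2) : P.c i (P.e i) = 1 := by simp [P.c_e]

theorem one_mem (i : Fin 2) : (1 : K) ∈ P.b i := P.c_self i ▸ P.c_mem i (P.e i)

theorem b_ne_zero (i : Fin 2) : P.b i ≠ 0 := fun h => by
  have := P.one_mem i
  rw [h, FractionalIdeal.mem_zero_iff] at this
  exact one_ne_zero this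

theorem ext {m m' : M} (h : ∀ i, P.c i m = P.c i m') : m = m' :=
  sub_eq_zero.1 (P.eq_zero _ fun i => by rw [map_sub, h, sub_self])

variable [IsFractionRing R K]

/-- After clearing denominators, a vector is a combination of the vectors `e i`. -/
theorem exists_smul_eq (m : M) : ∃ r : R, r ≠ 0 ∧ ∃ s : Fin 2 → R,
    (∀ i, algebraMap R K (s i) = algebraMap R K r * P.c i m) ∧
      r • m = s 0 • P.e 0 + s 1 • P.e 1 := by
  obtain ⟨r, hr, s, hs⟩ := exists_common_denominator (R := R) fun i => P.c i m
  refine ⟨r, hr, s, hs, P.ext fun i => ?_⟩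
  simp only [map_smul, map_add, P.c_e, Algebra.smul_def, hs]
  fin_cases i <;> simp

/-- A linear map to a `K`-vector space is determined by the images of the vectors `e i`. -/
theorem map_eq {W : Type*} [AddCommGroup W] [Module K W] [Module R W] [IsScalarTower R K W]
    (f : M →ₗ[R] W) (m : M) : f m = P.c 0 m • f (P.e 0) + P.c 1 m • f (P.e 1) := by
  obtain ⟨r, hr, s, hs, h⟩ := P.exists_smul_eq m
  have hr' : algebraMap R K r ≠ 0 := by simpa using hr
  have h' : r • f m = s 0 • f (P.e 0) + s 1 • f (P.e 1) := by
    rw [← map_smul, h, map_add, map_smul, map_smul]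
  rw [← algebraMap_smul K, ← algebraMap_smul K (s 0), ← algebraMap_smul K (s 1), hs, hs,
    mul_smul, mul_smul] at h'
  rw [← smul_add] at h'
  exact smul_right_injective W hr' h'

/-- An alternating form is the determinant of the coordinates, times its value at
`(e 0, e 1)`. -/
theorem alternating_eq (ω : M →ₗ[R] M →ₗ[R] K) (hω : ω.IsAlt) (x y : M) :
    ω x y = (P.c 0 x * P.c 1 y - P.c 1 x * P.c 0 y) * ω (P.e 0) (P.e 1) := by
  have h10 : ω (P.e 1) (P.e 0) = -ω (P.e 0) (P.e 1) := by
    rw [← hω.neg]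
  have : ∀ z, ω z y = P.c 0 y * ω z (P.e 0) + P.c 1 y * ω z (P.e 1) := fun z => P.map_eq (ω z) y
  have h2 : ω x y = P.c 0 x * ω (P.e 0) y + P.c 1 x * ω (P.e 1) y := P.map_eq (ω.flip y) x
  rw [h2, this, this, hω (P.e 0), hω (P.e 1), h10]
  ring

/-- The vectors `e i` stay independent over `K` in every `K`-vector space that contains `M`. -/
theorem linearIndependent_e {W : Type*} [AddCommGroup W] [Module K W] [Module R W]
    [IsScalarTower R K W] (f : M →ₗ[R] W) (hf : Function.Injective f) (s : Fin 2 → K)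
    (h : s 0 • f (P.e 0) + s 1 • f (P.e 1) = 0) : s = 0 := by
  obtain ⟨r, hr, t, ht⟩ := exists_common_denominator (R := R) s
  have hr' : algebraMap R K r ≠ 0 := by simpa using hr
  have h0 : t 0 • P.e 0 + t 1 • P.e 1 = 0 := hf <| by
    rw [map_add, map_smul, map_smul, ← algebraMap_smul K, ← algebraMap_smul K (t 1), ht, ht,
      mul_smul, mul_smul, ← smul_add, h, smul_zero, map_zero]
  ext i
  have h1 := congrArg (P.c i) h0
  have h2 : algebraMap R K (t i) = 0 := by
    simp only [map_smul, map_add, P.c_e, Algebra.smul_def, map_zero] at h1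
    fin_cases i <;> simpa using h1
  rw [ht] at h2
  exact (mul_eq_zero.1 h2).resolve_left hr'

end PseudoBasis

/-! ### Second exterior powers and their triple tensor products -/

section Wedge

variable {R : Type*} [CommRing R]

/-- The linear map on `Λ²M` given by an alternating bilinear form. -/
def wedgeLift {M N : Type*} [AddCommGroup M] [Module R M] [AddCommGroup N] [Module R N]
    (ω : M →ₗ[R] M →ₗ[R] N) (hω : ω.IsAlt) : ⋀[R]^2 M →ₗ[R] N :=
  exteriorPower.alternatingMapLinearEquiv
    { toFun := fun v => ω (v 0) (v 1)
      map_update_add' := fun v i x y => by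
        fin_cases i <;> simp
      map_update_smul' := fun v i r x => by
        fin_cases i <;> simp
      map_eq_zero_of_eq' := fun v i j h hij => by
        have h01 : v 0 = v 1 := by
          fin_cases i <;> fin_cases j <;> first | exact absurd rfl hij | exact h | exact h.symm
        rw [h01]
        exact hω _ }

theorem wedgeLift_wedge {M N : Type*} [AddCommGroup M] [Module R M] [AddCommGroup N] [Module R N]
    (ω : M →ₗ[R] M →ₗ[R] N) (hω : ω.IsAlt) (x y : M) :
    wedgeLift ω hω (wedge R x y) = ω x y := by
  unfold wedgeLift wedge
  rw [exteriorPower.alternatingMapLinearEquiv_apply_ιMulti]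
  rfl

theorem wedge_self {M : Type*} [AddCommGroup M] [Module R M] (x : M) : wedge R x x = 0 :=
  (exteriorPower.ιMulti R 2 (M := M)).map_eq_zero_of_eq ![x, x] (i := 0) (j := 1) rfl (by simp)

/-- The wedge product as a bilinear map. -/
def wedgeMap (R M : Type*) [CommRing R] [AddCommGroup M] [Module R M] :
    M →ₗ[R] M →ₗ[R] ⋀[R]^2 M :=
  LinearMap.mk₂ R (wedge R) wedge_add_left wedge_smul_left wedge_add_right wedge_smul_right

theorem wedgeMap_isAlt (M : Type*) [AddCommGroup M] [Module R M] : (wedgeMap R M).IsAlt :=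
  fun x => wedge_self x

theorem wedge_induction {M : Type*} [AddCommGroup M] [Module R M] {p : ⋀[R]^2 M → Prop}
    (wedge : ∀ x y, p (wedge R x y)) (zero : p 0) (add : ∀ x y, p x → p y → p (x + y))
    (smul : ∀ (r : R) x, p x → p (r • x)) (ω : ⋀[R]^2 M) : p ω := by
  have h : ω ∈ Submodule.span R (Set.range (exteriorPower.ιMulti R 2 (M := M))) := by
    rw [exteriorPower.ιMulti_span]; trivial
  induction h using Submodule.span_induction with
  | mem x hx =>
    obtain ⟨v, rfl⟩ := hx
    have : v = ![v 0, v 1] := by ext i; fin_cases i <;> rfl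
    rw [this]
    exact wedge _ _
  | zero => exact zero
  | add x y _ _ hx hy => exact add x y hx hy
  | smul r x _ hx => exact smul r x hx

theorem map_wedge {M N : Type*} [AddCommGroup M] [Module R M] [AddCommGroup N] [Module R N]
    (f : M →ₗ[R] N) (x y : M) : exteriorPower.map 2 f (wedge R x y) = wedge R (f x) (f y) := by
  unfold wedge
  rw [exteriorPower.map_apply_ιMulti]
  congr 1
  ext i; fin_cases i <;> rfl

theorem wedge_linearMap_ext {M N : Type*} [AddCommGroup M] [Module R M] [AddCommGroup N]
    [Module R N] {f g : ⋀[R]^2 M →ₗ[R] N} (h : ∀ x y, f (wedge R x y) = g (wedge R x y)) :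
    f = g := by
  refine LinearMap.ext fun ω => ?_
  induction ω using wedge_induction with
  | wedge x y => exact h x y
  | zero => simp
  | add x y hx hy => rw [map_add, map_add, hx, hy]
  | smul r x hx => rw [map_smul, map_smul, hx]

theorem wedge_triple_ext {M₁ M₂ M₃ N : Type*} [AddCommGroup M₁] [Module R M₁] [AddCommGroup M₂]
    [Module R M₂] [AddCommGroup M₃] [Module R M₃] [AddCommGroup N] [Module R N]
    {f g : (⋀[R]^2 M₁) ⊗[R] (⋀[R]^2 M₂) ⊗[R] (⋀[R]^2 M₃) →ₗ[R] N}
    (h : ∀ x₁ y₁ x₂ y₂ x₃ y₃, f (wedge R x₁ y₁ ⊗ₜ[R] wedge R x₂ y₂ ⊗ₜ[R] wedge R x₃ y₃) =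
      g (wedge R x₁ y₁ ⊗ₜ[R] wedge R x₂ y₂ ⊗ₜ[R] wedge R x₃ y₃)) : f = g := by
  refine TensorProduct.ext (TensorProduct.ext (wedge_linearMap_ext fun x₁ y₁ =>
    wedge_linearMap_ext fun x₂ y₂ => wedge_linearMap_ext fun x₃ y₃ => h x₁ y₁ x₂ y₂ x₃ y₃))

/-- The second exterior power of a finite projective module is projective, being a direct summand
of the second exterior power of a finite free module. -/
theorem projective_wedge (M : Type*) [AddCommGroup M] [Module R M] [Module.Finite R M]
    [Module.Projective R M] : Module.Projective R (⋀[R]^2 M) := by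
  obtain ⟨n, f, hf⟩ := Module.Finite.exists_fin' R M
  obtain ⟨g, hg⟩ := Module.projective_lifting_property f LinearMap.id hf
  refine Module.Projective.of_split (exteriorPower.map 2 g) (exteriorPower.map 2 f) ?_
  rw [← exteriorPower.map_comp, hg, exteriorPower.map_id]

/-- The linear form `(x₁ ∧ y₁) ⊗ (x₂ ∧ y₂) ⊗ (x₃ ∧ y₃) ↦ ω₁(x₁, y₁) ω₂(x₂, y₂) ω₃(x₃, y₃)` given
by three alternating forms. -/
def wedgeTripleLift {K : Type*} [CommRing K] [Algebra R K] {M₁ M₂ M₃ : Type*}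
    [AddCommGroup M₁] [Module R M₁] [AddCommGroup M₂] [Module R M₂] [AddCommGroup M₃] [Module R M₃]
    (ω₁ : M₁ →ₗ[R] M₁ →ₗ[R] K) (h₁ : ω₁.IsAlt) (ω₂ : M₂ →ₗ[R] M₂ →ₗ[R] K) (h₂ : ω₂.IsAlt)
    (ω₃ : M₃ →ₗ[R] M₃ →ₗ[R] K) (h₃ : ω₃.IsAlt) :
    (⋀[R]^2 M₁) ⊗[R] (⋀[R]^2 M₂) ⊗[R] (⋀[R]^2 M₃) →ₗ[R] K :=
  LinearMap.mul' R K ∘ₗ TensorProduct.map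
    (LinearMap.mul' R K ∘ₗ TensorProduct.map (wedgeLift ω₁ h₁) (wedgeLift ω₂ h₂)) (wedgeLift ω₃ h₃)

theorem wedgeTripleLift_apply {K : Type*} [CommRing K] [Algebra R K] {M₁ M₂ M₃ : Type*}
    [AddCommGroup M₁] [Module R M₁] [AddCommGroup M₂] [Module R M₂] [AddCommGroup M₃] [Module R M₃]
    (ω₁ : M₁ →ₗ[R] M₁ →ₗ[R] K) (h₁ : ω₁.IsAlt) (ω₂ : M₂ →ₗ[R] M₂ →ₗ[R] K) (h₂ : ω₂.IsAlt)
    (ω₃ : M₃ →ₗ[R] M₃ →ₗ[R] K) (h₃ : ω₃.IsAlt) (x₁ y₁ x₂ y₂ x₃ y₃) :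
    wedgeTripleLift ω₁ h₁ ω₂ h₂ ω₃ h₃
      (wedge R x₁ y₁ ⊗ₜ[R] wedge R x₂ y₂ ⊗ₜ[R] wedge R x₃ y₃) = ω₁ x₁ y₁ * ω₂ x₂ y₂ * ω₃ x₃ y₃ := by
  simp [wedgeTripleLift, wedgeLift_wedge]

end Wedge

/-! ### Modules of rank one -/

section RankOne

variable {R : Type*} [CommRing R] [IsDomain R]

/-- Every element of `P` has a nonzero multiple that is a multiple of `g`. -/
def GeneratesUpToTorsion (P : Type*) [AddCommMonoid P] [Module R P] (g : P) : Prop :=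
  ∀ x : P, ∃ r : R, r ≠ 0 ∧ ∃ s : R, r • x = s • g

theorem GeneratesUpToTorsion.add_aux {P : Type*} [AddCommMonoid P] [Module R P] {g x y : P}
    (hx : ∃ r : R, r ≠ 0 ∧ ∃ s : R, r • x = s • g) (hy : ∃ r : R, r ≠ 0 ∧ ∃ s : R, r • y = s • g) :
    ∃ r : R, r ≠ 0 ∧ ∃ s : R, r • (x + y) = s • g := by
  obtain ⟨r, hr, s, h⟩ := hx
  obtain ⟨r', hr', s', h'⟩ := hy
  refine ⟨r * r', mul_ne_zero hr hr', r' * s + r * s', ?_⟩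
  rw [smul_add, add_smul, mul_smul, mul_smul, mul_smul, mul_smul, ← h, ← h', smul_comm r r' x]

theorem GeneratesUpToTorsion.tmul {P Q : Type*} [AddCommMonoid P] [Module R P] [AddCommMonoid Q]
    [Module R Q] {g : P} {h : Q} (hg : GeneratesUpToTorsion (R := R) P g)
    (hh : GeneratesUpToTorsion (R := R) Q h) :
    GeneratesUpToTorsion (R := R) (P ⊗[R] Q) (g ⊗ₜ[R] h) := by
  intro x
  induction x using TensorProduct.induction_on with
  | zero => exact ⟨1, one_ne_zero, 0, by simp⟩
  | tmul x y =>
    obtain ⟨r, hr, s, h⟩ := hg x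
    obtain ⟨r', hr', s', h'⟩ := hh y
    refine ⟨r * r', mul_ne_zero hr hr', s * s', ?_⟩
    rw [← TensorProduct.smul_tmul_smul, h, h', TensorProduct.smul_tmul_smul]
  | add x y hx hy => exact GeneratesUpToTorsion.add_aux hx hy

/-- On a torsion-free module of rank one, a map to the fraction field that does not vanish at a
generator up to torsion is injective. -/
theorem GeneratesUpToTorsion.injective {K P : Type*} [Field K] [Algebra R K] [IsFractionRing R K]
    [AddCommMonoid P] [Module R P] [Module.IsTorsionFree R P] {g : P}
    (hg : GeneratesUpToTorsion (R := R) P g) (f : P →ₗ[R] K) (hf : f g ≠ 0) :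
    Function.Injective f := by
  intro x y hxy
  obtain ⟨r, hr, s, h⟩ := hg x
  obtain ⟨r', hr', s', h'⟩ := hg y
  have hs : r' * s = r * s' := by
    apply IsFractionRing.injective R K
    apply mul_right_cancel₀ hf
    rw [← Algebra.smul_def, ← Algebra.smul_def, mul_smul, mul_smul, ← map_smul, ← h,
      ← map_smul f s', ← h', map_smul, map_smul, hxy, smul_comm]
  have key : (r * r') • x = (r * r') • y := by
    rw [mul_comm, mul_smul, h, ← mul_smul, hs, mul_smul, ← h', ← mul_smul, mul_comm r']
  exact smul_right_injective P (mul_ne_zero hr hr') key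

variable {K : Type*} [Field K] [Algebra R K] [IsFractionRing R K]

theorem PseudoBasis.generatesUpToTorsion {M : Type*} [AddCommGroup M] [Module R M]
    (P : PseudoBasis R K M) : GeneratesUpToTorsion (R := R) (⋀[R]^2 M)
      (wedge R (P.e 0) (P.e 1)) := by
  intro ω
  induction ω using wedge_induction with
  | wedge x y =>
    obtain ⟨r, hr, s, -, h⟩ := P.exists_smul_eq x
    obtain ⟨r', hr', s', -, h'⟩ := P.exists_smul_eq y
    refine ⟨r * r', mul_ne_zero hr hr', s 0 * s' 1 - s 1 * s' 0, ?_⟩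
    have h10 : wedge R (P.e 1) (P.e 0) = -wedge R (P.e 0) (P.e 1) :=
      ((wedgeMap_isAlt M).neg (P.e 0) (P.e 1)).symm
    rw [mul_comm, mul_smul, ← wedge_smul_left, ← wedge_smul_right, h, h']
    simp only [wedge_add_left, wedge_add_right, wedge_smul_left, wedge_smul_right, wedge_self, h10]
    module
  | zero => exact ⟨1, one_ne_zero, 0, by simp⟩
  | add x y hx hy => exact GeneratesUpToTorsion.add_aux hx hy
  | smul c x hx =>
    obtain ⟨r, hr, s, h⟩ := hx
    exact ⟨r, hr, c * s, by rw [smul_comm, h, mul_smul]⟩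

end RankOne

section Dedekind

variable {R K : Type*} [CommRing R] [IsDedekindDomain R] [Field K] [Algebra R K]
  [IsFractionRing R K]

theorem IsRankTwoLattice.exists_ne_zero {M : Type*} [AddCommGroup M] [Module R M]
    (hM : IsRankTwoLattice R M) : ∃ v : M, v ≠ 0 := by
  by_contra! h
  have : Subsingleton M := ⟨fun x y => by rw [h x, h y]⟩
  have := hM.finrank_eq
  rw [Module.finrank_zero_of_subsingleton] at this
  norm_num at this

theorem IsRankTwoLattice.nonempty_pseudoBasis {M : Type*} [AddCommGroup M] [Module R M]
    (hM : IsRankTwoLattice R M) : Nonempty (PseudoBasis R K M) := by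
  obtain ⟨v, hv⟩ := hM.exists_ne_zero
  obtain ⟨P, -⟩ := exists_pseudoBasis (K := K) hM v hv
  exact ⟨P⟩

/-- An injective map to the fraction field is an isomorphism to the fractional ideal that is its
image. -/
theorem exists_equiv_fractionalIdeal {R K : Type*} [CommRing R] [Field K] [Algebra R K]
    {P : Type*} [AddCommMonoid P] [Module R P] (f : P →ₗ[R] K)
    (hf : Function.Injective f) (𝔟 : FractionalIdeal R⁰ K)
    (h : LinearMap.range f = (𝔟 : Submodule R K)) :
    ∃ e : P ≃ₗ[R] 𝔟, ∀ x, (e x : K) = f x :=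
  ⟨(LinearEquiv.ofInjective f hf).trans (LinearEquiv.ofEq _ _ h), fun _ => rfl⟩

/-- `Λ²M` is isomorphic to the fractional ideal generated by the values of a nonzero alternating
form on `M`. -/
theorem exists_wedge_equiv {M : Type*} [AddCommGroup M] [Module R M] (hM : IsRankTwoLattice R M)
    (ω : M →ₗ[R] M →ₗ[R] K) (hω : ω.IsAlt) (𝔟 : FractionalIdeal R⁰ K) (h𝔟 : 𝔟 ≠ 0)
    (h : Submodule.span R {t | ∃ x y, t = ω x y} = (𝔟 : Submodule R K)) :
    ∃ e : (⋀[R]^2 M) ≃ₗ[R] 𝔟, ∀ x y, (e (wedge R x y) : K) = ω x y := by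
  have := hM.finite
  have := hM.projective
  have := projective_wedge (R := R) M
  obtain ⟨P⟩ := hM.nonempty_pseudoBasis (K := K)
  have hne : ω (P.e 0) (P.e 1) ≠ 0 := fun h0 => h𝔟 <| by
    rw [← FractionalIdeal.coeToSubmodule_eq_bot, ← h, Submodule.span_eq_bot]
    rintro t ⟨x, y, rfl⟩
    rw [P.alternating_eq ω hω, h0, mul_zero]
  obtain ⟨e, he⟩ := exists_equiv_fractionalIdeal (wedgeLift ω hω)
    (P.generatesUpToTorsion.injective _ (by rwa [wedgeLift_wedge])) 𝔟 (by
      rw [← h]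
      refine le_antisymm ?_ (Submodule.span_le.2 ?_)
      · rintro _ ⟨w, rfl⟩
        induction w using wedge_induction with
        | wedge x y => exact Submodule.subset_span ⟨x, y, wedgeLift_wedge ω hω x y⟩
        | zero => rw [map_zero]; exact zero_mem _
        | add x y hx hy => rw [map_add]; exact add_mem hx hy
        | smul r x hx => rw [map_smul]; exact Submodule.smul_mem _ _ hx
      · rintro t ⟨x, y, rfl⟩
        exact ⟨wedge R x y, wedgeLift_wedge ω hω x y⟩)
  exact ⟨e, fun x y => by rw [he, wedgeLift_wedge]⟩

theorem range_eq_span_triple {R : Type*} [CommRing R] {M₁ M₂ M₃ : Type*} [AddCommGroup M₁]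
    [Module R M₁] [AddCommGroup M₂] [Module R M₂] [AddCommGroup M₃] [Module R M₃] {N : Type*}
    [AddCommGroup N] [Module R N] (f : (⋀[R]^2 M₁) ⊗[R] (⋀[R]^2 M₂) ⊗[R] (⋀[R]^2 M₃) →ₗ[R] N) :
    LinearMap.range f = Submodule.span R {t | ∃ x₁ y₁ x₂ y₂ x₃ y₃,
      t = f (wedge R x₁ y₁ ⊗ₜ[R] wedge R x₂ y₂ ⊗ₜ[R] wedge R x₃ y₃)} := by
  refine le_antisymm ?_ (Submodule.span_le.2 ?_)
  · set L := Submodule.span R {t | ∃ x₁ y₁ x₂ y₂ x₃ y₃,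
      t = f (wedge R x₁ y₁ ⊗ₜ[R] wedge R x₂ y₂ ⊗ₜ[R] wedge R x₃ y₃)} with hL
    have h : L.mkQ ∘ₗ f = 0 := wedge_triple_ext fun x₁ y₁ x₂ y₂ x₃ y₃ => by
      rw [LinearMap.zero_apply, LinearMap.comp_apply, Submodule.mkQ_apply,
        Submodule.Quotient.mk_eq_zero]
      exact Submodule.subset_span ⟨x₁, y₁, x₂, y₂, x₃, y₃, rfl⟩
    rintro _ ⟨w, rfl⟩
    rw [← Submodule.Quotient.mk_eq_zero L, ← Submodule.mkQ_apply]
    exact LinearMap.congr_fun h w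
  · rintro t ⟨x₁, y₁, x₂, y₂, x₃, y₃, rfl⟩
    exact ⟨_, rfl⟩

/-- The analogue of `exists_wedge_equiv` for the product of three forms. -/
theorem exists_wedge_triple_equiv {M₁ M₂ M₃ : Type*} [AddCommGroup M₁] [Module R M₁]
    [AddCommGroup M₂] [Module R M₂] [AddCommGroup M₃] [Module R M₃] (hM₁ : IsRankTwoLattice R M₁)
    (hM₂ : IsRankTwoLattice R M₂) (hM₃ : IsRankTwoLattice R M₃)
    (ω₁ : M₁ →ₗ[R] M₁ →ₗ[R] K) (h₁ : ω₁.IsAlt) (ω₂ : M₂ →ₗ[R] M₂ →ₗ[R] K) (h₂ : ω₂.IsAlt)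
    (ω₃ : M₃ →ₗ[R] M₃ →ₗ[R] K) (h₃ : ω₃.IsAlt) (𝔟 : FractionalIdeal R⁰ K) (h𝔟 : 𝔟 ≠ 0)
    (h : Submodule.span R {t | ∃ x₁ y₁ x₂ y₂ x₃ y₃, t = ω₁ x₁ y₁ * ω₂ x₂ y₂ * ω₃ x₃ y₃} =
      (𝔟 : Submodule R K)) :
    ∃ e : ((⋀[R]^2 M₁) ⊗[R] (⋀[R]^2 M₂) ⊗[R] (⋀[R]^2 M₃)) ≃ₗ[R] 𝔟, ∀ x₁ y₁ x₂ y₂ x₃ y₃,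
      (e (wedge R x₁ y₁ ⊗ₜ[R] wedge R x₂ y₂ ⊗ₜ[R] wedge R x₃ y₃) : K) =
        ω₁ x₁ y₁ * ω₂ x₂ y₂ * ω₃ x₃ y₃ := by
  have := hM₁.finite
  have := hM₁.projective
  have := projective_wedge (R := R) M₁
  have := hM₂.finite
  have := hM₂.projective
  have := projective_wedge (R := R) M₂
  have := hM₃.finite
  have := hM₃.projective
  have := projective_wedge (R := R) M₃
  obtain ⟨P₁⟩ := hM₁.nonempty_pseudoBasis (K := K)
  obtain ⟨P₂⟩ := hM₂.nonempty_pseudoBasis (K := K)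
  obtain ⟨P₃⟩ := hM₃.nonempty_pseudoBasis (K := K)
  have hne : ω₁ (P₁.e 0) (P₁.e 1) * ω₂ (P₂.e 0) (P₂.e 1) * ω₃ (P₃.e 0) (P₃.e 1) ≠ 0 :=
    fun h0 => h𝔟 <| by
      rw [← FractionalIdeal.coeToSubmodule_eq_bot, ← h, Submodule.span_eq_bot]
      rintro t ⟨x₁, y₁, x₂, y₂, x₃, y₃, rfl⟩
      rw [P₁.alternating_eq ω₁ h₁, P₂.alternating_eq ω₂ h₂, P₃.alternating_eq ω₃ h₃]
      linear_combination (P₁.c 0 x₁ * P₁.c 1 y₁ - P₁.c 1 x₁ * P₁.c 0 y₁) *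
        (P₂.c 0 x₂ * P₂.c 1 y₂ - P₂.c 1 x₂ * P₂.c 0 y₂) *
        (P₃.c 0 x₃ * P₃.c 1 y₃ - P₃.c 1 x₃ * P₃.c 0 y₃) * h0
  obtain ⟨e, he⟩ := exists_equiv_fractionalIdeal (wedgeTripleLift ω₁ h₁ ω₂ h₂ ω₃ h₃)
    (((P₁.generatesUpToTorsion.tmul P₂.generatesUpToTorsion).tmul
      P₃.generatesUpToTorsion).injective _ (by rwa [wedgeTripleLift_apply])) 𝔟 (by
      rw [← h, range_eq_span_triple]
      simp only [wedgeTripleLift_apply])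
  exact ⟨e, fun x₁ y₁ x₂ y₂ x₃ y₃ => by rw [he, wedgeTripleLift_apply]⟩

end Dedekind

/-! ### Oriented quadratic algebras over a field -/

section Algebra

variable {K : Type*} [Field K]

/-- The alternating form on `K ⊕ K ω` with value `1` at `(1, ω)`. -/
def area {a b : K} (x y : QuadraticAlgebra K a b) : K := x.re * y.im - x.im * y.re

/-- A commutative algebra of dimension two with a nonzero alternating form is `K[ω]` for a root `ω`
of a quadratic polynomial, with the form that takes the value `1` at `(1, ω)`. -/
theorem exists_quadraticAlgebra_equiv {A : Type*} [CommRing A] [Algebra K A]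
    (hA : Module.finrank K A = 2) (ω : A →ₗ[K] A →ₗ[K] K) (hω : ω.IsAlt) (hne : ω ≠ 0) :
    ∃ (a b : K) (e : A ≃ₐ[K] QuadraticAlgebra K a b), ∀ x y, ω x y = area (e x) (e y) := by
  have : FiniteDimensional K A := Module.finite_of_finrank_eq_succ hA
  have : Nontrivial A := Module.nontrivial_of_finrank_pos (R := K) (by omega)
  obtain ⟨v, hv⟩ := exists_linearIndependent_pair_of_one_lt_finrank (by rw [hA]; norm_num)
    (one_ne_zero (α := A))
  let B : Module.Basis (Fin 2) K A := basisOfLinearIndependentOfCardEqFinrank hv (by simp [hA])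
  have hB0 : B 0 = 1 := by simp [B]
  have hB1 : B 1 = v := by simp [B]
  have hexp : ∀ x : A, x = B.repr x 0 • (1 : A) + B.repr x 1 • v := fun x => by
    conv_lhs => rw [← B.sum_repr x, Fin.sum_univ_two, hB0, hB1]
  have hv1 : ω v 1 = -ω 1 v := by rw [← hω.neg]
  have hval : ∀ x y, ω x y = (B.repr x 0 * B.repr y 1 - B.repr x 1 * B.repr y 0) * ω 1 v := by
    intro x y
    conv_lhs => rw [hexp x, hexp y]
    simp only [map_add, map_smul, LinearMap.add_apply, LinearMap.smul_apply, smul_eq_mul, hω v,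
      hω 1, hv1]
    ring
  have hd : ω 1 v ≠ 0 := fun h => hne <| LinearMap.ext₂ fun x y => by
    rw [hval, h, mul_zero]; rfl
  set d := ω 1 v with hd'
  -- `d⁻¹ v` is the element `ω`, and its square gives the polynomial
  set t := d⁻¹ • v with ht
  have hexp' : ∀ x : A, x = B.repr x 0 • (1 : A) + (d * B.repr x 1) • t := fun x => by
    rw [ht, smul_smul, mul_right_comm, mul_inv_cancel₀ hd, one_mul]; exact hexp x
  let φ : QuadraticAlgebra K (B.repr (t * t) 0) (d * B.repr (t * t) 1) →ₐ[K] A :=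
    QuadraticAlgebra.lift ⟨t, hexp' _⟩
  have hφ : ∀ p q : K, φ ⟨p, q⟩ = p • (1 : A) + q • t := fun p q => by
    rw [QuadraticAlgebra.mk_eq_add_smul_omega, map_add, map_smul, AlgHom.commutes,
      Algebra.algebraMap_eq_smul_one]
    congr 2
    simp [φ, QuadraticAlgebra.lift]
  have hbij : Function.Bijective φ := by
    refine ⟨(injective_iff_map_eq_zero _).2 fun x hx => ?_,
      fun x => ⟨⟨B.repr x 0, d * B.repr x 1⟩, ?_⟩⟩
    · obtain ⟨p, q⟩ := x
      rw [hφ, ht, smul_smul] at hx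
      obtain ⟨hp, hq⟩ := LinearIndependent.pair_iff.1 hv _ _ hx
      have hq' := (mul_eq_zero.1 hq).resolve_right (inv_ne_zero hd)
      rw [hp, hq']; rfl
    · rw [hφ]; exact (hexp' x).symm
  refine ⟨_, _, (AlgEquiv.ofBijective φ hbij).symm, fun x y => ?_⟩
  have hsymm : ∀ x, (AlgEquiv.ofBijective φ hbij).symm x = ⟨B.repr x 0, d * B.repr x 1⟩ := by
    intro x
    rw [AlgEquiv.symm_apply_eq]
    exact (hexp' x).trans (hφ _ _).symm
  rw [hsymm, hsymm, hval, area]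
  ring

end Algebra

/-! ### The alternating form of an oriented quadratic algebra -/

section ValueSpan

variable {R K V : Type*} [CommRing R] [Field K] [Algebra R K] [AddCommGroup V] [Module K V]
  [Module R V]

/-- The `R`-submodule of `K` generated by the values of a form on a lattice. -/
def valueSpan (ω : V →ₗ[K] V →ₗ[K] K) (L : Submodule R V) : Submodule R K :=
  Submodule.span R {t | ∃ x ∈ L, ∃ y ∈ L, t = ω x y}

theorem valueSpan_mul_mul (ω : V →ₗ[K] V →ₗ[K] K) (L₁ L₂ L₃ : Submodule R V) :
    valueSpan ω L₁ * valueSpan ω L₂ * valueSpan ω L₃ =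
      Submodule.span R {t | ∃ x₁ ∈ L₁, ∃ y₁ ∈ L₁, ∃ x₂ ∈ L₂, ∃ y₂ ∈ L₂, ∃ x₃ ∈ L₃, ∃ y₃ ∈ L₃,
        t = ω x₁ y₁ * ω x₂ y₂ * ω x₃ y₃} := by
  unfold valueSpan
  rw [Submodule.span_mul_span, Submodule.span_mul_span]
  congr 1
  ext t
  constructor
  · rintro ⟨_, ⟨_, ⟨x₁, hx₁, y₁, hy₁, rfl⟩, _, ⟨x₂, hx₂, y₂, hy₂, rfl⟩, rfl⟩, _,
      ⟨x₃, hx₃, y₃, hy₃, rfl⟩, rfl⟩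
    exact ⟨x₁, hx₁, y₁, hy₁, x₂, hx₂, y₂, hy₂, x₃, hx₃, y₃, hy₃, rfl⟩
  · rintro ⟨x₁, hx₁, y₁, hy₁, x₂, hx₂, y₂, hy₂, x₃, hx₃, y₃, hy₃, rfl⟩
    exact Set.mul_mem_mul (Set.mul_mem_mul ⟨x₁, hx₁, y₁, hy₁, rfl⟩ ⟨x₂, hx₂, y₂, hy₂, rfl⟩)
      ⟨x₃, hx₃, y₃, hy₃, rfl⟩

/-- A nonzero alternating form on a plane identifies `(Λ²V)^{⊗3}` with `K`, and `wedgeTriple` with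
the product of the modules generated by its values. -/
theorem wedgeTriple_eq_iff [IsScalarTower R K V] {v w : V} (ω : V →ₗ[K] V →ₗ[K] K) (hω : ω.IsAlt)
    (h1 : ω v w = 1)
    (hspan : ∀ x, ∃ p q : K, x = p • v + q • w) (L₁ L₂ L₃ N₁ N₂ N₃ : Submodule R V) :
    wedgeTriple R K L₁ L₂ L₃ = wedgeTriple R K N₁ N₂ N₃ ↔
      valueSpan ω L₁ * valueSpan ω L₂ * valueSpan ω L₃ =
        valueSpan ω N₁ * valueSpan ω N₂ * valueSpan ω N₃ := by
  set E := wedge K v w ⊗ₜ[K] wedge K v w ⊗ₜ[K] wedge K v w with hE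
  have hwedge : ∀ x y, wedge K x y = ω x y • wedge K v w := by
    intro x y
    obtain ⟨p, q, rfl⟩ := hspan x
    obtain ⟨p', q', rfl⟩ := hspan y
    have h10 : wedge K w v = -wedge K v w := ((wedgeMap_isAlt V).neg v w).symm
    have hwv : ω w v = -1 := by rw [← hω.neg, h1]
    simp only [wedge_add_left, wedge_add_right, wedge_smul_left, wedge_smul_right, wedge_self, h10,
      map_add, map_smul, LinearMap.add_apply, LinearMap.smul_apply, hω v, hω w, h1, hwv]
    module
  let j : K →ₗ[R] (⋀[K]^2 V) ⊗[K] (⋀[K]^2 V) ⊗[K] (⋀[K]^2 V) :=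
    (LinearMap.toSpanSingleton K _ E).restrictScalars R
  have hj : Function.Injective j := by
    have h2 : wedgeTripleLift ω hω ω hω ω hω E = 1 := by
      rw [hE, wedgeTripleLift_apply, h1, one_mul, one_mul]
    intro x y h
    have h3 := congrArg (wedgeTripleLift ω hω ω hω ω hω) h
    change wedgeTripleLift ω hω ω hω ω hω (x • E) = wedgeTripleLift ω hω ω hω ω hω (y • E) at h3
    simpa only [map_smul, h2, smul_eq_mul, mul_one] using h3
  have key : ∀ L₁ L₂ L₃ : Submodule R V, wedgeTriple R K L₁ L₂ L₃ =
      (valueSpan ω L₁ * valueSpan ω L₂ * valueSpan ω L₃).map j := by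
    intro L₁ L₂ L₃
    have h3 : ∀ x₁ y₁ x₂ y₂ x₃ y₃, wedge K x₁ y₁ ⊗ₜ[K] wedge K x₂ y₂ ⊗ₜ[K] wedge K x₃ y₃ =
        j (ω x₁ y₁ * ω x₂ y₂ * ω x₃ y₃) := by
      intro x₁ y₁ x₂ y₂ x₃ y₃
      change _ = (ω x₁ y₁ * ω x₂ y₂ * ω x₃ y₃) • E
      rw [hwedge x₁, hwedge x₂, hwedge x₃, TensorProduct.smul_tmul_smul,
        TensorProduct.smul_tmul_smul]
    rw [valueSpan_mul_mul, Submodule.map_span]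
    unfold wedgeTriple
    congr 1
    ext t
    constructor
    · rintro ⟨x₁, hx₁, y₁, hy₁, x₂, hx₂, y₂, hy₂, x₃, hx₃, y₃, hy₃, rfl⟩
      exact ⟨_, ⟨x₁, hx₁, y₁, hy₁, x₂, hx₂, y₂, hy₂, x₃, hx₃, y₃, hy₃, rfl⟩, (h3 ..).symm⟩
    · rintro ⟨_, ⟨x₁, hx₁, y₁, hy₁, x₂, hx₂, y₂, hy₂, x₃, hx₃, y₃, hy₃, rfl⟩, rfl⟩
      exact ⟨x₁, hx₁, y₁, hy₁, x₂, hx₂, y₂, hy₂, x₃, hx₃, y₃, hy₃, (h3 ..).symm⟩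
  rw [key, key, (Submodule.map_injective_of_injective hj).eq_iff]

end ValueSpan

section Orientation

variable {R K : Type u} [CommRing R] [Field K] [Algebra R K]

/-- The extension to `S_K` of the form `(s, t) ↦ α(s ∧ t)` of an orientation `α`. -/
def orientationForm {S : Type u} [CommRing S] [Algebra R S] {𝔞 : FractionalIdeal R⁰ K}
    (α : (⋀[R]^2 S) ≃ₗ[R] 𝔞) : (K ⊗[R] S) →ₗ[K] (K ⊗[R] S) →ₗ[K] K :=
  LinearMap.liftBaseChange K (((LinearMap.liftBaseChangeEquiv K).toLinearMap.restrictScalars R) ∘ₗ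
    LinearMap.mk₂ R (fun s t => (α (wedge R s t) : K))
    (fun s s' t => by rw [wedge_add_left, map_add]; rfl)
    (fun c s t => by rw [wedge_smul_left, map_smul]; rfl)
    (fun s t t' => by rw [wedge_add_right, map_add]; rfl)
    (fun c s t => by rw [wedge_smul_right, map_smul]; rfl))

theorem BalancedTriple.orientFormK_eq {𝔞 : FractionalIdeal R⁰ K} (T : BalancedTriple 𝔞) :
    T.orientFormK = orientationForm T.orient := rfl

variable {S : Type u} [CommRing S] [Algebra R S] {𝔞 : FractionalIdeal R⁰ K}
  (α : (⋀[R]^2 S) ≃ₗ[R] 𝔞)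

theorem orientationForm_tmul (k l : K) (s t : S) :
    orientationForm α (k ⊗ₜ[R] s) (l ⊗ₜ[R] t) = k * l * α (wedge R s t) := by
  simp [orientationForm, mul_assoc]

theorem orientationForm_isAlt : (orientationForm α).IsAlt := by
  have hskew : ∀ x y, orientationForm α x y = -orientationForm α y x := by
    intro x y
    induction x using TensorProduct.induction_on with
    | zero => simp
    | add x x' hx hx' => simp only [map_add, LinearMap.add_apply, hx, hx', neg_add]
    | tmul k s =>
      induction y using TensorProduct.induction_on with
      | zero => simp
      | add y y' hy hy' => simp only [map_add, LinearMap.add_apply, hy, hy', neg_add]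
      | tmul l t =>
        have : wedge R s t = -wedge R t s := ((wedgeMap_isAlt S).neg t s).symm
        rw [orientationForm_tmul, orientationForm_tmul, this, map_neg]
        push_cast
        ring
  intro x
  induction x using TensorProduct.induction_on with
  | zero => simp
  | add x y hx hy =>
    simp only [map_add, LinearMap.add_apply, hx, hy, hskew x y]
    ring
  | tmul k s => rw [orientationForm_tmul, wedge_self, map_zero]; simp

theorem valueSpan_unitLattice :
    valueSpan (orientationForm α) (unitLattice R K S) = (𝔞 : Submodule R K) := by
  have hU : ∀ x, x ∈ unitLattice R K S ↔ ∃ s : S, (1 : K) ⊗ₜ[R] s = x := fun x => Iff.rfl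
  refine le_antisymm (Submodule.span_le.2 ?_) ?_
  · rintro t ⟨x, ⟨s, rfl⟩, y, ⟨s', rfl⟩, rfl⟩
    have : orientationForm α ((1 : K) ⊗ₜ[R] s) ((1 : K) ⊗ₜ[R] s') = α (wedge R s s') := by
      rw [orientationForm_tmul]; ring
    exact this.symm ▸ (α (wedge R s s')).2
  · intro x hx
    obtain ⟨w, hw⟩ := α.surjective ⟨x, hx⟩
    have : x = α w := by rw [hw]
    rw [this]
    clear hw this
    induction w using wedge_induction with
    | wedge s t =>
      refine Submodule.subset_span ⟨_, (hU _).2 ⟨s, rfl⟩, _, (hU _).2 ⟨t, rfl⟩, ?_⟩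
      rw [orientationForm_tmul]; ring
    | zero => rw [map_zero]; exact zero_mem _
    | add w w' h h' => rw [map_add]; exact add_mem h h'
    | smul r w h => rw [map_smul]; exact Submodule.smul_mem _ r h

theorem orientationForm_ne_zero (h𝔞 : 𝔞 ≠ 0) : orientationForm α ≠ 0 := by
  intro h
  apply h𝔞
  rw [← FractionalIdeal.coeToSubmodule_eq_bot, ← valueSpan_unitLattice α, h]
  unfold valueSpan
  rw [Submodule.span_eq_bot]
  rintro t ⟨x, -, y, -, rfl⟩
  rfl

variable [IsFractionRing R K]

/-- The coordinates in which an oriented quadratic algebra becomes `K[ω]` over `K`. -/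
theorem exists_orientationForm_eq_area (hS : IsRankTwoLattice R S) (h𝔞 : 𝔞 ≠ 0) :
    ∃ (a b : K) (e : (K ⊗[R] S) ≃ₐ[K] QuadraticAlgebra K a b),
      ∀ x y, orientationForm α x y = area (e x) (e y) :=
  exists_quadraticAlgebra_equiv ((finrank_baseChange S).trans hS.finrank_eq) _
    (orientationForm_isAlt α) (orientationForm_ne_zero α h𝔞)

/-- The values of the form `α(x ∧ y)` on `S` generate `𝔞`, so the second condition for a balanced
triple says that its values on the three ideals generate ideals with product `𝔞 ^ 3`. -/
theorem isBalanced_iff (hS : IsRankTwoLattice R S) (h𝔞 : 𝔞 ≠ 0) (I₁ I₂ I₃ : FracIdeal R K S) :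
    IsBalanced I₁ I₂ I₃ ↔ I₁.carrier * I₂.carrier * I₃.carrier ≤ unitLattice R K S ∧
      valueSpan (orientationForm α) I₁.carrier * valueSpan (orientationForm α) I₂.carrier *
        valueSpan (orientationForm α) I₃.carrier =
          ((𝔞 ^ 3 : FractionalIdeal R⁰ K) : Submodule R K) := by
  obtain ⟨a, b, e, he⟩ := exists_orientationForm_eq_area α hS h𝔞
  have hspan : ∀ x, ∃ p q : K, x = p • (1 : K ⊗[R] S) + q • e.symm QuadraticAlgebra.omega := by
    intro x
    refine ⟨(e x).re, (e x).im, e.injective ?_⟩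
    rw [map_add, map_smul, map_smul, map_one, e.apply_symm_apply]
    ext <;> simp [QuadraticAlgebra.re_one, QuadraticAlgebra.im_one]
  have h1 : orientationForm α 1 (e.symm QuadraticAlgebra.omega) = 1 := by
    rw [he]; simp [area, QuadraticAlgebra.re_one, QuadraticAlgebra.im_one]
  have key := wedgeTriple_eq_iff (orientationForm α) (orientationForm_isAlt α) h1 hspan
    I₁.carrier I₂.carrier I₃.carrier (unitLattice R K S) (unitLattice R K S) (unitLattice R K S)
  rw [valueSpan_unitLattice] at key
  rw [FractionalIdeal.coe_pow, pow_three', ← key]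
  exact ⟨fun h => ⟨h.1, h.2⟩, fun h => ⟨h.1, h.2⟩⟩

end Orientation

/-! ### Nondegenerate trilinear maps -/

section FullRank

variable {R K : Type*} [CommRing R] [IsDedekindDomain R] [Field K] [Algebra R K]
  [IsFractionRing R K]

/-- A map to `Hom(M, 𝔞)` has image of full rank if and only if no nonzero vector of `K ⊗ M` is
annihilated by its image. -/
theorem hasFullRankImage_iff {M X : Type*} [AddCommGroup M] [Module R M] [AddCommGroup X]
    [Module R X] (P : PseudoBasis R K M) {𝔞 : FractionalIdeal R⁰ K} (h𝔞 : 𝔞 ≠ 0)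
    (f : X →ₗ[R] (M →ₗ[R] 𝔞)) : HasFullRankImage (P := X) (Q := M →ₗ[R] 𝔞) f ↔
      ∀ s : Fin 2 → K, (∀ x, s 0 * f x (P.e 0) + s 1 * f x (P.e 1) = 0) → s = 0 := by
  let ev : (M →ₗ[R] 𝔞) →ₗ[R] (Fin 2 → K) :=
    { toFun := fun h i => h (P.e i)
      map_add' := fun _ _ => rfl
      map_smul' := fun _ _ => rfl }
  have hev : Function.Injective ev := by
    intro h h' hh
    refine LinearMap.ext fun m => Subtype.ext ?_
    have h1 := P.map_eq ((𝔞 : Submodule R K).subtype ∘ₗ h) m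
    have h2 := P.map_eq ((𝔞 : Submodule R K).subtype ∘ₗ h') m
    have h3 : ∀ i, (h (P.e i) : K) = h' (P.e i) := fun i => congrFun hh i
    simp only [LinearMap.comp_apply, Submodule.subtype_apply, h3] at h1 h2
    rw [h1, h2]
  obtain ⟨x, hx, hx0⟩ : ∃ x ∈ 𝔞, x ≠ 0 := by
    by_contra! h
    exact h𝔞 (FractionalIdeal.eq_zero_iff.2 h)
  have htop : Submodule.span K ((LinearMap.range ev : Submodule R (Fin 2 → K)) : Set (Fin 2 → K)) =
      ⊤ := by
    have hi : ∀ i : Fin 2, Pi.single i (1 : K) ∈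
        Submodule.span K ((LinearMap.range ev : Submodule R (Fin 2 → K)) : Set (Fin 2 → K)) := by
      intro i
      obtain ⟨r, hr, hr'⟩ := (P.b i).isFractional
      have hr0 : algebraMap R K r ≠ 0 := by
        simpa using nonZeroDivisors.ne_zero hr
      let g : M →ₗ[R] 𝔞 :=
        { toFun := fun m => ⟨algebraMap R K r * P.c i m * x, by
            obtain ⟨t, ht⟩ := hr' _ (P.c_mem i m)
            rw [← Algebra.smul_def, ← ht, ← Algebra.smul_def]
            exact Submodule.smul_mem _ _ hx⟩
          map_add' := fun m m' => Subtype.ext (by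
            change algebraMap R K r * P.c i (m + m') * x = algebraMap R K r * P.c i m * x +
              algebraMap R K r * P.c i m' * x
            rw [map_add]; ring)
          map_smul' := fun t m => Subtype.ext (by
            change algebraMap R K r * P.c i (t • m) * x = t • (algebraMap R K r * P.c i m * x)
            rw [map_smul, Algebra.smul_def, Algebra.smul_def]; ring) }
      have hg : Pi.single i (1 : K) = (algebraMap R K r * x)⁻¹ • ev g := by
        ext j
        change _ = (algebraMap R K r * x)⁻¹ * (algebraMap R K r * P.c i (P.e j) * x)
        rw [P.c_e]
        by_cases hij : i = j
        · subst hij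
          rw [if_pos rfl, Pi.single_eq_same]
          field_simp
        · rw [if_neg hij, Pi.single_eq_of_ne (Ne.symm hij)]
          ring
      rw [hg]
      exact Submodule.smul_mem _ _ (Submodule.subset_span ⟨g, rfl⟩)
    rw [eq_top_iff]
    intro v _
    have : v = v 0 • Pi.single 0 1 + v 1 • Pi.single 1 1 := by
      ext i; fin_cases i <;> simp
    rw [this]
    exact add_mem (Submodule.smul_mem _ _ (hi 0)) (Submodule.smul_mem _ _ (hi 1))
  -- the evaluations at the vectors `e i` embed `Hom(M, 𝔞)` as a lattice in `K²`
  have hHom : Module.finrank R (M →ₗ[R] 𝔞) = 2 := by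
    rw [(LinearEquiv.ofInjective ev hev).finrank_eq, finrank_eq_of_span_eq_top (K := K) _ htop]
    simp
  have hrange : Module.finrank R (LinearMap.range f) = Module.finrank K
      (Submodule.span K (((LinearMap.range f).map ev : Submodule R (Fin 2 → K)) :
        Set (Fin 2 → K))) := by
    rw [← finrank_eq_finrank_span]
    exact ((LinearMap.range f).equivMapOfInjective ev hev).finrank_eq
  unfold HasFullRankImage
  rw [hHom, hrange]
  set W := Submodule.span K (((LinearMap.range f).map ev : Submodule R (Fin 2 → K)) :
        Set (Fin 2 → K)) with hW
  have hmem : ∀ x, ev (f x) ∈ W := fun x => Submodule.subset_span ⟨f x, ⟨x, rfl⟩, rfl⟩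
  constructor
  · intro h s hs
    have hWtop : W = ⊤ := Submodule.eq_top_of_finrank_eq (by rw [h]; simp)
    have hker : W ≤ LinearMap.ker (s 0 • LinearMap.proj 0 + s 1 • LinearMap.proj 1 :
        (Fin 2 → K) →ₗ[K] K) := by
      rw [hW, Submodule.span_le]
      rintro _ ⟨_, ⟨x, rfl⟩, rfl⟩
      exact hs x
    rw [hWtop] at hker
    ext i
    have := hker (Submodule.mem_top (x := Pi.single i (1 : K)))
    fin_cases i <;> simpa using this
  · intro h
    have hWtop : W = ⊤ := by
      by_contra hne
      obtain ⟨g, hg, hg'⟩ := Submodule.exists_le_ker_of_lt_top W (lt_top_iff_ne_top.2 hne)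
      have hgv : ∀ v, g v = g (Pi.single 0 1) * v 0 + g (Pi.single 1 1) * v 1 := by
        intro v
        have : v = v 0 • Pi.single 0 1 + v 1 • Pi.single 1 1 := by
          ext i; fin_cases i <;> simp
        conv_lhs => rw [this]
        rw [map_add, map_smul, map_smul, smul_eq_mul, smul_eq_mul]
        ring
      have h0 := h (fun i => g (Pi.single i 1)) fun x => by
        have := hg' (hmem x)
        rw [LinearMap.mem_ker, hgv] at this
        exact this
      apply hg
      refine LinearMap.ext fun v => ?_
      rw [hgv]
      have h00 := congrFun h0 0
      have h01 := congrFun h0 1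
      simp only [Pi.zero_apply] at h00 h01
      rw [h00, h01]; simp
    rw [hWtop, finrank_top]
    simp

variable {M₁ M₂ M₃ : Type*} [AddCommGroup M₁] [AddCommGroup M₂]
  [AddCommGroup M₃] [Module R M₁] [Module R M₂] [Module R M₃] {𝔞 : FractionalIdeal R⁰ K}
  (β : M₁ →ₗ[R] M₂ →ₗ[R] M₃ →ₗ[R] 𝔞)

theorem partialDual₁_iff (h𝔞 : 𝔞 ≠ 0) (P : PseudoBasis R K M₁) :
    HasFullRankImage (partialDual₁ β) ↔ ∀ s : Fin 2 → K,
      (∀ y z, s 0 * β (P.e 0) y z + s 1 * β (P.e 1) y z = 0) → s = 0 := by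
  rw [hasFullRankImage_iff P h𝔞]
  refine forall_congr' fun s => imp_congr_left ⟨fun h y z => h (y ⊗ₜ z), fun h x => ?_⟩
  induction x using TensorProduct.induction_on with
  | zero => simp
  | tmul y z => exact h y z
  | add x y hx hy =>
    simp only [map_add, LinearMap.add_apply, Submodule.coe_add]
    linear_combination hx + hy

theorem partialDual₂_iff (h𝔞 : 𝔞 ≠ 0) (P : PseudoBasis R K M₂) :
    HasFullRankImage (partialDual₂ β) ↔ ∀ s : Fin 2 → K,
      (∀ x z, s 0 * β x (P.e 0) z + s 1 * β x (P.e 1) z = 0) → s = 0 := by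
  rw [hasFullRankImage_iff P h𝔞]
  refine forall_congr' fun s => imp_congr_left ⟨fun h x z => h (x ⊗ₜ z), fun h x => ?_⟩
  induction x using TensorProduct.induction_on with
  | zero => simp
  | tmul y z => exact h y z
  | add x y hx hy =>
    simp only [map_add, LinearMap.add_apply, Submodule.coe_add]
    linear_combination hx + hy

theorem partialDual₃_iff (h𝔞 : 𝔞 ≠ 0) (P : PseudoBasis R K M₃) :
    HasFullRankImage (partialDual₃ β) ↔ ∀ s : Fin 2 → K,
      (∀ x y, s 0 * β x y (P.e 0) + s 1 * β x y (P.e 1) = 0) → s = 0 := by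
  rw [hasFullRankImage_iff P h𝔞]
  refine forall_congr' fun s => imp_congr_left ⟨fun h x y => h (x ⊗ₜ y), fun h x => ?_⟩
  induction x using TensorProduct.induction_on with
  | zero => simp
  | tmul y z => exact h y z
  | add x y hx hy =>
    simp only [map_add, LinearMap.add_apply, Submodule.coe_add]
    linear_combination hx + hy

end FullRank

/-! ### The box of a balanced triple -/

section ToBox

variable {K : Type*} [Field K]

/-- The bilinear form `α(1 ∧ xy)` is nondegenerate, even if the algebra is degenerate. -/
theorem eq_zero_of_area_one_mul {a b : K} (x : QuadraticAlgebra K a b)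
    (h : ∀ y, area 1 (x * y) = 0) : x = 0 := by
  have h1 := h 1
  have h2 := h ⟨0, 1⟩
  simp only [area, mul_one, QuadraticAlgebra.re_one, QuadraticAlgebra.im_one,
    QuadraticAlgebra.re_mul, QuadraticAlgebra.im_mul] at h1 h2
  ext
  · simp only [QuadraticAlgebra.re_zero]; linear_combination h2 - b * h1
  · simp only [QuadraticAlgebra.im_zero]; linear_combination h1

end ToBox

section ToBox

variable {R K : Type u} [CommRing R] [Field K] [Algebra R K]
  {S : Type u} [CommRing S] [Algebra R S]

/-- The `R`-bilinear form on a lattice in `S_K` given by a `K`-bilinear form on `S_K`. -/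
def restrictForm (ω : (K ⊗[R] S) →ₗ[K] (K ⊗[R] S) →ₗ[K] K) (L : Submodule R (K ⊗[R] S)) :
    L →ₗ[R] L →ₗ[R] K :=
  LinearMap.mk₂ R (fun x y => ω x y)
    (fun x x' y => by simp)
    (fun c x y => by
      rw [Submodule.coe_smul, ← algebraMap_smul K c (x : K ⊗[R] S), map_smul, LinearMap.smul_apply,
        algebraMap_smul])
    (fun x y y' => by simp)
    (fun c x y => by
      rw [Submodule.coe_smul, ← algebraMap_smul K c (y : K ⊗[R] S), map_smul, algebraMap_smul])

variable {𝔞 : FractionalIdeal R⁰ K} (α : (⋀[R]^2 S) ≃ₗ[R] 𝔞)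

theorem orientationForm_one_mem (x : K ⊗[R] S) (hx : x ∈ unitLattice R K S) :
    orientationForm α 1 x ∈ 𝔞 := by
  obtain ⟨s, rfl⟩ := hx
  have : orientationForm α 1 ((1 : K) ⊗ₜ[R] s) = α (wedge R 1 s) := by
    rw [Algebra.TensorProduct.one_def, orientationForm_tmul]; ring
  exact this.symm ▸ (α (wedge R 1 s)).2

/-- The trilinear map `(x, y, z) ↦ α(1 ∧ xyz)` on three ideals whose product is contained
in `S`. -/
def boxForm {I₁ I₂ I₃ : Submodule R (K ⊗[R] S)} (h : I₁ * I₂ * I₃ ≤ unitLattice R K S) :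
    I₁ →ₗ[R] I₂ →ₗ[R] I₃ →ₗ[R] 𝔞 :=
  LinearMap.mk₂ R (fun x y =>
      { toFun := fun z => ⟨orientationForm α 1 (x * y * z), orientationForm_one_mem α _
          (h (Submodule.mul_mem_mul (Submodule.mul_mem_mul x.2 y.2) z.2))⟩
        map_add' := fun z z' => Subtype.ext (by simp [mul_add])
        map_smul' := fun c z => Subtype.ext (by
          simp only [Submodule.coe_smul, mul_smul_comm, RingHom.id_apply]
          rw [← algebraMap_smul K c, map_smul, algebraMap_smul]) })
    (fun x x' y => LinearMap.ext fun z => Subtype.ext (by simp [add_mul]))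
    (fun c x y => LinearMap.ext fun z => Subtype.ext (by
      simp only [Submodule.coe_smul, smul_mul_assoc, LinearMap.smul_apply, LinearMap.coe_mk,
        AddHom.coe_mk]
      rw [← algebraMap_smul K c, map_smul, algebraMap_smul]))
    (fun x y y' => LinearMap.ext fun z => Subtype.ext (by simp [add_mul, mul_add]))
    (fun c x y => LinearMap.ext fun z => Subtype.ext (by
      simp only [Submodule.coe_smul, smul_mul_assoc, mul_smul_comm, LinearMap.smul_apply,
        LinearMap.coe_mk, AddHom.coe_mk]
      rw [← algebraMap_smul K c, map_smul, algebraMap_smul]))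

theorem boxForm_apply {I₁ I₂ I₃ : Submodule R (K ⊗[R] S)} (h : I₁ * I₂ * I₃ ≤ unitLattice R K S)
    (x : I₁) (y : I₂) (z : I₃) :
    (boxForm α h x y z : K) = orientationForm α 1 (x * y * z) := rfl

variable [IsFractionRing R K]

theorem FracIdeal.isRankTwoLattice [IsDomain R] (hS : IsRankTwoLattice R S)
    (I : FracIdeal R K S) : IsRankTwoLattice R I.carrier where
  finite := Module.Finite.iff_fg.2 I.fg
  torsionFree := by
    have : Module.IsTorsionFree R (K ⊗[R] S) := by
      refine ⟨fun r hr x y h => ?_⟩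
      have hr' : algebraMap R K r ≠ 0 := by simpa using hr.ne_zero
      change r • x = r • y at h
      rw [← algebraMap_smul K r x, ← algebraMap_smul K r y] at h
      exact smul_right_injective _ hr' h
    infer_instance
  finrank_eq := by
    rw [finrank_eq_of_span_eq_top (K := K) _ I.span_eq_top, finrank_baseChange, hS.finrank_eq]

theorem eq_zero_of_orientationForm_one_mul (hS : IsRankTwoLattice R S) (h𝔞 : 𝔞 ≠ 0)
    (x : K ⊗[R] S) (h : ∀ y, orientationForm α 1 (x * y) = 0) : x = 0 := by
  obtain ⟨a, b, e, he⟩ := exists_orientationForm_eq_area α hS h𝔞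
  apply e.injective
  rw [map_zero]
  refine eq_zero_of_area_one_mul _ fun y => ?_
  have := h (e.symm y)
  rwa [he, map_one, map_mul, e.apply_symm_apply] at this

theorem eq_zero_of_forall_mem (hS : IsRankTwoLattice R S) (h𝔞 : 𝔞 ≠ 0)
    (I J : FracIdeal R K S) (x : K ⊗[R] S)
    (h : ∀ y ∈ I.carrier, ∀ z ∈ J.carrier, orientationForm α 1 (x * y * z) = 0) : x = 0 := by
  have h1 : ∀ y ∈ I.carrier, ∀ z, orientationForm α 1 (x * y * z) = 0 := by
    intro y hy z
    have hz : z ∈ Submodule.span K (J.carrier : Set (K ⊗[R] S)) := J.span_eq_top ▸ trivial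
    induction hz using Submodule.span_induction with
    | mem z hz => exact h y hy z hz
    | zero => simp
    | add z z' _ _ h h' => rw [mul_add, map_add, h, h', add_zero]
    | smul k z _ h => rw [mul_smul_comm, map_smul, h, smul_zero]
  have h2 : ∀ y, orientationForm α 1 (x * y) = 0 := by
    intro y
    have hy : y ∈ Submodule.span K (I.carrier : Set (K ⊗[R] S)) := I.span_eq_top ▸ trivial
    induction hy using Submodule.span_induction with
    | mem y hy => simpa using h1 y hy 1
    | zero => simp
    | add y y' _ _ h h' => rw [mul_add, map_add, h, h', add_zero]
    | smul k y _ h => rw [mul_smul_comm, map_smul, h, smul_zero]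
  exact eq_zero_of_orientationForm_one_mul α hS h𝔞 x h2

end ToBox

section ToBox

variable {R K : Type u} [CommRing R] [IsDedekindDomain R] [Field K] [Algebra R K]
  [IsFractionRing R K] {𝔞 : FractionalIdeal R⁰ K}

/-- Every balanced triple gives a box. -/
theorem exists_arisesFrom (h𝔞 : 𝔞 ≠ 0) (T : BalancedTriple 𝔞) :
    ∃ B : BhargavaBox 𝔞, B.ArisesFrom T := by
  have hS := T.lattice
  have hL₁ := T.I₁.isRankTwoLattice hS
  have hL₂ := T.I₂.isRankTwoLattice hS
  have hL₃ := T.I₃.isRankTwoLattice hS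
  obtain ⟨hle, hval⟩ := (isBalanced_iff T.orient hS h𝔞 _ _ _).1 T.balanced
  set ω := orientationForm T.orient with hω
  have halt : ∀ L : Submodule R (K ⊗[R] T.S), (restrictForm ω L).IsAlt :=
    fun L x => orientationForm_isAlt T.orient x
  have hspan : Submodule.span R {t | ∃ x₁ y₁ x₂ y₂ x₃ y₃,
      t = restrictForm ω T.I₁.carrier x₁ y₁ * restrictForm ω T.I₂.carrier x₂ y₂ *
        restrictForm ω T.I₃.carrier x₃ y₃} = ((𝔞 ^ 3 : FractionalIdeal R⁰ K) : Submodule R K) := by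
    rw [← hval, valueSpan_mul_mul]
    congr 1
    ext t
    constructor
    · rintro ⟨x₁, y₁, x₂, y₂, x₃, y₃, rfl⟩
      exact ⟨x₁, x₁.2, y₁, y₁.2, x₂, x₂.2, y₂, y₂.2, x₃, x₃.2, y₃, y₃.2, rfl⟩
    · rintro ⟨x₁, hx₁, y₁, hy₁, x₂, hx₂, y₂, hy₂, x₃, hx₃, y₃, hy₃, rfl⟩
      exact ⟨⟨x₁, hx₁⟩, ⟨y₁, hy₁⟩, ⟨x₂, hx₂⟩, ⟨y₂, hy₂⟩, ⟨x₃, hx₃⟩, ⟨y₃, hy₃⟩, rfl⟩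
  obtain ⟨θ, hθ⟩ := exists_wedge_triple_equiv hL₁ hL₂ hL₃ _ (halt _) _ (halt _) _ (halt _) (𝔞 ^ 3)
    (pow_ne_zero 3 h𝔞) hspan
  obtain ⟨P₁⟩ := hL₁.nonempty_pseudoBasis (K := K)
  obtain ⟨P₂⟩ := hL₂.nonempty_pseudoBasis (K := K)
  obtain ⟨P₃⟩ := hL₃.nonempty_pseudoBasis (K := K)
  refine ⟨{ M₁ := T.I₁.carrier, M₂ := T.I₂.carrier, M₃ := T.I₃.carrier,
            lattice₁ := hL₁, lattice₂ := hL₂, lattice₃ := hL₃, θ := θ,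
            β := boxForm T.orient hle, nondeg₁ := ?_, nondeg₂ := ?_, nondeg₃ := ?_ },
    LinearEquiv.refl R _, LinearEquiv.refl R _, LinearEquiv.refl R _, fun x y z => rfl,
    fun x₁ y₁ x₂ y₂ x₃ y₃ => hθ x₁ y₁ x₂ y₂ x₃ y₃⟩
  · rw [partialDual₁_iff _ h𝔞 P₁]
    intro s hs
    refine P₁.linearIndependent_e T.I₁.carrier.subtype Subtype.val_injective s ?_
    refine eq_zero_of_forall_mem T.orient hS h𝔞 T.I₂ T.I₃ _ fun y hy z hz => ?_
    have := hs ⟨y, hy⟩ ⟨z, hz⟩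
    simp only [boxForm_apply] at this
    simpa only [add_mul, smul_mul_assoc, map_add, map_smul, Submodule.subtype_apply,
      smul_eq_mul] using this
  · rw [partialDual₂_iff _ h𝔞 P₂]
    intro s hs
    refine P₂.linearIndependent_e T.I₂.carrier.subtype Subtype.val_injective s ?_
    refine eq_zero_of_forall_mem T.orient hS h𝔞 T.I₁ T.I₃ _ fun y hy z hz => ?_
    have := hs ⟨y, hy⟩ ⟨z, hz⟩
    simp only [boxForm_apply] at this
    rw [mul_comm _ y]
    simpa only [mul_add, add_mul, smul_mul_assoc, mul_smul_comm, map_add, map_smul,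
      Submodule.subtype_apply, smul_eq_mul] using this
  · rw [partialDual₃_iff _ h𝔞 P₃]
    intro s hs
    refine P₃.linearIndependent_e T.I₃.carrier.subtype Subtype.val_injective s ?_
    refine eq_zero_of_forall_mem T.orient hS h𝔞 T.I₁ T.I₂ _ fun y hy z hz => ?_
    have := hs ⟨y, hy⟩ ⟨z, hz⟩
    simp only [boxForm_apply] at this
    rw [mul_assoc, mul_comm]
    simpa only [mul_add, mul_smul_comm, map_add, map_smul, Submodule.subtype_apply,
      smul_eq_mul] using this

end ToBox

section Isomorphic

variable {R K : Type u} [CommRing R] [Field K] [Algebra R K] {𝔞 : FractionalIdeal R⁰ K}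

/-- A box arising from a triple is determined by it up to isomorphism. -/
theorem isomorphic_of_arisesFrom {T : BalancedTriple 𝔞} {B B' : BhargavaBox 𝔞}
    (h : B.ArisesFrom T) (h' : B'.ArisesFrom T) : B.Isomorphic B' := by
  obtain ⟨i₁, i₂, i₃, hβ, hθ⟩ := h
  obtain ⟨j₁, j₂, j₃, hβ', hθ'⟩ := h'
  refine ⟨i₁.trans j₁.symm, i₂.trans j₂.symm, i₃.trans j₃.symm, fun w => ?_, fun x y z => ?_⟩
  · have key : B'.θ.toLinearMap ∘ₗ (TensorProduct.map (TensorProduct.map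
        (exteriorPower.map 2 (i₁.trans j₁.symm).toLinearMap)
        (exteriorPower.map 2 (i₂.trans j₂.symm).toLinearMap))
        (exteriorPower.map 2 (i₃.trans j₃.symm).toLinearMap)) = B.θ.toLinearMap := by
      refine wedge_triple_ext fun x₁ y₁ x₂ y₂ x₃ y₃ => Subtype.ext ?_
      simp only [LinearMap.comp_apply, TensorProduct.map_tmul, map_wedge, LinearEquiv.coe_coe]
      rw [hθ, hθ']
      simp
    exact LinearMap.congr_fun key w
  · apply Subtype.ext
    rw [hβ, hβ']
    simp

theorem arisesFrom_of_isomorphic {T : BalancedTriple 𝔞} {B B' : BhargavaBox 𝔞}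
    (h : B.ArisesFrom T) (hB : B'.Isomorphic B) : B'.ArisesFrom T := by
  obtain ⟨i₁, i₂, i₃, hβ, hθ⟩ := h
  obtain ⟨f₁, f₂, f₃, kθ, kβ⟩ := hB
  refine ⟨f₁.trans i₁, f₂.trans i₂, f₃.trans i₃, fun x y z => ?_, fun x₁ y₁ x₂ y₂ x₃ y₃ => ?_⟩
  · rw [← kβ, hβ]; rfl
  · rw [← kθ]
    simp only [TensorProduct.map_tmul, map_wedge, LinearEquiv.coe_coe]
    rw [hθ]; rfl

end Isomorphic

/-! ### Rigidity of the trilinear form of a quadratic algebra -/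

section Rigidity

variable {K : Type*} [Field K] {a b a' b' : K}

open scoped QuadraticAlgebra

theorem area_mul_mul (x y z : QuadraticAlgebra K a b) :
    area (x * y) (x * z) = QuadraticAlgebra.norm x * area y z := by
  simp only [area, QuadraticAlgebra.norm_def, QuadraticAlgebra.re_mul, QuadraticAlgebra.im_mul]
  ring

/-- The determinant of the bilinear form `(y, z) ↦ α(1 ∧ xyz)` is the norm of `x`, up to sign. -/
theorem area_one_mul_det (x y y' z z' : QuadraticAlgebra K a b) :
    area 1 (x * y * z) * area 1 (x * y' * z') - area 1 (x * y * z') * area 1 (x * y' * z) =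
      -(QuadraticAlgebra.norm x * area y y' * area z z') := by
  simp only [area, QuadraticAlgebra.norm_def, QuadraticAlgebra.re_mul, QuadraticAlgebra.im_mul,
    QuadraticAlgebra.re_one, QuadraticAlgebra.im_one]
  ring

theorem area_map_map (g : QuadraticAlgebra K a b →ₗ[K] QuadraticAlgebra K a' b')
    (x y : QuadraticAlgebra K a b) :
    area (g x) (g y) = area (g ⟨1, 0⟩) (g ⟨0, 1⟩) * area x y := by
  have h : ∀ x, g x = x.re • g ⟨1, 0⟩ + x.im • g ⟨0, 1⟩ := fun x => by
    rw [← map_smul, ← map_smul, ← map_add]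
    congr 1
    ext <;> simp
  rw [h x, h y]
  simp only [area, QuadraticAlgebra.re_add, QuadraticAlgebra.im_add, QuadraticAlgebra.re_smul,
    QuadraticAlgebra.im_smul, smul_eq_mul]
  ring

/-- A unital linear map that preserves norms and areas is multiplicative. -/
theorem map_mul_of_norm_of_area (f : QuadraticAlgebra K a b →ₗ[K] QuadraticAlgebra K a' b')
    (h1 : f 1 = 1) (hn : ∀ x, QuadraticAlgebra.norm (f x) = QuadraticAlgebra.norm x)
    (ha : ∀ x y, area (f x) (f y) = area x y) (x y : QuadraticAlgebra K a b) :
    f (x * y) = f x * f y := by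
  obtain ⟨r, q, hrq⟩ : ∃ r q, f ⟨0, 1⟩ = ⟨r, q⟩ := ⟨_, _, rfl⟩
  have hq : q = 1 := by
    have := ha 1 ⟨0, 1⟩
    rw [h1, hrq] at this
    simpa [area] using this
  subst hq
  have h : ∀ x, f x = ⟨x.re + x.im * r, x.im⟩ := fun x => by
    have : x = x.re • (1 : QuadraticAlgebra K a b) + x.im • ⟨0, 1⟩ := by ext <;> simp
    conv_lhs => rw [this]
    rw [map_add, map_smul, map_smul, h1, hrq]
    ext <;> simp
  have e1 := hn ⟨0, 1⟩
  have e2 := hn ⟨1, 1⟩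
  rw [h] at e1 e2
  simp only [QuadraticAlgebra.norm_def] at e1 e2
  rw [h, h x, h y]
  ext
  · simp only [QuadraticAlgebra.re_mul, QuadraticAlgebra.im_mul]
    linear_combination (x.im * y.im) * e1 + (x.im * y.im * r) * (e1 - e2)
  · simp only [QuadraticAlgebra.im_mul]
    linear_combination (x.im * y.im) * (e1 - e2)

/-- Linear isomorphisms that preserve the trilinear form `α(1 ∧ xyz)` and the product of the three
areas are, up to units with product one, one and the same isomorphism of oriented algebras. -/
theorem exists_algEquiv_of_trilinear
    (g₁ g₂ g₃ : QuadraticAlgebra K a b ≃ₗ[K] QuadraticAlgebra K a' b')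
    (h : ∀ x y z, area 1 (g₁ x * g₂ y * g₃ z) = area 1 (x * y * z))
    (x₁ y₁ x₂ y₂ x₃ y₃ : QuadraticAlgebra K a b)
    (hne : area x₁ y₁ * area x₂ y₂ * area x₃ y₃ ≠ 0)
    (hd : area (g₁ x₁) (g₁ y₁) * area (g₂ x₂) (g₂ y₂) * area (g₃ x₃) (g₃ y₃) =
      area x₁ y₁ * area x₂ y₂ * area x₃ y₃) :
    ∃ (f : QuadraticAlgebra K a b ≃ₐ[K] QuadraticAlgebra K a' b')
      (γ₁ γ₂ γ₃ : (QuadraticAlgebra K a' b')ˣ), γ₁ * γ₂ * γ₃ = 1 ∧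
      (∀ x y, area (f x) (f y) = area x y) ∧
      (∀ x, g₁ x = γ₁ * f x) ∧ (∀ x, g₂ x = γ₂ * f x) ∧ (∀ x, g₃ x = γ₃ * f x) := by
  have hg₁ := area_map_map g₁.toLinearMap
  have hg₂ := area_map_map g₂.toLinearMap
  have hg₃ := area_map_map g₃.toLinearMap
  simp only [LinearEquiv.coe_coe] at hg₁ hg₂ hg₃
  set d₁ := area (g₁ ⟨1, 0⟩) (g₁ ⟨0, 1⟩)
  set d₂ := area (g₂ ⟨1, 0⟩) (g₂ ⟨0, 1⟩)
  set d₃ := area (g₃ ⟨1, 0⟩) (g₃ ⟨0, 1⟩)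
  have hddd : d₁ * d₂ * d₃ = 1 := by
    rw [hg₁, hg₂, hg₃] at hd
    apply mul_right_cancel₀ hne
    linear_combination hd
  have hd₁ : d₁ ≠ 0 := fun h0 => by rw [h0] at hddd; simp at hddd
  have hd₂ : d₂ ≠ 0 := fun h0 => by rw [h0] at hddd; simp at hddd
  have hone : area (⟨1, 0⟩ : QuadraticAlgebra K a b) ⟨0, 1⟩ = 1 := by simp [area]
  have hn₁ : ∀ x, QuadraticAlgebra.norm (g₁ x) = d₁ * QuadraticAlgebra.norm x := by
    intro x
    have e1 := area_one_mul_det (g₁ x) (g₂ ⟨1, 0⟩) (g₂ ⟨0, 1⟩) (g₃ ⟨1, 0⟩) (g₃ ⟨0, 1⟩)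
    rw [h, h, h, h, area_one_mul_det, hone] at e1
    change _ = -(_ * d₂ * d₃) at e1
    linear_combination -QuadraticAlgebra.norm (g₁ x) * hddd + d₁ * e1
  have hn₂ : ∀ x, QuadraticAlgebra.norm (g₂ x) = d₂ * QuadraticAlgebra.norm x := by
    intro x
    have h' : ∀ x y z, area 1 (g₂ x * g₁ y * g₃ z) = area 1 (x * y * z) := fun x y z => by
      rw [mul_comm (g₂ x), h, mul_comm x]
    have e1 := area_one_mul_det (g₂ x) (g₁ ⟨1, 0⟩) (g₁ ⟨0, 1⟩) (g₃ ⟨1, 0⟩) (g₃ ⟨0, 1⟩)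
    rw [h', h', h', h', area_one_mul_det, hone] at e1
    change _ = -(_ * d₁ * d₃) at e1
    linear_combination -QuadraticAlgebra.norm (g₂ x) * hddd + d₂ * e1
  have hu₁ : IsUnit (g₁ 1) := by
    rw [QuadraticAlgebra.isUnit_iff_norm_isUnit, hn₁, QuadraticAlgebra.norm_one, mul_one]
    exact isUnit_iff_ne_zero.2 hd₁
  have hu₂ : IsUnit (g₂ 1) := by
    rw [QuadraticAlgebra.isUnit_iff_norm_isUnit, hn₂, QuadraticAlgebra.norm_one, mul_one]
    exact isUnit_iff_ne_zero.2 hd₂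
  obtain ⟨γ₁, hγ₁⟩ := hu₁
  obtain ⟨γ₂, hγ₂⟩ := hu₂
  have hnγ₁ : QuadraticAlgebra.norm (γ₁ : QuadraticAlgebra K a' b') = d₁ := by
    rw [hγ₁, hn₁, QuadraticAlgebra.norm_one, mul_one]
  have hnγ₁' : QuadraticAlgebra.norm ((γ₁⁻¹ : (QuadraticAlgebra K a' b')ˣ) :
      QuadraticAlgebra K a' b') * d₁ = 1 := by
    rw [← hnγ₁, ← map_mul, Units.inv_mul, map_one]
  -- the normalized maps
  let f₁ : QuadraticAlgebra K a b →ₗ[K] QuadraticAlgebra K a' b' :=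
    LinearMap.mulLeft K ((γ₁⁻¹ : (QuadraticAlgebra K a' b')ˣ) : QuadraticAlgebra K a' b') ∘ₗ
      g₁.toLinearMap
  have hf₁ : ∀ x, g₁ x = γ₁ * f₁ x := fun x => by
    change _ = _ * (_ * g₁ x)
    rw [Units.mul_inv_cancel_left]
  have hf₁' : ∀ x, f₁ x = ((γ₁⁻¹ : (QuadraticAlgebra K a' b')ˣ) : QuadraticAlgebra K a' b') *
    g₁ x := fun x => rfl
  have hf₁1 : f₁ 1 = 1 := by rw [hf₁', ← hγ₁, Units.inv_mul]
  have harea : ∀ x y, area (f₁ x) (f₁ y) = area x y := fun x y => by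
    rw [hf₁', hf₁', area_mul_mul, hg₁]
    linear_combination area x y * hnγ₁'
  have hmul : ∀ x y, f₁ (x * y) = f₁ x * f₁ y := map_mul_of_norm_of_area f₁ hf₁1 (fun x => by
      rw [hf₁', map_mul, hn₁]
      linear_combination QuadraticAlgebra.norm x * hnγ₁') harea
  have hbij : Function.Bijective f₁ := by
    have h1 : Function.Bijective (fun x : QuadraticAlgebra K a' b' =>
        ((γ₁⁻¹ : (QuadraticAlgebra K a' b')ˣ) : QuadraticAlgebra K a' b') * x) :=
      (Units.mulLeft γ₁⁻¹).bijective
    exact h1.comp g₁.bijective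
  let f : QuadraticAlgebra K a b ≃ₐ[K] QuadraticAlgebra K a' b' :=
    AlgEquiv.ofBijective (AlgHom.ofLinearMap f₁ hf₁1 hmul) hbij
  have hff : ∀ x, f x = f₁ x := fun x => rfl
  have hcancel : ∀ u v : QuadraticAlgebra K a' b', (∀ z, area 1 (u * g₃ z) = area 1 (v * g₃ z)) →
      u = v := by
    intro u v huv
    refine sub_eq_zero.1 (eq_zero_of_area_one_mul _ fun w => ?_)
    obtain ⟨z, rfl⟩ := g₃.surjective w
    have := huv z
    simp only [area, sub_mul, QuadraticAlgebra.re_sub, QuadraticAlgebra.im_sub] at this ⊢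
    linear_combination this
  have hf₂ : ∀ x, g₂ x = γ₂ * f x := by
    intro x
    apply γ₁.mul_right_inj.1
    refine hcancel _ _ fun z => ?_
    have e1 := h x 1 z
    have e2 := h 1 x z
    rw [one_mul] at e2
    rw [mul_one] at e1
    rw [hγ₁, e2, ← e1, hf₁, hγ₂, hff, ← hγ₁]
    congr 1
    ring
  have hf₃ : ∀ x, γ₁ * γ₂ * g₃ x = f x := by
    intro x
    refine sub_eq_zero.1 (eq_zero_of_area_one_mul _ fun w => ?_)
    obtain ⟨y, rfl⟩ := f.surjective w
    have e1 := h y 1 x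
    have e2 := harea 1 (x * y)
    rw [← hγ₂, hf₁, mul_one] at e1
    rw [← hff, ← hff, map_one, map_mul, mul_comm x, ← e1, ← hff] at e2
    have e3 : (γ₁ * γ₂ * g₃ x - f x) * f y = γ₁ * f y * γ₂ * g₃ x - f x * f y := by ring
    rw [e3]
    simp only [area, QuadraticAlgebra.re_sub, QuadraticAlgebra.im_sub] at e2 ⊢
    linear_combination -e2
  refine ⟨f, γ₁, γ₂, (γ₁ * γ₂)⁻¹, mul_inv_cancel _, fun x y => by rw [hff, hff, harea],
    fun x => by rw [hf₁, hff], hf₂, fun x => ?_⟩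
  rw [← hf₃, ← Units.val_mul, Units.inv_mul_cancel_left]

end Rigidity

/-! ### A triple is determined by its box -/

section Integrality

variable {R K : Type*} [CommRing R] [IsDedekindDomain R] [Field K] [Algebra R K]
  [IsFractionRing R K]

/-- As `R` is integrally closed, the scalars that preserve a finitely generated module lie
in `R`. -/
theorem exists_algebraMap_eq_of_smul_mem {V : Type*} [AddCommGroup V] [Module K V] [Module R V]
    [IsScalarTower R K V] (N : Submodule R V) (hN : N ≠ ⊥) (hN' : N.FG) (p : K)
    (hp : ∀ x ∈ N, p • x ∈ N) : ∃ r : R, algebraMap R K r = p :=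
  IsIntegrallyClosed.isIntegral_iff.1 (isIntegral_of_smul_mem_submodule N hN hN' p hp)

end Integrality

section Order

variable {R K : Type u} [CommRing R] [IsDedekindDomain R] [Field K] [Algebra R K]
  [IsFractionRing R K] {S : Type u} [CommRing S] [Algebra R S] {𝔞 : FractionalIdeal R⁰ K}
  (α : (⋀[R]^2 S) ≃ₗ[R] 𝔞)

theorem unitLattice_fg {R K S : Type*} [CommRing R] [Field K] [Algebra R K] [CommRing S]
    [Algebra R S] [Module.Finite R S] : (unitLattice R K S).FG :=
  Module.Finite.iff_fg.1 (Module.Finite.range _)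

theorem includeRight_injective (hS : IsRankTwoLattice R S) :
    Function.Injective (Algebra.TensorProduct.includeRight : S →ₐ[R] K ⊗[R] S) := by
  have := hS.torsionFree
  exact mk_one_injective S

/-- Every element of `𝔞` is of the form `α(1 ∧ s)`, because `S/R` is torsion-free. -/
theorem exists_orientationForm_one_eq (hS : IsRankTwoLattice R S) (x : K) (hx : x ∈ 𝔞) :
    ∃ s : S, orientationForm α 1 ((1 : K) ⊗ₜ[R] s) = x := by
  have := hS.finite
  have hinj := includeRight_injective (K := K) hS
  have h1 : (1 : S) ≠ 0 := by
    intro h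
    obtain ⟨v, hv⟩ := hS.exists_ne_zero
    exact hv (by rw [← mul_one v, h, mul_zero])
  obtain ⟨P, hP⟩ := exists_pseudoBasis (K := K) hS 1 h1
  -- the multiples of `1` in `S` have integral coefficients
  have hint : ∀ s, ∃ r : R, algebraMap R K r = P.c 0 s := by
    intro s
    obtain ⟨m, hm⟩ := P.exists_eq ![P.c 0 s, 0] fun i => by
      fin_cases i
      · exact P.c_mem 0 s
      · exact (P.b 1).zero_mem
    have hm' := P.map_eq
      (Algebra.TensorProduct.includeRight : S →ₐ[R] K ⊗[R] S).toLinearMap m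
    rw [hm, hm, hP] at hm'
    simp only [Matrix.cons_val_zero, Matrix.cons_val_one, zero_smul, add_zero,
      AlgHom.toLinearMap_apply, map_one] at hm'
    refine exists_algebraMap_eq_of_smul_mem (unitLattice R K S) ?_ unitLattice_fg _ ?_
    · intro h
      have h2 : (1 : K) ⊗ₜ[R] (1 : S) ∈ unitLattice R K S := ⟨1, rfl⟩
      rw [h, Submodule.mem_bot] at h2
      exact h1 (hinj (by rw [map_zero]; exact h2))
    · rintro _ ⟨t, rfl⟩
      refine ⟨m * t, ?_⟩
      rw [AlgHom.toLinearMap_apply, map_mul, hm', smul_mul_assoc, one_mul]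
      rfl
  have key : ∀ s t : S, ∃ u : S, (α (wedge R s t) : K) = α (wedge R 1 u) := by
    intro s t
    obtain ⟨r, hr⟩ := hint s
    obtain ⟨r', hr'⟩ := hint t
    refine ⟨r • t - r' • s, ?_⟩
    let ω : S →ₗ[R] S →ₗ[R] K :=
      (wedgeMap R S).compr₂ ((𝔞 : Submodule R K).subtype ∘ₗ α.toLinearMap)
    have hω : ω.IsAlt := fun x => by
      change ((α (wedge R x x) : 𝔞) : K) = 0
      rw [wedge_self, map_zero]; rfl
    change ω s t = ω 1 _
    rw [P.alternating_eq ω hω, P.alternating_eq ω hω 1]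
    have e0 : P.c 0 1 = 1 := by rw [← hP, P.c_self]
    have e1 : P.c 1 1 = 0 := by rw [← hP, P.c_e]; simp
    rw [e0, e1, map_sub, map_smul, map_smul, Algebra.smul_def, Algebra.smul_def, hr, hr']
    ring
  have h2 : ∀ w, ∃ u : S, (α w : K) = α (wedge R 1 u) := by
    intro w
    induction w using wedge_induction with
    | wedge s t => exact key s t
    | zero => exact ⟨0, by
        have := wedge_smul_right (0 : R) (1 : S) 0
        rw [zero_smul, zero_smul] at this
        rw [this]⟩
    | add w w' h h' =>
      obtain ⟨u, hu⟩ := h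
      obtain ⟨u', hu'⟩ := h'
      exact ⟨u + u', by rw [wedge_add_right, map_add, map_add]; simp [hu, hu']⟩
    | smul r w h =>
      obtain ⟨u, hu⟩ := h
      exact ⟨r • u, by rw [wedge_smul_right, map_smul, map_smul]; simp [hu]⟩
  obtain ⟨w, hw⟩ := α.surjective ⟨x, hx⟩
  obtain ⟨u, hu⟩ := h2 w
  refine ⟨u, ?_⟩
  rw [Algebra.TensorProduct.one_def, orientationForm_tmul, ← hu, hw]
  simp

/-- The algebra `S` is determined by its orientation and any one of its ideals: it consists of the
multipliers `x` of the ideal with `α(1 ∧ x) ∈ 𝔞`. -/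
theorem mem_unitLattice_iff (hS : IsRankTwoLattice R S) (h𝔞 : 𝔞 ≠ 0) (I : FracIdeal R K S)
    (x : K ⊗[R] S) : x ∈ unitLattice R K S ↔
      orientationForm α 1 x ∈ 𝔞 ∧ ∀ y ∈ I.carrier, x * y ∈ I.carrier := by
  constructor
  · intro hx
    refine ⟨orientationForm_one_mem α x hx, ?_⟩
    obtain ⟨s, rfl⟩ := hx
    exact fun y hy => I.smul_mem s y hy
  · rintro ⟨hx, hI⟩
    obtain ⟨s, hs⟩ := exists_orientationForm_one_eq α hS _ hx
    obtain ⟨a, b, e, he⟩ := exists_orientationForm_eq_area α hS h𝔞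
    -- the difference of `x` and `s` is a scalar multiplier, hence integral
    have h1 : x - (1 : K) ⊗ₜ[R] s = (e (x - (1 : K) ⊗ₜ[R] s)).re • (1 : K ⊗[R] S) := by
      apply e.injective
      have h2 : (e (x - (1 : K) ⊗ₜ[R] s)).im = 0 := by
        have : orientationForm α 1 (x - (1 : K) ⊗ₜ[R] s) = 0 := by rw [map_sub, hs, sub_self]
        rw [he, map_one] at this
        simpa [area, QuadraticAlgebra.re_one, QuadraticAlgebra.im_one] using this
      rw [map_smul, map_one]
      ext
      · simp [QuadraticAlgebra.re_one]
      · rw [h2]; simp [QuadraticAlgebra.im_one]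
    set p := (e (x - (1 : K) ⊗ₜ[R] s)).re
    have hne : I.carrier ≠ ⊥ := by
      intro h
      have := (I.isRankTwoLattice hS).finrank_eq
      rw [h, finrank_bot] at this
      norm_num at this
    obtain ⟨r, hr⟩ := exists_algebraMap_eq_of_smul_mem I.carrier hne I.fg p fun y hy => by
      have : p • y = x * y - ((1 : K) ⊗ₜ[R] s) * y := by
        rw [← sub_mul, h1, smul_mul_assoc, one_mul]
      rw [this]
      exact sub_mem (hI y hy) (I.smul_mem s y hy)
    refine ⟨r • 1 + s, ?_⟩
    change (1 : K) ⊗ₜ[R] (r • 1 + s) = x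
    rw [TensorProduct.tmul_add, TensorProduct.tmul_smul, ← Algebra.TensorProduct.one_def,
      ← algebraMap_smul K r, hr, ← h1, sub_add_cancel]

end Order

section Extension

variable {R K : Type u} [CommRing R] [Field K] [Algebra R K]

/-- An identity of trilinear forms on three ideals extends to `S_K`. -/
theorem trilinear_eq {S S' : Type u} [CommRing S] [Algebra R S] [CommRing S']
    [Algebra R S'] {I₁ I₂ I₃ : FracIdeal R K S} (φ : (K ⊗[R] S) →ₗ[K] K)
    (φ' : (K ⊗[R] S') →ₗ[K] K) (g₁ g₂ g₃ : (K ⊗[R] S) →ₗ[K] (K ⊗[R] S'))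
    (h : ∀ x ∈ I₁.carrier, ∀ y ∈ I₂.carrier, ∀ z ∈ I₃.carrier,
      φ' (g₁ x * g₂ y * g₃ z) = φ (x * y * z)) (x y z : K ⊗[R] S) :
    φ' (g₁ x * g₂ y * g₃ z) = φ (x * y * z) := by
  have h3 : ∀ x ∈ I₁.carrier, ∀ y ∈ I₂.carrier, ∀ z,
      φ' (g₁ x * g₂ y * g₃ z) = φ (x * y * z) := by
    intro x hx y hy z
    have hz : z ∈ Submodule.span K (I₃.carrier : Set (K ⊗[R] S)) := I₃.span_eq_top ▸ trivial
    induction hz using Submodule.span_induction with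
    | mem z hz => exact h x hx y hy z hz
    | zero => simp
    | add z z' _ _ h h' => simp only [map_add, mul_add, h, h']
    | smul k z _ h => simp only [map_smul, mul_smul_comm, h]
  have h2 : ∀ x ∈ I₁.carrier, ∀ y z, φ' (g₁ x * g₂ y * g₃ z) = φ (x * y * z) := by
    intro x hx y z
    have hy : y ∈ Submodule.span K (I₂.carrier : Set (K ⊗[R] S)) := I₂.span_eq_top ▸ trivial
    induction hy using Submodule.span_induction with
    | mem y hy => exact h3 x hx y hy z
    | zero => simp
    | add y y' _ _ h h' => simp only [map_add, mul_add, add_mul, h, h']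
    | smul k y _ h => simp only [map_smul, mul_smul_comm, smul_mul_assoc, h]
  have hx : x ∈ Submodule.span K (I₁.carrier : Set (K ⊗[R] S)) := I₁.span_eq_top ▸ trivial
  induction hx using Submodule.span_induction with
  | mem x hx => exact h2 x hx y z
  | zero => simp
  | add x x' _ _ h h' => simp only [map_add, add_mul, h, h']
  | smul k x _ h => simp only [map_smul, smul_mul_assoc, h]

/-- An isomorphism of oriented algebras preserves the extended forms. -/
theorem orientationForm_map {S S' : Type u} [CommRing S] [Algebra R S] [CommRing S']
    [Algebra R S'] [IsFractionRing R K] {𝔞 : FractionalIdeal R⁰ K} (α : (⋀[R]^2 S) ≃ₗ[R] 𝔞)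
    (α' : (⋀[R]^2 S') ≃ₗ[R] 𝔞) (f : S →ₐ[R] S')
    (hf : ∀ ω, α' (exteriorPower.map 2 f.toLinearMap ω) = α ω) (x y : K ⊗[R] S) :
    orientationForm α' (f.toLinearMap.lTensor K x) (f.toLinearMap.lTensor K y) =
      orientationForm α x y := by
  induction x using TensorProduct.induction_on with
  | zero => simp
  | add x x' hx hx' => simp only [map_add, LinearMap.add_apply, hx, hx']
  | tmul k s =>
    induction y using TensorProduct.induction_on with
    | zero => simp
    | add y y' hy hy' => simp only [map_add, hy, hy']
    | tmul l t =>
      rw [LinearMap.lTensor_tmul, LinearMap.lTensor_tmul, orientationForm_tmul,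
        orientationForm_tmul, ← hf, map_wedge]

end Extension

section Determined

variable {R K : Type u} [CommRing R] [IsDedekindDomain R] [Field K] [Algebra R K]
  [IsFractionRing R K]

/-- An isomorphism of ideals extends to an isomorphism of `K`-vector spaces. -/
theorem exists_linearEquiv_extension {S S' : Type u} [CommRing S] [Algebra R S] [CommRing S']
    [Algebra R S'] (hS : IsRankTwoLattice R S) (hS' : IsRankTwoLattice R S') {I : FracIdeal R K S}
    {I' : FracIdeal R K S'} (j : I.carrier ≃ₗ[R] I'.carrier) :
    ∃ g : (K ⊗[R] S) ≃ₗ[K] (K ⊗[R] S'), ∀ x : I.carrier, g x = j x := by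
  obtain ⟨P⟩ := (I.isRankTwoLattice hS).nonempty_pseudoBasis (K := K)
  have hli : ∀ {S : Type u} [CommRing S] [Algebra R S] (f : I.carrier →ₗ[R] K ⊗[R] S),
      Function.Injective f → LinearIndependent K (fun i => f (P.e i)) := by
    intro S _ _ f hf
    rw [Fintype.linearIndependent_iff]
    intro s hs i
    rw [Fin.sum_univ_two] at hs
    rw [P.linearIndependent_e f hf s hs]
    rfl
  have hd : Module.finrank K (K ⊗[R] S) = 2 := (finrank_baseChange S).trans hS.finrank_eq
  have hd' : Module.finrank K (K ⊗[R] S') = 2 := (finrank_baseChange S').trans hS'.finrank_eq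
  have h1 := hli I.carrier.subtype Subtype.val_injective
  have h2 := hli (I'.carrier.subtype ∘ₗ j.toLinearMap)
    (Subtype.val_injective.comp j.injective)
  let B := basisOfLinearIndependentOfCardEqFinrank h1 (by simp [hd])
  let B' := basisOfLinearIndependentOfCardEqFinrank h2 (by simp [hd'])
  have hB : ∀ i, B i = P.e i := fun i => by simp [B]
  have hB' : ∀ i, B' i = j (P.e i) := fun i => by simp [B']
  let g := B.equiv B' (Equiv.refl _)
  have hg : ∀ i, g (P.e i) = j (P.e i) := fun i => by
    rw [← hB, ← hB']; simp [g]
  refine ⟨g, fun x => ?_⟩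
  have e1 := P.map_eq (g.toLinearMap.restrictScalars R ∘ₗ I.carrier.subtype) x
  have e2 := P.map_eq (I'.carrier.subtype ∘ₗ j.toLinearMap) x
  simp only [LinearMap.comp_apply, LinearMap.coe_restrictScalars, LinearEquiv.coe_coe,
    Submodule.subtype_apply, hg] at e1 e2
  rw [e1, e2]

/-- An isomorphism of `K`-algebras that maps `S` onto `S'` comes from an isomorphism `S ≃ S'`. -/
theorem exists_algEquiv_lTensor {S S' : Type u} [CommRing S] [Algebra R S] [CommRing S']
    [Algebra R S'] (hS : IsRankTwoLattice R S) (hS' : IsRankTwoLattice R S')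
    (F : (K ⊗[R] S) ≃ₐ[K] (K ⊗[R] S'))
    (hF : ∀ x, x ∈ unitLattice R K S ↔ F x ∈ unitLattice R K S') :
    ∃ f : S ≃ₐ[R] S', ∀ x, f.toLinearMap.lTensor K x = F x := by
  let i : S →ₐ[R] K ⊗[R] S := Algebra.TensorProduct.includeRight
  let i' : S' →ₐ[R] K ⊗[R] S' := Algebra.TensorProduct.includeRight
  have hi : Function.Injective i := includeRight_injective hS
  have hi' : Function.Injective i' := includeRight_injective hS'
  have hmem : ∀ s, F (i s) ∈ i'.range := fun s => by
    obtain ⟨s', hs'⟩ := (hF (i s)).1 ⟨s, rfl⟩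
    exact ⟨s', hs'⟩
  let φ : S →ₐ[R] S' := (AlgEquiv.ofInjective i' hi').symm.toAlgHom.comp
    (((F.restrictScalars R).toAlgHom.comp i).codRestrict i'.range hmem)
  have hφ : ∀ s, i' (φ s) = F (i s) := fun s =>
    congrArg Subtype.val ((AlgEquiv.ofInjective i' hi').apply_symm_apply ⟨F (i s), hmem s⟩)
  have hbij : Function.Bijective φ := by
    refine ⟨fun s t h => hi (F.injective ?_), fun s' => ?_⟩
    · rw [← hφ, ← hφ, h]
    · obtain ⟨x, hx⟩ := F.surjective (i' s')
      obtain ⟨s, hs⟩ := (hF x).2 (hx ▸ ⟨s', rfl⟩)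
      refine ⟨s, hi' ?_⟩
      rw [hφ, ← hx]
      exact congrArg F hs
  refine ⟨AlgEquiv.ofBijective φ hbij, fun x => ?_⟩
  induction x using TensorProduct.induction_on with
  | zero => simp
  | add x y hx hy => rw [map_add, map_add, hx, hy]
  | tmul k s =>
    have h1 : k ⊗ₜ[R] s = k • i s := by simp [i, TensorProduct.smul_tmul']
    have h2 : k ⊗ₜ[R] φ s = k • i' (φ s) := by simp [i', TensorProduct.smul_tmul']
    rw [LinearMap.lTensor_tmul]
    change k ⊗ₜ[R] φ s = _
    rw [h1, map_smul, h2, hφ]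

variable {𝔞 : FractionalIdeal R⁰ K}

/-- Triples that give the same box are equivalent. -/
theorem equivalent_of_arisesFrom (h𝔞 : 𝔞 ≠ 0) {T T' : BalancedTriple 𝔞} {B : BhargavaBox 𝔞}
    (h : B.ArisesFrom T) (h' : B.ArisesFrom T') : T.Equivalent T' := by
  obtain ⟨i₁, i₂, i₃, hβ, hθ⟩ := h
  obtain ⟨j₁, j₂, j₃, hβ', hθ'⟩ := h'
  have hS := T.lattice
  have hS' := T'.lattice
  obtain ⟨g₁, hg₁⟩ := exists_linearEquiv_extension hS hS' (i₁.symm.trans j₁)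
  obtain ⟨g₂, hg₂⟩ := exists_linearEquiv_extension hS hS' (i₂.symm.trans j₂)
  obtain ⟨g₃, hg₃⟩ := exists_linearEquiv_extension hS hS' (i₃.symm.trans j₃)
  obtain ⟨a, b, e, he⟩ := exists_orientationForm_eq_area T.orient hS h𝔞
  obtain ⟨a', b', e', he'⟩ := exists_orientationForm_eq_area T'.orient hS' h𝔞
  rw [BalancedTriple.orientFormK_eq] at hβ hθ hβ' hθ'
  have hi₁ : ∀ x, g₁ (i₁ x) = j₁ x := fun x => by rw [hg₁]; simp
  have hi₂ : ∀ x, g₂ (i₂ x) = j₂ x := fun x => by rw [hg₂]; simp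
  have hi₃ : ∀ x, g₃ (i₃ x) = j₃ x := fun x => by rw [hg₃]; simp
  have htri : ∀ x y z, orientationForm T'.orient 1 (g₁ x * g₂ y * g₃ z) =
      orientationForm T.orient 1 (x * y * z) := by
    refine trilinear_eq (I₁ := T.I₁) (I₂ := T.I₂) (I₃ := T.I₃) _ _ g₁.toLinearMap g₂.toLinearMap
      g₃.toLinearMap fun x hx y hy z hz => ?_
    obtain ⟨x, rfl⟩ : ∃ x', (i₁ x' : K ⊗[R] T.S) = x := ⟨i₁.symm ⟨x, hx⟩, by simp⟩
    obtain ⟨y, rfl⟩ : ∃ x', (i₂ x' : K ⊗[R] T.S) = y := ⟨i₂.symm ⟨y, hy⟩, by simp⟩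
    obtain ⟨z, rfl⟩ : ∃ x', (i₃ x' : K ⊗[R] T.S) = z := ⟨i₃.symm ⟨z, hz⟩, by simp⟩
    simp only [LinearEquiv.coe_coe]
    rw [hi₁, hi₂, hi₃, ← hβ, ← hβ']
  obtain ⟨x₁, y₁, x₂, y₂, x₃, y₃, hne⟩ : ∃ x₁ y₁ x₂ y₂ x₃ y₃,
      orientationForm T.orient (i₁ x₁) (i₁ y₁) * orientationForm T.orient (i₂ x₂) (i₂ y₂) *
        orientationForm T.orient (i₃ x₃) (i₃ y₃) ≠ 0 := by
    by_contra! h0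
    have h1 : (((𝔞 ^ 3 : FractionalIdeal R⁰ K) : Submodule R K).subtype ∘ₗ B.θ.toLinearMap) = 0 := by
      refine wedge_triple_ext fun x₁ y₁ x₂ y₂ x₃ y₃ => ?_
      rw [LinearMap.zero_apply, ← h0 x₁ y₁ x₂ y₂ x₃ y₃]
      exact hθ x₁ y₁ x₂ y₂ x₃ y₃
    apply pow_ne_zero 3 h𝔞
    rw [FractionalIdeal.eq_zero_iff]
    intro x hx
    obtain ⟨w, hw⟩ := B.θ.surjective ⟨x, hx⟩
    have := LinearMap.congr_fun h1 w
    change ((B.θ w : _) : K) = 0 at this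
    rwa [hw] at this
  obtain ⟨f, γ₁, γ₂, γ₃, hγ, hf, hf₁, hf₂, hf₃⟩ := exists_algEquiv_of_trilinear
    (e.symm.toLinearEquiv.trans (g₁.trans e'.toLinearEquiv))
    (e.symm.toLinearEquiv.trans (g₂.trans e'.toLinearEquiv))
    (e.symm.toLinearEquiv.trans (g₃.trans e'.toLinearEquiv))
    (fun x y z => by
      have := htri (e.symm x) (e.symm y) (e.symm z)
      rw [he, he', map_one, map_one] at this
      simpa only [map_mul, LinearEquiv.trans_apply, AlgEquiv.toLinearEquiv_apply,
        e.apply_symm_apply] using this)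
    (e (i₁ x₁)) (e (i₁ y₁)) (e (i₂ x₂)) (e (i₂ y₂)) (e (i₃ x₃)) (e (i₃ y₃))
    (by rw [← he, ← he, ← he]; exact hne)
    (by
      simp only [LinearEquiv.trans_apply, AlgEquiv.toLinearEquiv_apply, e.symm_apply_apply]
      rw [← he, ← he, ← he, ← he', ← he', ← he', hi₁, hi₁, hi₂, hi₂, hi₃, hi₃, ← hθ, ← hθ'])
  let F : (K ⊗[R] T.S) ≃ₐ[K] (K ⊗[R] T'.S) := (e.trans f).trans e'.symm
  have hF : ∀ x, F x = e'.symm (f (e x)) := fun x => rfl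
  let δ : (QuadraticAlgebra K a' b')ˣ →* (K ⊗[R] T'.S)ˣ :=
    Units.map (e'.symm : QuadraticAlgebra K a' b' →* (K ⊗[R] T'.S))
  have hδ : ∀ γ, ((δ γ : (K ⊗[R] T'.S)ˣ) : K ⊗[R] T'.S) = e'.symm γ := fun γ => rfl
  have hgF : ∀ (γ : (QuadraticAlgebra K a' b')ˣ) (g : (K ⊗[R] T.S) ≃ₗ[K] (K ⊗[R] T'.S)),
      (∀ x, e.symm.toLinearEquiv.trans (g.trans e'.toLinearEquiv) x = γ * f x) →
      ∀ x, g x = δ γ * F x := by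
    intro γ g hg x
    have := hg (e x)
    simp only [LinearEquiv.trans_apply, AlgEquiv.toLinearEquiv_apply, e.symm_apply_apply] at this
    rw [hF, hδ, ← map_mul, ← this, e'.symm_apply_apply]
  have hG₁ := hgF γ₁ g₁ hf₁
  have hG₂ := hgF γ₂ g₂ hf₂
  have hG₃ := hgF γ₃ g₃ hf₃
  have hFω : ∀ x y, orientationForm T'.orient (F x) (F y) = orientationForm T.orient x y := by
    intro x y
    rw [he', hF, hF, e'.apply_symm_apply, e'.apply_symm_apply, hf, he]
  have hcar : ∀ (I : FracIdeal R K T.S) (I' : FracIdeal R K T'.S) (M : Type u) [AddCommGroup M]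
      [Module R M] (i : M ≃ₗ[R] I.carrier) (j : M ≃ₗ[R] I'.carrier)
      (g : (K ⊗[R] T.S) ≃ₗ[K] (K ⊗[R] T'.S)), (∀ x, g (i x) = j x) →
      ∀ y, y ∈ I'.carrier ↔ ∃ x ∈ I.carrier, g x = y := by
    intro I I' M _ _ i j g hg y
    constructor
    · intro hy
      exact ⟨i (j.symm ⟨y, hy⟩), (i _).2, by rw [hg]; simp⟩
    · rintro ⟨x, hx, rfl⟩
      have := hg (i.symm ⟨x, hx⟩)
      rw [i.apply_symm_apply] at this
      rw [this]
      exact (j _).2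
  -- `F` maps `S` to `S'`, because both are given by the first ideal and the orientation
  have hU : ∀ x, x ∈ unitLattice R K T.S ↔ F x ∈ unitLattice R K T'.S := by
    intro x
    have hF1 : orientationForm T'.orient 1 (F x) = orientationForm T.orient 1 x := by
      rw [← hFω, map_one F]
    rw [mem_unitLattice_iff T.orient hS h𝔞 T.I₁, mem_unitLattice_iff T'.orient hS' h𝔞 T'.I₁, hF1]
    refine and_congr_right fun _ => ⟨fun hx y hy => ?_, fun hx y hy => ?_⟩
    · obtain ⟨z, hz, rfl⟩ := (hcar T.I₁ T'.I₁ B.M₁ i₁ j₁ g₁ hi₁ y).1 hy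
      refine (hcar T.I₁ T'.I₁ B.M₁ i₁ j₁ g₁ hi₁ _).2 ⟨x * z, hx z hz, ?_⟩
      rw [hG₁, hG₁, map_mul]
      ring
    · have h1 := hx (g₁ y) ((hcar T.I₁ T'.I₁ B.M₁ i₁ j₁ g₁ hi₁ _).2 ⟨y, hy, rfl⟩)
      have h2 : F x * g₁ y = g₁ (x * y) := by
        rw [hG₁, hG₁, map_mul]
        ring
      rw [h2] at h1
      obtain ⟨z, hz, hz'⟩ := (hcar T.I₁ T'.I₁ B.M₁ i₁ j₁ g₁ hi₁ _).1 h1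
      rwa [← g₁.injective hz']
  obtain ⟨f₀, hf₀⟩ := exists_algEquiv_lTensor hS hS' F hU
  have hmap : ∀ (I : FracIdeal R K T.S) (I' : FracIdeal R K T'.S) (M : Type u) [AddCommGroup M]
      [Module R M] (i : M ≃ₗ[R] I.carrier) (j : M ≃ₗ[R] I'.carrier)
      (g : (K ⊗[R] T.S) ≃ₗ[K] (K ⊗[R] T'.S)), (∀ x, g (i x) = j x) →
      ∀ γ : (K ⊗[R] T'.S)ˣ, (∀ x, g x = γ * F x) → I'.carrier = I.carrier.map
        (LinearMap.mulLeft R (γ : K ⊗[R] T'.S) ∘ₗ f₀.toLinearMap.lTensor K) := by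
    intro I I' M _ _ i j g hg γ hγ
    ext y
    rw [hcar I I' M i j g hg, Submodule.mem_map]
    refine exists_congr fun x => and_congr_right fun _ => ?_
    rw [LinearMap.comp_apply, LinearMap.mulLeft_apply, hf₀, hγ]
  refine ⟨f₀, fun w => ?_, δ γ₁, δ γ₂, δ γ₃, ?_, hmap _ _ _ i₁ j₁ g₁ hi₁ _ hG₁,
    hmap _ _ _ i₂ j₂ g₂ hi₂ _ hG₂, hmap _ _ _ i₃ j₃ g₃ hi₃ _ hG₃⟩
  · have key : T'.orient.toLinearMap ∘ₗ exteriorPower.map 2 f₀.toLinearMap =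
        T.orient.toLinearMap := by
      refine wedge_linearMap_ext fun x y => Subtype.ext ?_
      rw [LinearMap.comp_apply, map_wedge]
      have h1 := hFω ((1 : K) ⊗ₜ[R] x) ((1 : K) ⊗ₜ[R] y)
      rw [← hf₀, ← hf₀, LinearMap.lTensor_tmul, LinearMap.lTensor_tmul, orientationForm_tmul,
        orientationForm_tmul, mul_one, one_mul, one_mul] at h1
      exact h1
    exact LinearMap.congr_fun key w
  · rw [← map_mul, ← map_mul, hγ, map_one]

end Determined

section Equivalent

variable {R K : Type u} [CommRing R] [Field K] [Algebra R K] [IsFractionRing R K]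
  {𝔞 : FractionalIdeal R⁰ K}

/-- A box that arises from a triple arises from every equivalent triple. -/
theorem arisesFrom_of_equivalent (h𝔞 : 𝔞 ≠ 0) {T T' : BalancedTriple 𝔞} {B : BhargavaBox 𝔞}
    (h : B.ArisesFrom T) (hT : T.Equivalent T') : B.ArisesFrom T' := by
  obtain ⟨i₁, i₂, i₃, hβ, hθ⟩ := h
  obtain ⟨f, hf, γ₁, γ₂, γ₃, hγ, h₁, h₂, h₃⟩ := hT
  rw [BalancedTriple.orientFormK_eq] at hβ hθ
  obtain ⟨a, b, e, he⟩ := exists_orientationForm_eq_area T'.orient T'.lattice h𝔞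
  have hω := orientationForm_map (K := K) T.orient T'.orient f.toAlgHom hf
  let F : (K ⊗[R] T.S) →ₐ[K] (K ⊗[R] T'.S) := Algebra.TensorProduct.map (AlgHom.id K K) f.toAlgHom
  have hF : ∀ x, f.toLinearMap.lTensor K x = F x := fun x => rfl
  replace hω : ∀ x y, orientationForm T'.orient (F x) (F y) = orientationForm T.orient x y := hω
  have hinj : ∀ γ : (K ⊗[R] T'.S)ˣ, Function.Injective
      (LinearMap.mulLeft R (γ : K ⊗[R] T'.S) ∘ₗ f.toLinearMap.lTensor K) := by
    intro γ
    have h1 : Function.Injective (fun x : K ⊗[R] T'.S => (γ : K ⊗[R] T'.S) * x) :=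
      (Units.mulLeft γ).injective
    exact h1.comp (LinearEquiv.lTensor K f.toLinearEquiv).injective
  let j : ∀ (γ : (K ⊗[R] T'.S)ˣ) (I : FracIdeal R K T.S) (I' : FracIdeal R K T'.S),
      I'.carrier = I.carrier.map (LinearMap.mulLeft R (γ : K ⊗[R] T'.S) ∘ₗ
        f.toLinearMap.lTensor K) → (I.carrier ≃ₗ[R] I'.carrier) := fun γ I I' h =>
    (Submodule.equivMapOfInjective _ (hinj γ) I.carrier).trans (LinearEquiv.ofEq _ _ h.symm)
  have hj : ∀ γ I I' h x, ((j γ I I' h x : I'.carrier) : K ⊗[R] T'.S) = γ * F x :=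
    fun γ I I' h x => rfl
  have hnorm : ∀ (γ x y : K ⊗[R] T'.S), orientationForm T'.orient (γ * x) (γ * y) =
      QuadraticAlgebra.norm (e γ) * orientationForm T'.orient x y := fun γ x y => by
    rw [he, he, map_mul, map_mul, area_mul_mul]
  have hN : QuadraticAlgebra.norm (e γ₁) * QuadraticAlgebra.norm (e γ₂) *
      QuadraticAlgebra.norm (e γ₃) = 1 := by
    rw [← map_mul, ← map_mul, ← map_mul, ← map_mul, ← Units.val_mul, ← Units.val_mul, hγ,
      Units.val_one, map_one, map_one]
  have hγ' : (γ₁ * γ₂ * γ₃ : K ⊗[R] T'.S) = 1 := by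
    rw [← Units.val_mul, ← Units.val_mul, hγ, Units.val_one]
  refine ⟨i₁.trans (j γ₁ _ _ h₁), i₂.trans (j γ₂ _ _ h₂), i₃.trans (j γ₃ _ _ h₃),
    fun x y z => ?_, fun x₁ y₁ x₂ y₂ x₃ y₃ => ?_⟩
  · rw [BalancedTriple.orientFormK_eq, hβ, ← hω, map_one F, map_mul F, map_mul F]
    simp only [LinearEquiv.trans_apply, hj]
    congr 1
    linear_combination (-(F (i₁ x) * F (i₂ y) * F (i₃ z))) * hγ'
  · rw [BalancedTriple.orientFormK_eq, hθ]
    simp only [LinearEquiv.trans_apply, hj, hnorm, hω]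
    linear_combination (-(orientationForm T.orient (i₁ x₁) (i₁ y₁) *
      orientationForm T.orient (i₂ x₂) (i₂ y₂) * orientationForm T.orient (i₃ x₃) (i₃ y₃))) * hN

end Equivalent

/-! ### The quadratic algebra of a cube -/

section Cube

variable {K : Type*} [Field K] (c : Fin 2 → Fin 2 → Fin 2 → K) (D : K)

/-- The value at the first basis vector of the binary quadratic form `x ↦ -det c(x, ·, ·) / D`
attached to the first index of a cube `c`. -/
def cubeP : K := -(c 0 0 0 * c 0 1 1 - c 0 0 1 * c 0 1 0) * D⁻¹

/-- The value at the second basis vector of the form `x ↦ -det c(x, ·, ·) / D`. -/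
def cubeR : K := -(c 1 0 0 * c 1 1 1 - c 1 0 1 * c 1 1 0) * D⁻¹

/-- The middle coefficient of the form `x ↦ -det c(x, ·, ·) / D`. -/
def cubeT : K :=
  -(c 0 0 0 * c 1 1 1 + c 1 0 0 * c 0 1 1 - c 0 0 1 * c 1 1 0 - c 1 0 1 * c 0 1 0) * D⁻¹

/-- The cube with its second index moved to the first place. -/
def cubeTwo : Fin 2 → Fin 2 → Fin 2 → K := fun j i k => c i j k

/-- The cube with its third index moved to the first place. -/
def cubeThree : Fin 2 → Fin 2 → Fin 2 → K := fun k i j => c i j k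

/-- The difference between the generators of the quadratic algebra given by the second and the
first index. -/
def shiftTwo : K := -(c 0 1 0 * c 1 0 1 - c 0 1 1 * c 1 0 0) * D⁻¹

/-- The difference between the generators of the quadratic algebra given by the third and the
first index. -/
def shiftThree : K := -(c 0 0 1 * c 1 1 0 - c 0 1 1 * c 1 0 0) * D⁻¹

/-- The quadratic algebra of a cube: if `N` is the quadratic form of the first index, it is
generated by `ω` with trace `cubeT` and norm `N(e₀) N(e₁)`, which stands for `ē₀ e₁ / α(e₀ ∧ e₁)`
in an algebra in which `e₀, e₁` span an ideal with `N(x) = x x̄ / α(e₀ ∧ e₁)`. -/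
abbrev CubeAlgebra : Type _ := QuadraticAlgebra K (-(cubeP c D * cubeR c D)) (cubeT c D)

/-- The first ideal of the triple attached to a cube is spanned by `1` and `ω / N₁(e₀)`. -/
def cubeVecOne : Fin 2 → CubeAlgebra c D := ![⟨1, 0⟩, ⟨0, (cubeP c D)⁻¹⟩]

/-- The second ideal is spanned by `1` and `ω₂ / N₂(e₀)`, where `ω₂` is the generator given by the
second index. -/
def cubeVecTwo : Fin 2 → CubeAlgebra c D :=
  ![⟨1, 0⟩, ⟨shiftTwo c D * (cubeP (cubeTwo c) D)⁻¹, (cubeP (cubeTwo c) D)⁻¹⟩]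

/-- Since the first basis vectors of the first two ideals are `1`, the basis vector `z` of the third
ideal with index `k` is determined by `α(1 ∧ z) = c 0 0 k` and
`α(1 ∧ ω z) = cubeP c D * c 1 0 k`. -/
def cubeVecThree : Fin 2 → CubeAlgebra c D :=
  fun k => ⟨cubeP c D * c 1 0 k - cubeT c D * c 0 0 k, c 0 0 k⟩

/-- The coordinate at `1` of the product of basis vectors of the three ideals; the coordinate at `ω`
is the entry of the cube. -/
def cubeRe : Fin 2 → Fin 2 → Fin 2 → K :=
  ![fun j k => cubeP c D * c 1 j k - cubeT c D * c 0 j k, fun j k => -(cubeR c D * c 0 j k)]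

/-- The matrix of multiplication by `ω` on the first ideal. -/
def cubeMatOne : Fin 2 → Fin 2 → K := ![![0, cubeP c D], ![-cubeR c D, cubeT c D]]

/-- The matrix of multiplication by `ω` on the second ideal. -/
def cubeMatTwo : Fin 2 → Fin 2 → K :=
  ![![-shiftTwo c D, cubeP (cubeTwo c) D],
    ![-cubeR (cubeTwo c) D, cubeT (cubeTwo c) D - shiftTwo c D]]

/-- The matrix of multiplication by `ω` on the third ideal. -/
def cubeMatThree : Fin 2 → Fin 2 → K :=
  ![![-shiftThree c D, cubeP (cubeThree c) D],
    ![-cubeR (cubeThree c) D, cubeT (cubeThree c) D - shiftThree c D]]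

variable {c D}

/-- The products of the basis vectors recover the cube as the values of `α(1 ∧ xyz)`. -/
theorem cubeVec_mul (hP : cubeP c D ≠ 0) (hP' : cubeP (cubeTwo c) D ≠ 0) (i j k : Fin 2) :
    cubeVecOne c D i * cubeVecTwo c D j * cubeVecThree c D k = ⟨cubeRe c D i j k, c i j k⟩ := by
  have h0 : ∀ j k, cubeVecTwo c D j * cubeVecThree c D k = ⟨cubeRe c D 0 j k, c 0 j k⟩ := by
    intro j k
    fin_cases j
    · ext <;> simp [cubeVecTwo, cubeVecThree, cubeRe]
    · ext
      · simp only [cubeVecTwo, cubeVecThree, cubeRe, Matrix.cons_val_one, Matrix.cons_val_zero,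
          QuadraticAlgebra.re_mul, Fin.mk_one, Fin.isValue, Matrix.cons_val_fin_one]
        apply mul_left_cancel₀ hP'
        field_simp
        fin_cases k <;> simp [cubeP, cubeT, cubeR, cubeTwo, shiftTwo] <;> ring
      · simp only [cubeVecTwo, cubeVecThree, Matrix.cons_val_one, QuadraticAlgebra.im_mul,
          Fin.mk_one, Fin.isValue, Matrix.cons_val_fin_one]
        apply mul_left_cancel₀ hP'
        field_simp
        fin_cases k <;> simp [cubeP, cubeT, cubeTwo, shiftTwo] <;> ring
  rw [mul_assoc, h0]
  fin_cases i
  · ext <;> simp [cubeVecOne]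
  · ext
    · simp only [cubeVecOne, cubeRe, QuadraticAlgebra.re_mul, Fin.mk_one, Fin.isValue,
        Matrix.cons_val_one, Matrix.cons_val_fin_one]
      field_simp
      ring
    · simp only [cubeVecOne, cubeRe, QuadraticAlgebra.im_mul, Fin.mk_one, Fin.isValue,
        Matrix.cons_val_one, Matrix.cons_val_zero, Matrix.cons_val_fin_one]
      field_simp
      ring

theorem area_cubeVec (hD : D ≠ 0) (hP : cubeP c D ≠ 0) (hP' : cubeP (cubeTwo c) D ≠ 0) :
    area (cubeVecOne c D 0) (cubeVecOne c D 1) * area (cubeVecTwo c D 0) (cubeVecTwo c D 1) *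
      area (cubeVecThree c D 0) (cubeVecThree c D 1) = D := by
  have h3 : area (cubeVecThree c D 0) (cubeVecThree c D 1) =
      cubeP c D * cubeP (cubeTwo c) D * D := by
    simp only [area, cubeVecThree]
    have : cubeP (cubeTwo c) D * D = -(c 0 0 0 * c 1 0 1 - c 0 0 1 * c 1 0 0) := by
      simp only [cubeP, cubeTwo]
      field_simp
    linear_combination -cubeP c D * this
  rw [h3]
  simp only [area, cubeVecOne, cubeVecTwo, Matrix.cons_val_one, Matrix.cons_val_zero, Fin.isValue,
    Matrix.cons_val_fin_one]
  field_simp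
  ring

theorem omega_mul_cubeVecOne (hP : cubeP c D ≠ 0) (k : Fin 2) :
    ⟨0, 1⟩ * cubeVecOne c D k =
      cubeMatOne c D k 0 • cubeVecOne c D 0 + cubeMatOne c D k 1 • cubeVecOne c D 1 := by
  fin_cases k <;> ext <;> simp [cubeVecOne, cubeMatOne] <;> field_simp

theorem omega_mul_cubeVecTwo (hP' : cubeP (cubeTwo c) D ≠ 0) (k : Fin 2) :
    ⟨0, 1⟩ * cubeVecTwo c D k =
      cubeMatTwo c D k 0 • cubeVecTwo c D 0 + cubeMatTwo c D k 1 • cubeVecTwo c D 1 := by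
  have h1 : cubeT (cubeTwo c) D = cubeT c D + 2 * shiftTwo c D := by
    simp only [cubeT, cubeTwo, shiftTwo]; ring
  have h2 : cubeP c D * cubeR c D = cubeP (cubeTwo c) D * cubeR (cubeTwo c) D -
      (cubeT c D + shiftTwo c D) * shiftTwo c D := by
    simp only [cubeT, cubeP, cubeR, cubeTwo, shiftTwo]; ring
  fin_cases k <;> ext <;> simp [cubeVecTwo, cubeMatTwo, h1, h2] <;> field_simp <;> ring

theorem omega_mul_cubeVecThree (k : Fin 2) :
    ⟨0, 1⟩ * cubeVecThree c D k =
      cubeMatThree c D k 0 • cubeVecThree c D 0 + cubeMatThree c D k 1 • cubeVecThree c D 1 := by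
  fin_cases k <;> ext <;>
    simp only [cubeVecThree, cubeMatThree, QuadraticAlgebra.re_mul, QuadraticAlgebra.im_mul,
      QuadraticAlgebra.re_add, QuadraticAlgebra.im_add, QuadraticAlgebra.re_smul,
      QuadraticAlgebra.im_smul, smul_eq_mul, Fin.mk_one, Fin.zero_eta, Fin.isValue,
      Matrix.cons_val_one, Matrix.cons_val_zero, Matrix.cons_val_fin_one] <;>
    simp only [cubeT, cubeP, cubeR, cubeThree, shiftThree] <;> ring

/-- If a cube is nondegenerate in all three directions, the quadratic form of its first index is
nonzero at `(1, 0)`, `(0, 1)` or `(1, 1)`: otherwise it vanishes identically, and the cube has a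
kernel in the second or in the third direction. -/
theorem exists_cube_det_ne_zero
    (h₁ : ∀ s : Fin 2 → K, (∀ j k, s 0 * c 0 j k + s 1 * c 1 j k = 0) → s = 0)
    (h₂ : ∀ s : Fin 2 → K, (∀ i k, s 0 * c i 0 k + s 1 * c i 1 k = 0) → s = 0)
    (h₃ : ∀ s : Fin 2 → K, (∀ i j, s 0 * c i j 0 + s 1 * c i j 1 = 0) → s = 0) :
    ∃ p q : K, (p = 0 ∨ p = 1) ∧ (q = 0 ∨ q = 1) ∧
      (p * c 0 0 0 + q * c 1 0 0) * (p * c 0 1 1 + q * c 1 1 1) -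
        (p * c 0 0 1 + q * c 1 0 1) * (p * c 0 1 0 + q * c 1 1 0) ≠ 0 := by
  by_contra! h
  have e0 : c 0 0 0 * c 0 1 1 - c 0 0 1 * c 0 1 0 = 0 := by
    linear_combination h 1 0 (Or.inr rfl) (Or.inl rfl)
  have e1 : c 1 0 0 * c 1 1 1 - c 1 0 1 * c 1 1 0 = 0 := by
    linear_combination h 0 1 (Or.inl rfl) (Or.inr rfl)
  have e2 : c 0 0 0 * c 1 1 1 + c 1 0 0 * c 0 1 1 - c 0 0 1 * c 1 1 0 - c 1 0 1 * c 0 1 0 = 0 := by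
    linear_combination h 1 1 (Or.inr rfl) (Or.inr rfl) - e0 - e1
  have hne : ∃ j k, c 0 j k ≠ 0 := by
    by_contra! h0
    have := congrFun (h₁ ![1, 0] fun j k => by simp [h0]) 0
    simp at this
  obtain ⟨j, k, hjk⟩ := hne
  -- `u` and `v` span the right and the left kernel of the matrix `c 0`
  have hu : ∀ i, c 0 j 1 * c 0 i 0 + -c 0 j 0 * c 0 i 1 = 0 := by
    intro i
    fin_cases i <;> fin_cases j <;> simp only [Fin.mk_one, Fin.zero_eta, Fin.isValue] <;>
      first | ring1 | linear_combination e0 | linear_combination -e0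
  have hv : ∀ l, c 0 1 k * c 0 0 l + -c 0 0 k * c 0 1 l = 0 := by
    intro l
    fin_cases l <;> fin_cases k <;> simp only [Fin.mk_one, Fin.zero_eta, Fin.isValue] <;>
      first | ring1 | linear_combination e0 | linear_combination -e0
  -- the image of `u` under the matrix `c 1`
  set w : Fin 2 → K := fun i => c 0 j 1 * c 1 i 0 + -c 0 j 0 * c 1 i 1 with hw
  have hvw : c 0 1 k * w 0 + -c 0 0 k * w 1 = 0 := by
    simp only [hw]
    fin_cases j <;> fin_cases k <;> simp only [Fin.mk_one, Fin.zero_eta, Fin.isValue]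
    · linear_combination c 0 0 0 * e2 - c 1 0 0 * e0
    · linear_combination c 0 0 1 * e2 - c 1 0 1 * e0
    · linear_combination c 0 1 0 * e2 - c 1 1 0 * e0
    · linear_combination c 0 1 1 * e2 - c 1 1 1 * e0
  by_cases hw0 : ∀ i, w i = 0
  · have h0 := h₃ ![c 0 j 1, -c 0 j 0] fun i i' => by
      fin_cases i
      · exact hu i'
      · exact hw0 i'
    have h01 := congrFun h0 0
    have h00 := congrFun h0 1
    fin_cases k
    · exact hjk (by simpa using h00)
    · exact hjk (by simpa using h01)
  · have hx : ∀ l, c 0 1 k * c 1 0 l + -c 0 0 k * c 1 1 l = 0 := by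
      intro l
      have h1 : w 0 * c 1 1 l = w 1 * c 1 0 l := by
        simp only [hw]
        fin_cases l <;> simp only [Fin.mk_one, Fin.zero_eta, Fin.isValue]
        · linear_combination c 0 j 0 * e1
        · linear_combination c 0 j 1 * e1
      have h2 : w 0 * (c 0 1 k * c 1 0 l + -c 0 0 k * c 1 1 l) = 0 := by
        linear_combination c 1 0 l * hvw - c 0 0 k * h1
      have h3 : w 1 * (c 0 1 k * c 1 0 l + -c 0 0 k * c 1 1 l) = 0 := by
        linear_combination c 1 1 l * hvw - c 0 1 k * h1
      by_contra hne
      exact hw0 fun i => by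
        fin_cases i
        · exact (mul_eq_zero.1 h2).resolve_right hne
        · exact (mul_eq_zero.1 h3).resolve_right hne
    have h0 := h₂ ![c 0 1 k, -c 0 0 k] fun i l => by
      fin_cases i
      · exact hv l
      · exact hx l
    have h01 := congrFun h0 0
    have h00 := congrFun h0 1
    fin_cases j
    · exact hjk (by simpa using h00)
    · exact hjk (by simpa using h01)

end Cube

/-! ### Integrality of the coefficients of a cube -/

section IntegralCube

variable {R K : Type*} [CommRing R] [IsDedekindDomain R] [Field K] [Algebra R K]
  [IsFractionRing R K]

/-- The entries of a cube are divisible like the coefficients of a trilinear map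
`⨁ b₁ i × ⨁ b₂ j × ⨁ b₃ k → 𝔞`, and `D` like the value of an isomorphism
`⨂ Λ²(⨁ bₙ i) ≃ 𝔞 ^ 3` at the basis vectors. -/
structure IsIntegralCube (𝔞 : FractionalIdeal R⁰ K) (b₁ b₂ b₃ : Fin 2 → FractionalIdeal R⁰ K)
    (c : Fin 2 → Fin 2 → Fin 2 → K) (D : K) : Prop where
  ne_zero : 𝔞 ≠ 0
  ne_zero₁ : ∀ i, b₁ i ≠ 0
  ne_zero₂ : ∀ i, b₂ i ≠ 0
  ne_zero₃ : ∀ i, b₃ i ≠ 0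
  entry_mem : ∀ i j k, c i j k ∈ 𝔞 / (b₁ i * b₂ j * b₃ k)
  inv_mem : D⁻¹ ∈ (b₁ 0 * b₁ 1) * (b₂ 0 * b₂ 1) * (b₃ 0 * b₃ 1) / 𝔞 ^ 3

namespace IsIntegralCube

variable {𝔞 : FractionalIdeal R⁰ K} {b₁ b₂ b₃ : Fin 2 → FractionalIdeal R⁰ K}
  {c : Fin 2 → Fin 2 → Fin 2 → K} {D : K} (h : IsIntegralCube 𝔞 b₁ b₂ b₃ c D)

include h

theorem two : IsIntegralCube 𝔞 b₂ b₁ b₃ (cubeTwo c) D where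
  ne_zero := h.ne_zero
  ne_zero₁ := h.ne_zero₂
  ne_zero₂ := h.ne_zero₁
  ne_zero₃ := h.ne_zero₃
  entry_mem i j k := by rw [mul_comm (b₂ i)]; exact h.entry_mem j i k
  inv_mem := by rw [mul_comm (b₂ 0 * b₂ 1)]; exact h.inv_mem

theorem three : IsIntegralCube 𝔞 b₃ b₁ b₂ (cubeThree c) D where
  ne_zero := h.ne_zero
  ne_zero₁ := h.ne_zero₃
  ne_zero₂ := h.ne_zero₁
  ne_zero₃ := h.ne_zero₂
  entry_mem i j k := by rw [mul_assoc, mul_comm (b₃ i)]; exact h.entry_mem j k i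
  inv_mem := by
    rw [mul_assoc, mul_comm (b₃ 0 * b₃ 1)]; exact h.inv_mem

/-- The structure constants of the algebra and its ideals are sums of such products. -/
theorem mul_mul_inv_mem (Z : FractionalIdeal R⁰ K) (i j k i' j' k' : Fin 2)
    (hZ : (𝔞 / (b₁ i * b₂ j * b₃ k)) * (𝔞 / (b₁ i' * b₂ j' * b₃ k')) *
      ((b₁ 0 * b₁ 1) * (b₂ 0 * b₂ 1) * (b₃ 0 * b₃ 1) / 𝔞 ^ 3) = Z) :
    c i j k * c i' j' k' * D⁻¹ ∈ Z :=
  hZ ▸ FractionalIdeal.mul_mem_mul (FractionalIdeal.mul_mem_mul (h.entry_mem i j k)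
    (h.entry_mem i' j' k')) h.inv_mem

theorem cubeP_mem : cubeP c D ∈ b₁ 1 / (𝔞 * b₁ 0) := by
  have h0 := h.ne_zero; have h1 := h.ne_zero₁; have h2 := h.ne_zero₂; have h3 := h.ne_zero₃
  have e1 := h.mul_mul_inv_mem (b₁ 1 / (𝔞 * b₁ 0)) 0 0 0 0 1 1 (by field_simp [h0, h1, h2, h3])
  have e2 := h.mul_mul_inv_mem (b₁ 1 / (𝔞 * b₁ 0)) 0 0 1 0 1 0 (by field_simp [h0, h1, h2, h3])
  have : cubeP c D = c 0 0 1 * c 0 1 0 * D⁻¹ - c 0 0 0 * c 0 1 1 * D⁻¹ := by rw [cubeP]; ring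
  rw [this]
  exact sub_mem (S := Submodule R K) e2 e1

theorem cubeR_mem : cubeR c D ∈ b₁ 0 / (𝔞 * b₁ 1) := by
  have h0 := h.ne_zero; have h1 := h.ne_zero₁; have h2 := h.ne_zero₂; have h3 := h.ne_zero₃
  have e1 := h.mul_mul_inv_mem (b₁ 0 / (𝔞 * b₁ 1)) 1 0 0 1 1 1 (by field_simp [h0, h1, h2, h3])
  have e2 := h.mul_mul_inv_mem (b₁ 0 / (𝔞 * b₁ 1)) 1 0 1 1 1 0 (by field_simp [h0, h1, h2, h3])
  have : cubeR c D = c 1 0 1 * c 1 1 0 * D⁻¹ - c 1 0 0 * c 1 1 1 * D⁻¹ := by rw [cubeR]; ring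
  rw [this]
  exact sub_mem (S := Submodule R K) e2 e1

theorem cubeT_mem : cubeT c D ∈ 1 / 𝔞 := by
  have h0 := h.ne_zero; have h1 := h.ne_zero₁; have h2 := h.ne_zero₂; have h3 := h.ne_zero₃
  have e1 := h.mul_mul_inv_mem (1 / 𝔞) 0 0 0 1 1 1 (by field_simp [h0, h1, h2, h3])
  have e2 := h.mul_mul_inv_mem (1 / 𝔞) 1 0 0 0 1 1 (by field_simp [h0, h1, h2, h3])
  have e3 := h.mul_mul_inv_mem (1 / 𝔞) 0 0 1 1 1 0 (by field_simp [h0, h1, h2, h3])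
  have e4 := h.mul_mul_inv_mem (1 / 𝔞) 1 0 1 0 1 0 (by field_simp [h0, h1, h2, h3])
  have : cubeT c D = (c 0 0 1 * c 1 1 0 * D⁻¹ + c 1 0 1 * c 0 1 0 * D⁻¹) -
      (c 0 0 0 * c 1 1 1 * D⁻¹ + c 1 0 0 * c 0 1 1 * D⁻¹) := by rw [cubeT]; ring
  rw [this]
  exact sub_mem (S := Submodule R K) (add_mem (S := Submodule R K) e3 e4)
    (add_mem (S := Submodule R K) e1 e2)

theorem shiftTwo_mem : shiftTwo c D ∈ 1 / 𝔞 := by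
  have h0 := h.ne_zero; have h1 := h.ne_zero₁; have h2 := h.ne_zero₂; have h3 := h.ne_zero₃
  have e1 := h.mul_mul_inv_mem (1 / 𝔞) 0 1 0 1 0 1 (by field_simp [h0, h1, h2, h3])
  have e2 := h.mul_mul_inv_mem (1 / 𝔞) 0 1 1 1 0 0 (by field_simp [h0, h1, h2, h3])
  have : shiftTwo c D = c 0 1 1 * c 1 0 0 * D⁻¹ - c 0 1 0 * c 1 0 1 * D⁻¹ := by rw [shiftTwo]; ring
  rw [this]
  exact sub_mem (S := Submodule R K) e2 e1

theorem shiftThree_mem : shiftThree c D ∈ 1 / 𝔞 := by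
  have h0 := h.ne_zero; have h1 := h.ne_zero₁; have h2 := h.ne_zero₂; have h3 := h.ne_zero₃
  have e1 := h.mul_mul_inv_mem (1 / 𝔞) 0 0 1 1 1 0 (by field_simp [h0, h1, h2, h3])
  have e2 := h.mul_mul_inv_mem (1 / 𝔞) 0 1 1 1 0 0 (by field_simp [h0, h1, h2, h3])
  have : shiftThree c D = c 0 1 1 * c 1 0 0 * D⁻¹ - c 0 0 1 * c 1 1 0 * D⁻¹ := by
    rw [shiftThree]; ring
  rw [this]
  exact sub_mem (S := Submodule R K) e2 e1

theorem cubeRe_mem (i j k : Fin 2) : cubeRe c D i j k ∈ 1 / (b₁ i * b₂ j * b₃ k) := by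
  have h0 := h.ne_zero; have h1 := h.ne_zero₁; have h2 := h.ne_zero₂; have h3 := h.ne_zero₃
  fin_cases i
  · have e1 := FractionalIdeal.mul_mem_mul h.cubeP_mem (h.entry_mem 1 j k)
    have e2 := FractionalIdeal.mul_mem_mul h.cubeT_mem (h.entry_mem 0 j k)
    have k1 : b₁ 1 / (𝔞 * b₁ 0) * (𝔞 / (b₁ 1 * b₂ j * b₃ k)) = 1 / (b₁ 0 * b₂ j * b₃ k) := by
      field_simp [h0, h1, h2, h3]
    have k2 : 1 / 𝔞 * (𝔞 / (b₁ 0 * b₂ j * b₃ k)) = 1 / (b₁ 0 * b₂ j * b₃ k) := by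
      field_simp [h0, h1, h2, h3]
    rw [k1] at e1
    rw [k2] at e2
    exact sub_mem (S := Submodule R K) e1 e2
  · have e1 := FractionalIdeal.mul_mem_mul h.cubeR_mem (h.entry_mem 0 j k)
    have k1 : b₁ 0 / (𝔞 * b₁ 1) * (𝔞 / (b₁ 0 * b₂ j * b₃ k)) = 1 / (b₁ 1 * b₂ j * b₃ k) := by
      field_simp [h0, h1, h2, h3]
    rw [k1] at e1
    exact neg_mem (S := Submodule R K) e1

theorem mem_one_div_diag {x : K} (hx : x ∈ 1 / 𝔞) {I : FractionalIdeal R⁰ K} (hI : I ≠ 0) :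
    x ∈ I / (𝔞 * I) := by
  have h0 := h.ne_zero
  have : I / (𝔞 * I) = 1 / 𝔞 := by field_simp [h0, hI]
  rwa [this]

theorem cubeMatOne_mem (k l : Fin 2) : cubeMatOne c D k l ∈ b₁ l / (𝔞 * b₁ k) := by
  fin_cases k <;> fin_cases l
  · exact zero_mem (S := Submodule R K) _
  · exact h.cubeP_mem
  · exact neg_mem (S := Submodule R K) h.cubeR_mem
  · exact h.mem_one_div_diag h.cubeT_mem (h.ne_zero₁ 1)

theorem cubeMatTwo_mem (k l : Fin 2) : cubeMatTwo c D k l ∈ b₂ l / (𝔞 * b₂ k) := by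
  fin_cases k <;> fin_cases l
  · exact h.mem_one_div_diag (neg_mem (S := Submodule R K) h.shiftTwo_mem) (h.ne_zero₂ 0)
  · exact h.two.cubeP_mem
  · exact neg_mem (S := Submodule R K) h.two.cubeR_mem
  · exact h.mem_one_div_diag (sub_mem (S := Submodule R K) h.two.cubeT_mem h.shiftTwo_mem)
      (h.ne_zero₂ 1)

theorem cubeMatThree_mem (k l : Fin 2) : cubeMatThree c D k l ∈ b₃ l / (𝔞 * b₃ k) := by
  fin_cases k <;> fin_cases l
  · exact h.mem_one_div_diag (neg_mem (S := Submodule R K) h.shiftThree_mem) (h.ne_zero₃ 0)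
  · exact h.three.cubeP_mem
  · exact neg_mem (S := Submodule R K) h.three.cubeR_mem
  · exact h.mem_one_div_diag (sub_mem (S := Submodule R K) h.three.cubeT_mem h.shiftThree_mem)
      (h.ne_zero₃ 1)

theorem norm_mul_mem {x y : K} (hx : x ∈ 𝔞) (hy : y ∈ 𝔞) :
    -(cubeP c D * cubeR c D) * x * y ∈ (1 : FractionalIdeal R⁰ K) := by
  have h0 := h.ne_zero; have h1 := h.ne_zero₁
  have e := FractionalIdeal.mul_mem_mul (FractionalIdeal.mul_mem_mul
    (FractionalIdeal.mul_mem_mul h.cubeP_mem h.cubeR_mem) hx) hy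
  have k : b₁ 1 / (𝔞 * b₁ 0) * (b₁ 0 / (𝔞 * b₁ 1)) * 𝔞 * 𝔞 = 1 := by field_simp [h0, h1]
  rw [k] at e
  rw [neg_mul, neg_mul]
  exact neg_mem (S := Submodule R K) e

theorem cubeT_mul_mem {x : K} (hx : x ∈ 𝔞) : cubeT c D * x ∈ (1 : FractionalIdeal R⁰ K) := by
  have h0 := h.ne_zero
  have e := FractionalIdeal.mul_mem_mul h.cubeT_mem hx
  have k : 1 / 𝔞 * 𝔞 = 1 := by field_simp [h0]
  rwa [k] at e

end IsIntegralCube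

end IntegralCube

/-! ### Orders and ideals in a quadratic algebra -/

section Order

theorem mem_mul_of_mem {R K : Type*} [CommRing R] [Field K] [Algebra R K]
    {I J : FractionalIdeal R⁰ K} {x y : K} (Z : FractionalIdeal R⁰ K)
    (h : I * J = Z) (hx : x ∈ I) (hy : y ∈ J) : x * y ∈ Z :=
  h ▸ FractionalIdeal.mul_mem_mul hx hy

variable {R K : Type u} [CommRing R] [IsDedekindDomain R] [Field K] [Algebra R K]
  [IsFractionRing R K] {𝔞 : FractionalIdeal R⁰ K} {a b : K}

/-- The order `R ⊕ 𝔞 ω` in `K[ω]`, where `ω² = a + b ω` with `a 𝔞² ⊆ R` and `b 𝔞 ⊆ R`. -/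
def quadraticOrder (ha : ∀ x ∈ 𝔞, ∀ y ∈ 𝔞, a * x * y ∈ (1 : FractionalIdeal R⁰ K))
    (hb : ∀ x ∈ 𝔞, b * x ∈ (1 : FractionalIdeal R⁰ K)) :
    Subalgebra R (QuadraticAlgebra K a b) where
  carrier := {x | x.re ∈ (1 : FractionalIdeal R⁰ K) ∧ x.im ∈ 𝔞}
  mul_mem' := by
    rintro x y ⟨hx, hx'⟩ ⟨hy, hy'⟩
    refine ⟨?_, ?_⟩
    · rw [QuadraticAlgebra.re_mul]
      exact add_mem (S := Submodule R K) (mem_mul_of_mem 1 (one_mul 1) hx hy) (ha _ hx' _ hy')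
    · rw [QuadraticAlgebra.im_mul]
      exact add_mem (S := Submodule R K) (add_mem (S := Submodule R K)
        (mem_mul_of_mem 𝔞 (one_mul 𝔞) hx hy') (mem_mul_of_mem 𝔞 (mul_one 𝔞) hx' hy))
        (mem_mul_of_mem 𝔞 (one_mul 𝔞) (hb _ hx') hy')
  add_mem' := by
    rintro x y ⟨hx, hx'⟩ ⟨hy, hy'⟩
    exact ⟨add_mem (S := Submodule R K) hx hy, add_mem (S := Submodule R K) hx' hy'⟩
  algebraMap_mem' := by
    intro r
    rw [IsScalarTower.algebraMap_apply R K (QuadraticAlgebra K a b)]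
    refine ⟨?_, ?_⟩
    · rw [QuadraticAlgebra.algebraMap_re]
      exact (FractionalIdeal.mem_one_iff _).2 ⟨r, rfl⟩
    · rw [QuadraticAlgebra.algebraMap_im]
      exact 𝔞.zero_mem

/-- The order `R ⊕ 𝔞 ω` is an oriented quadratic algebra of type `𝔞`. -/
theorem exists_orientedAlgebra (h𝔞 : 𝔞 ≠ 0)
    (ha : ∀ x ∈ 𝔞, ∀ y ∈ 𝔞, a * x * y ∈ (1 : FractionalIdeal R⁰ K))
    (hb : ∀ x ∈ 𝔞, b * x ∈ (1 : FractionalIdeal R⁰ K)) :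
    ∃ (S : Type u) (_ : CommRing S) (_ : Algebra R S) (_ : IsRankTwoLattice R S)
      (α : (⋀[R]^2 S) ≃ₗ[R] 𝔞) (e : (K ⊗[R] S) ≃ₐ[K] QuadraticAlgebra K a b),
      (∀ x y, orientationForm α x y = area (e x) (e y)) ∧
      ∀ x, x ∈ unitLattice R K S ↔ (e x).re ∈ (1 : FractionalIdeal R⁰ K) ∧ (e x).im ∈ 𝔞 := by
  set S := quadraticOrder ha hb with hSdef
  have hmem : ∀ x, x ∈ S ↔ x.re ∈ (1 : FractionalIdeal R⁰ K) ∧ x.im ∈ 𝔞 := fun x => Iff.rfl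
  have hone : (1 : K) ∈ (1 : FractionalIdeal R⁰ K) := FractionalIdeal.one_mem_one _
  have hspan : Submodule.span K
      ((Subalgebra.toSubmodule S : Submodule R (QuadraticAlgebra K a b)) :
        Set (QuadraticAlgebra K a b)) = ⊤ := by
    obtain ⟨x, hx, hx0⟩ : ∃ x ∈ 𝔞, x ≠ 0 := by
      by_contra! h
      exact h𝔞 (FractionalIdeal.eq_zero_iff.2 h)
    rw [eq_top_iff]
    intro y _
    have : y = y.re • (⟨1, 0⟩ : QuadraticAlgebra K a b) + (y.im * x⁻¹) • ⟨0, x⟩ := by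
      ext <;> simp [hx0]
    rw [this]
    exact add_mem
      (Submodule.smul_mem _ _ (Submodule.subset_span ⟨hone, 𝔞.zero_mem⟩))
      (Submodule.smul_mem _ _ (Submodule.subset_span ⟨FractionalIdeal.zero_mem _, hx⟩))
  have htf : Module.IsTorsionFree R (QuadraticAlgebra K a b) := by
    refine ⟨fun r hr x y h => ?_⟩
    have hr' : algebraMap R K r ≠ 0 := by simpa using hr.ne_zero
    change r • x = r • y at h
    rw [← algebraMap_smul K r x, ← algebraMap_smul K r y] at h
    exact smul_right_injective _ hr' h
  have hlat : IsRankTwoLattice R S := by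
    refine ⟨?_, ?_, ?_⟩
    · let j : S →ₗ[R] ((1 : FractionalIdeal R⁰ K) : Submodule R K) × (𝔞 : Submodule R K) :=
        { toFun := fun x => (⟨x.1.re, x.2.1⟩, ⟨x.1.im, x.2.2⟩)
          map_add' := fun _ _ => rfl
          map_smul' := fun _ _ => rfl }
      have h1 : IsNoetherian R ((1 : FractionalIdeal R⁰ K) : Submodule R K) :=
        FractionalIdeal.isNoetherian 1
      have h2 : IsNoetherian R (𝔞 : Submodule R K) := FractionalIdeal.isNoetherian 𝔞
      refine Module.Finite.of_injective j fun x y h => Subtype.ext ?_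
      have hh := Prod.ext_iff.1 h
      exact QuadraticAlgebra.ext (congrArg Subtype.val hh.1) (congrArg Subtype.val hh.2)
    · exact inferInstanceAs (Module.IsTorsionFree R (Subalgebra.toSubmodule S))
    · have := finrank_eq_of_span_eq_top (K := K) _ hspan
      rw [QuadraticAlgebra.finrank_eq_two] at this
      exact this
  -- the area form on the order has values generating `𝔞`
  let ω : S →ₗ[R] S →ₗ[R] K :=
    LinearMap.mk₂ R (fun x y => area x.1 y.1)
      (fun x x' y => by
        simp only [area, Subalgebra.coe_add, QuadraticAlgebra.re_add, QuadraticAlgebra.im_add]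
        ring)
      (fun r x y => by
        simp only [area, Subalgebra.coe_smul, QuadraticAlgebra.re_smul, QuadraticAlgebra.im_smul]
        simp only [Algebra.smul_def]; ring)
      (fun x y y' => by
        simp only [area, Subalgebra.coe_add, QuadraticAlgebra.re_add, QuadraticAlgebra.im_add]
        ring)
      (fun r x y => by
        simp only [area, Subalgebra.coe_smul, QuadraticAlgebra.re_smul, QuadraticAlgebra.im_smul]
        simp only [Algebra.smul_def]; ring)
  have hω : ω.IsAlt := fun x => by
    change area x.1 x.1 = 0
    simp only [area]; ring
  have hval : Submodule.span R {t | ∃ x y, t = ω x y} = 𝔞 := by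
    refine le_antisymm (Submodule.span_le.2 ?_) fun x hx => Submodule.subset_span
      ⟨1, ⟨⟨0, x⟩, FractionalIdeal.zero_mem _, hx⟩, ?_⟩
    · rintro t ⟨x, y, rfl⟩
      exact sub_mem (S := Submodule R K) (mem_mul_of_mem 𝔞 (one_mul 𝔞) x.2.1 y.2.2)
        (mem_mul_of_mem 𝔞 (mul_one 𝔞) x.2.2 y.2.1)
    · change x = area 1 _
      simp [area, QuadraticAlgebra.re_one, QuadraticAlgebra.im_one]
  obtain ⟨α, hα⟩ := exists_wedge_equiv hlat ω hω 𝔞 h𝔞 hval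
  let φ : (K ⊗[R] S) →ₐ[K] QuadraticAlgebra K a b :=
    Algebra.TensorProduct.lift (Algebra.ofId K _) S.val fun _ _ => mul_comm _ _
  have hφ : ∀ k s, φ (k ⊗ₜ[R] s) = k • s.1 := fun k s => by
    rw [Algebra.smul_def]
    exact Algebra.TensorProduct.lift_tmul ..
  have hsurj : Function.Surjective φ.toLinearMap := by
    rw [← LinearMap.range_eq_top, eq_top_iff, ← hspan, Submodule.span_le]
    intro x hx
    exact ⟨1 ⊗ₜ[R] ⟨x, hx⟩, by rw [AlgHom.toLinearMap_apply, hφ, one_smul]⟩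
  have hfr : Module.finrank K (K ⊗[R] S) = Module.finrank K (QuadraticAlgebra K a b) := by
    rw [finrank_baseChange, hlat.finrank_eq, QuadraticAlgebra.finrank_eq_two]
  have : FiniteDimensional K (K ⊗[R] S) :=
    Module.finite_of_finrank_eq_succ (hfr.trans (QuadraticAlgebra.finrank_eq_two a b))
  have hinj : Function.Injective φ.toLinearMap :=
    (LinearMap.injective_iff_surjective_of_finrank_eq_finrank hfr).2 hsurj
  let e : (K ⊗[R] S) ≃ₐ[K] QuadraticAlgebra K a b := AlgEquiv.ofBijective φ ⟨hinj, hsurj⟩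
  have he : ∀ k s, e (k ⊗ₜ[R] s) = k • s.1 := hφ
  refine ⟨S, inferInstance, inferInstance, hlat, α, e, fun x y => ?_, fun x => ?_⟩
  · induction x using TensorProduct.induction_on with
    | zero => simp [area]
    | add x x' hx hx' =>
      rw [map_add, LinearMap.add_apply, hx, hx', map_add]
      simp only [area, QuadraticAlgebra.re_add, QuadraticAlgebra.im_add]; ring
    | tmul k s =>
      induction y using TensorProduct.induction_on with
      | zero => simp [area]
      | add y y' hy hy' =>
        rw [map_add, hy, hy', map_add]
        simp only [area, QuadraticAlgebra.re_add, QuadraticAlgebra.im_add]; ring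
      | tmul l t =>
        rw [orientationForm_tmul, he, he, hα]
        change k * l * area s.1 t.1 = _
        simp only [area, QuadraticAlgebra.re_smul, QuadraticAlgebra.im_smul, smul_eq_mul]; ring
  · constructor
    · rintro ⟨s, rfl⟩
      have : e ((1 : K) ⊗ₜ[R] s) = s.1 := by rw [he, one_smul]
      exact this.symm ▸ s.2
    · intro hx
      refine ⟨⟨e x, hx⟩, e.injective ?_⟩
      exact (he 1 _).trans (one_smul _ _)

/-- Vectors `v 0, v 1` on which `ω` acts with coefficients of suitable divisibility span, with the
coefficient ideals of a lattice `M`, an ideal isomorphic to `M`. -/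
theorem exists_fracIdeal {S : Type u} [CommRing S] [Algebra R S] (h𝔞 : 𝔞 ≠ 0)
    (e : (K ⊗[R] S) ≃ₐ[K] QuadraticAlgebra K a b)
    (he : ∀ x, x ∈ unitLattice R K S → (e x).re ∈ (1 : FractionalIdeal R⁰ K) ∧ (e x).im ∈ 𝔞)
    {M : Type u} [AddCommGroup M] [Module R M] [Module.Finite R M] (P : PseudoBasis R K M)
    (v : Fin 2 → QuadraticAlgebra K a b) (hv : area (v 0) (v 1) ≠ 0) (m : Fin 2 → Fin 2 → K)
    (hm : ∀ k, ⟨0, 1⟩ * v k = m k 0 • v 0 + m k 1 • v 1)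
    (hm' : ∀ k l, m k l ∈ P.b l / (𝔞 * P.b k)) :
    ∃ (I : FracIdeal R K S) (ι : M ≃ₗ[R] I.carrier),
      ∀ x, e (ι x) = P.c 0 x • v 0 + P.c 1 x • v 1 := by
  let j : M →ₗ[R] K ⊗[R] S :=
    { toFun := fun x => P.c 0 x • e.symm (v 0) + P.c 1 x • e.symm (v 1)
      map_add' := fun x y => by simp only [map_add]; module
      map_smul' := fun r x => by
        simp only [map_smul, RingHom.id_apply, smul_add, smul_assoc] }
  have hj : ∀ x, e (j x) = P.c 0 x • v 0 + P.c 1 x • v 1 := fun x => by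
    change e (P.c 0 x • e.symm (v 0) + P.c 1 x • e.symm (v 1)) = _
    rw [map_add, map_smul, map_smul, e.apply_symm_apply, e.apply_symm_apply]
  have hind : ∀ p q : K, p • v 0 + q • v 1 = 0 → p = 0 ∧ q = 0 := by
    intro p q h
    have h1 : p * area (v 0) (v 1) = area (p • v 0 + q • v 1) (v 1) := by
      simp only [area, QuadraticAlgebra.re_add, QuadraticAlgebra.im_add, QuadraticAlgebra.re_smul,
        QuadraticAlgebra.im_smul, smul_eq_mul]; ring
    have h2 : q * area (v 0) (v 1) = area (v 0) (p • v 0 + q • v 1) := by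
      simp only [area, QuadraticAlgebra.re_add, QuadraticAlgebra.im_add, QuadraticAlgebra.re_smul,
        QuadraticAlgebra.im_smul, smul_eq_mul]; ring
    rw [h] at h1 h2
    simp only [area, QuadraticAlgebra.re_zero, QuadraticAlgebra.im_zero, zero_mul, mul_zero,
      sub_zero, mul_eq_zero] at h1 h2
    exact ⟨h1.resolve_right hv, h2.resolve_right hv⟩
  have hinj : Function.Injective j := by
    rw [injective_iff_map_eq_zero]
    intro x hx
    have := hj x
    rw [hx, map_zero] at this
    obtain ⟨h0, h1⟩ := hind _ _ this.symm
    refine P.eq_zero x fun i => ?_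
    fin_cases i
    · exact h0
    · exact h1
  let I : FracIdeal R K S :=
    { carrier := LinearMap.range j
      smul_mem := by
        rintro s _ ⟨x, rfl⟩
        obtain ⟨hp, hq⟩ := he ((1 : K) ⊗ₜ[R] s) ⟨s, rfl⟩
        set p := (e ((1 : K) ⊗ₜ[R] s)).re with hpdef
        set q := (e ((1 : K) ⊗ₜ[R] s)).im with hqdef
        obtain ⟨y, hy⟩ := P.exists_eq
          (fun l => p * P.c l x + (q * (m 0 l) * P.c 0 x + q * m 1 l * P.c 1 x)) fun l => by
            have h1 : ∀ k, q * m k l * P.c k x ∈ P.b l := fun k => by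
              refine mem_mul_of_mem (P.b l) ?_ (FractionalIdeal.mul_mem_mul hq (hm' k l))
                (P.c_mem k x)
              have := P.b_ne_zero k
              field_simp
            exact add_mem (S := Submodule R K) (mem_mul_of_mem _ (one_mul _) hp (P.c_mem l x))
              (add_mem (S := Submodule R K) (h1 0) (h1 1))
        refine ⟨y, e.injective ?_⟩
        have hs : e ((1 : K) ⊗ₜ[R] s) = p • 1 + q • ⟨0, 1⟩ := by
          ext <;> simp [hpdef, hqdef, QuadraticAlgebra.re_one, QuadraticAlgebra.im_one]
        rw [map_mul, hj, hj, hs, hy, hy, add_mul, smul_mul_assoc, smul_mul_assoc, one_mul, mul_add,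
          mul_smul_comm, mul_smul_comm, hm, hm]
        module
      fg := Module.Finite.iff_fg.1 (Module.Finite.range j)
      span_eq_top := by
        rw [eq_top_iff]
        intro x _
        have hx : x = (area (e x) (v 1) * (area (v 0) (v 1))⁻¹) • j (P.e 0) +
            (area (v 0) (e x) * (area (v 0) (v 1))⁻¹) • j (P.e 1) := by
          apply e.injective
          rw [map_add, map_smul, map_smul, hj, hj]
          simp only [P.c_e]
          apply smul_right_injective _ hv
          ext <;> simp <;> field_simp <;> simp only [area] <;> ring
        rw [hx]
        exact add_mem (Submodule.smul_mem _ _ (Submodule.subset_span ⟨_, rfl⟩))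
          (Submodule.smul_mem _ _ (Submodule.subset_span ⟨_, rfl⟩)) }
  exact ⟨I, LinearEquiv.ofInjective j hinj, hj⟩

end Order

/-! ### The cube of a box -/

section Coordinates

variable {R K : Type*} [CommRing R] [IsDomain R] [Field K] [Algebra R K]
  {M : Type*} [AddCommGroup M] [Module R M]

/-- The determinant of two vectors in the coordinates of a pseudo-basis. -/
def PseudoBasis.det (P : PseudoBasis R K M) (x y : M) : K :=
  P.c 0 x * P.c 1 y - P.c 1 x * P.c 0 y

theorem PseudoBasis.det_mem (P : PseudoBasis R K M) (x y : M) : P.det x y ∈ P.b 0 * P.b 1 :=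
  sub_mem (S := Submodule R K) (FractionalIdeal.mul_mem_mul (P.c_mem 0 x) (P.c_mem 1 y))
    (mul_comm (P.b 1) (P.b 0) ▸ FractionalIdeal.mul_mem_mul (P.c_mem 1 x) (P.c_mem 0 y))

/-- The element of the lattice with one prescribed coordinate and the other one zero. -/
theorem PseudoBasis.exists_single (P : PseudoBasis R K M) (i : Fin 2) {p : K} (hp : p ∈ P.b i) :
    ∃ m, ∀ i', P.c i' m = if i' = i then p else 0 :=
  P.exists_eq (fun i' => if i' = i then p else 0) fun i' => by
    by_cases h : i' = i
    · subst h; simpa using hp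
    · simpa [h] using FractionalIdeal.zero_mem _

end Coordinates

section Coordinates

variable {R K : Type*} [CommRing R] [IsDedekindDomain R] [Field K] [Algebra R K]
  [IsFractionRing R K] {M₁ M₂ M₃ : Type*} [AddCommGroup M₁]
  [Module R M₁] [AddCommGroup M₂] [Module R M₂] [AddCommGroup M₃] [Module R M₃]
  {𝔞 : FractionalIdeal R⁰ K}

variable (P₁ : PseudoBasis R K M₁) (P₂ : PseudoBasis R K M₂) (P₃ : PseudoBasis R K M₃)

theorem PseudoBasis.bilinear_eq (γ : M₂ →ₗ[R] M₃ →ₗ[R] 𝔞) (y : M₂) (z : M₃) :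
    (γ y z : K) = ∑ j, ∑ k, P₂.c j y * P₃.c k z * γ (P₂.e j) (P₃.e k) := by
  have h1 := P₂.map_eq ((𝔞 : Submodule R K).subtype ∘ₗ γ.flip z) y
  have h2 := fun j => P₃.map_eq ((𝔞 : Submodule R K).subtype ∘ₗ γ (P₂.e j)) z
  simp only [LinearMap.comp_apply, Submodule.subtype_apply, LinearMap.flip_apply, smul_eq_mul]
    at h1 h2
  rw [h1, h2, h2]
  simp only [Fin.sum_univ_two]
  ring

variable (β : M₁ →ₗ[R] M₂ →ₗ[R] M₃ →ₗ[R] 𝔞)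

/-- The coefficients of a trilinear form. -/
def coeffCube : Fin 2 → Fin 2 → Fin 2 → K := fun i j k => β (P₁.e i) (P₂.e j) (P₃.e k)

theorem trilinear_eq_sum (x : M₁) (y : M₂) (z : M₃) :
    (β x y z : K) = ∑ i, ∑ j, ∑ k, P₁.c i x * P₂.c j y * P₃.c k z * coeffCube P₁ P₂ P₃ β i j k := by
  have h1 := P₁.map_eq ((𝔞 : Submodule R K).subtype ∘ₗ (β.flip y).flip z) x
  simp only [LinearMap.comp_apply, Submodule.subtype_apply, LinearMap.flip_apply, smul_eq_mul]
    at h1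
  rw [h1, P₂.bilinear_eq P₃, P₂.bilinear_eq P₃]
  simp only [Fin.sum_univ_two, coeffCube]
  ring

/-- For a nondegenerate trilinear form, one of the bilinear forms `β x` is nondegenerate. -/
theorem exists_bilinear_nondegenerate
    (h₁ : ∀ s : Fin 2 → K, (∀ y z, s 0 * β (P₁.e 0) y z + s 1 * β (P₁.e 1) y z = 0) → s = 0)
    (h₂ : ∀ s : Fin 2 → K, (∀ x z, s 0 * β x (P₂.e 0) z + s 1 * β x (P₂.e 1) z = 0) → s = 0)
    (h₃ : ∀ s : Fin 2 → K, (∀ x y, s 0 * β x y (P₃.e 0) + s 1 * β x y (P₃.e 1) = 0) → s = 0) :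
    ∃ x y y' z z', (β x y z * β x y' z' - β x y z' * β x y' z : K) ≠ 0 := by
  have hc : ∀ i j k, (β (P₁.e i) (P₂.e j) (P₃.e k) : K) = coeffCube P₁ P₂ P₃ β i j k :=
    fun _ _ _ => rfl
  obtain ⟨p, q, hp, hq, h⟩ := exists_cube_det_ne_zero (c := coeffCube P₁ P₂ P₃ β)
    (fun s hs => h₁ s fun y z => by
      rw [P₂.bilinear_eq P₃, P₂.bilinear_eq P₃]
      simp only [hc, Fin.sum_univ_two]
      linear_combination P₂.c 0 y * P₃.c 0 z * hs 0 0 + P₂.c 0 y * P₃.c 1 z * hs 0 1 +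
        P₂.c 1 y * P₃.c 0 z * hs 1 0 + P₂.c 1 y * P₃.c 1 z * hs 1 1)
    (fun s hs => h₂ s fun x z => by
      have e := fun y => P₁.bilinear_eq P₃ (β.flip y) x z
      simp only [LinearMap.flip_apply] at e
      rw [e, e]
      simp only [hc, Fin.sum_univ_two]
      linear_combination P₁.c 0 x * P₃.c 0 z * hs 0 0 + P₁.c 0 x * P₃.c 1 z * hs 0 1 +
        P₁.c 1 x * P₃.c 0 z * hs 1 0 + P₁.c 1 x * P₃.c 1 z * hs 1 1)
    (fun s hs => h₃ s fun x y => by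
      have e := fun z => P₁.bilinear_eq P₂ ((LinearMap.lflip.toLinearMap ∘ₗ β).flip z) x y
      change ∀ z, (β x y z : K) = ∑ i, ∑ j, P₁.c i x * P₂.c j y * β (P₁.e i) (P₂.e j) z at e
      rw [e, e]
      simp only [hc, Fin.sum_univ_two]
      linear_combination P₁.c 0 x * P₂.c 0 y * hs 0 0 + P₁.c 0 x * P₂.c 1 y * hs 0 1 +
        P₁.c 1 x * P₂.c 0 y * hs 1 0 + P₁.c 1 x * P₂.c 1 y * hs 1 1)
  -- `p` and `q` are `0` or `1`, so the vector `p e₀ + q e₁` lies in the lattice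
  obtain ⟨p', rfl⟩ : ∃ r : R, algebraMap R K r = p := by
    rcases hp with rfl | rfl
    · exact ⟨0, map_zero _⟩
    · exact ⟨1, map_one _⟩
  obtain ⟨q', rfl⟩ : ∃ r : R, algebraMap R K r = q := by
    rcases hq with rfl | rfl
    · exact ⟨0, map_zero _⟩
    · exact ⟨1, map_one _⟩
  refine ⟨p' • P₁.e 0 + q' • P₁.e 1, P₂.e 0, P₂.e 1, P₃.e 0, P₃.e 1, ?_⟩
  simpa only [map_add, map_smul, LinearMap.add_apply, LinearMap.smul_apply, Submodule.coe_add,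
    Submodule.coe_smul, Algebra.smul_def, hc] using h

/-- The nondegeneracy of `β x` does not depend on the pseudo-bases. -/
theorem bilinear_det_eq (x : M₁) (y y' : M₂) (z z' : M₃) :
    (β x y z * β x y' z' - β x y z' * β x y' z : K) = P₂.det y y' * P₃.det z z' *
      (β x (P₂.e 0) (P₃.e 0) * β x (P₂.e 1) (P₃.e 1) -
        β x (P₂.e 0) (P₃.e 1) * β x (P₂.e 1) (P₃.e 0)) := by
  rw [P₂.bilinear_eq P₃ (β x) y z, P₂.bilinear_eq P₃ (β x) y' z', P₂.bilinear_eq P₃ (β x) y z',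
    P₂.bilinear_eq P₃ (β x) y' z]
  simp only [Fin.sum_univ_two, PseudoBasis.det]
  ring

/-- The first quadratic form of the cube does not vanish at a vector `x` for which `β x` is
nondegenerate. -/
theorem cubeP_coeffCube_ne_zero {D : K} (hD : D ≠ 0) {y y' : M₂} {z z' : M₃}
    (h : (β (P₁.e 0) y z * β (P₁.e 0) y' z' - β (P₁.e 0) y z' * β (P₁.e 0) y' z : K) ≠ 0) :
    cubeP (coeffCube P₁ P₂ P₃ β) D ≠ 0 := by
  rw [bilinear_det_eq P₂ P₃] at h
  exact mul_ne_zero (neg_ne_zero.2 (right_ne_zero_of_mul h)) (inv_ne_zero hD)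

theorem coeffCube_mem (i j k : Fin 2) :
    coeffCube P₁ P₂ P₃ β i j k ∈ 𝔞 / (P₁.b i * P₂.b j * P₃.b k) := by
  rw [FractionalIdeal.mem_div_iff_of_ne_zero
    (mul_ne_zero (mul_ne_zero (P₁.b_ne_zero i) (P₂.b_ne_zero j)) (P₃.b_ne_zero k))]
  intro p hp
  refine FractionalIdeal.mul_induction_on hp (fun p hp r hr => ?_) fun p p' hp hp' => by
    rw [mul_add]; exact add_mem (S := Submodule R K) hp hp'
  refine FractionalIdeal.mul_induction_on hp (fun p hp q hq => ?_) fun p p' hp hp' => by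
    rw [add_mul, mul_add]; exact add_mem (S := Submodule R K) hp hp'
  obtain ⟨x, hx⟩ := P₁.exists_single i hp
  obtain ⟨y, hy⟩ := P₂.exists_single j hq
  obtain ⟨z, hz⟩ := P₃.exists_single k hr
  have h := (β x y z).2
  rw [trilinear_eq_sum P₁ P₂ P₃] at h
  simp only [hx, hy, hz, ite_mul, zero_mul, mul_ite, mul_zero, Finset.sum_ite_eq',
    Finset.mem_univ, if_true] at h
  rw [mul_comm]
  exact h

/-- A linear form on `Λ²M₁ ⊗ Λ²M₂ ⊗ Λ²M₃` is given by its value at the basis vectors. -/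
theorem triple_wedge_eq (f : (⋀[R]^2 M₁) ⊗[R] (⋀[R]^2 M₂) ⊗[R] (⋀[R]^2 M₃) →ₗ[R] K)
    (x₁ y₁ : M₁) (x₂ y₂ : M₂) (x₃ y₃ : M₃) :
    f (wedge R x₁ y₁ ⊗ₜ[R] wedge R x₂ y₂ ⊗ₜ[R] wedge R x₃ y₃) =
      P₁.det x₁ y₁ * P₂.det x₂ y₂ * P₃.det x₃ y₃ *
        f (wedge R (P₁.e 0) (P₁.e 1) ⊗ₜ[R] wedge R (P₂.e 0) (P₂.e 1) ⊗ₜ[R]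
          wedge R (P₃.e 0) (P₃.e 1)) := by
  have h₁ : ∀ u v, f (wedge R x₁ y₁ ⊗ₜ[R] u ⊗ₜ[R] v) =
      P₁.det x₁ y₁ * f (wedge R (P₁.e 0) (P₁.e 1) ⊗ₜ[R] u ⊗ₜ[R] v) := fun u v =>
    P₁.alternating_eq ((wedgeMap R M₁).compr₂ (f ∘ₗ (TensorProduct.mk R _ _).flip v ∘ₗ
      (TensorProduct.mk R _ _).flip u)) (fun x => by
        change f (wedge R x x ⊗ₜ[R] u ⊗ₜ[R] v) = 0
        rw [wedge_self, TensorProduct.zero_tmul, TensorProduct.zero_tmul, map_zero]) x₁ y₁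
  have h₂ : ∀ u v, f (u ⊗ₜ[R] wedge R x₂ y₂ ⊗ₜ[R] v) =
      P₂.det x₂ y₂ * f (u ⊗ₜ[R] wedge R (P₂.e 0) (P₂.e 1) ⊗ₜ[R] v) := fun u v =>
    P₂.alternating_eq ((wedgeMap R M₂).compr₂ (f ∘ₗ (TensorProduct.mk R _ _).flip v ∘ₗ
      TensorProduct.mk R _ _ u)) (fun x => by
        change f (u ⊗ₜ[R] wedge R x x ⊗ₜ[R] v) = 0
        rw [wedge_self, TensorProduct.tmul_zero, TensorProduct.zero_tmul, map_zero]) x₂ y₂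
  have h₃ : ∀ u, f (u ⊗ₜ[R] wedge R x₃ y₃) =
      P₃.det x₃ y₃ * f (u ⊗ₜ[R] wedge R (P₃.e 0) (P₃.e 1)) := fun u =>
    P₃.alternating_eq ((wedgeMap R M₃).compr₂ (f ∘ₗ TensorProduct.mk R _ _ u)) (fun x => by
        change f (u ⊗ₜ[R] wedge R x x) = 0
        rw [wedge_self, TensorProduct.tmul_zero, map_zero]) x₃ y₃
  rw [h₁, h₂, h₃]
  ring

end Coordinates

section Coordinates

variable {R K : Type u} [CommRing R] [IsDedekindDomain R] [Field K] [Algebra R K]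
  [IsFractionRing R K] {𝔞 : FractionalIdeal R⁰ K} (B : BhargavaBox 𝔞)

/-- The values of `θ` generate `𝔞 ^ 3`. -/
theorem BhargavaBox.span_theta : Submodule.span R {t : K | ∃ x₁ y₁ x₂ y₂ x₃ y₃,
    t = B.θ (wedge R x₁ y₁ ⊗ₜ[R] wedge R x₂ y₂ ⊗ₜ[R] wedge R x₃ y₃)} =
      ((𝔞 ^ 3 : FractionalIdeal R⁰ K) : Submodule R K) := by
  have h := range_eq_span_triple
    (((𝔞 ^ 3 : FractionalIdeal R⁰ K) : Submodule R K).subtype ∘ₗ B.θ.toLinearMap)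
  rw [LinearMap.range_comp, LinearEquiv.range, Submodule.map_top, Submodule.range_subtype] at h
  exact h.symm

/-- A box has pseudo-bases with an integral cube, in which the first quadratic forms of the first and
of the second index do not vanish at the first basis vector. -/
theorem BhargavaBox.exists_adapted (h𝔞 : 𝔞 ≠ 0) :
    ∃ (P₁ : PseudoBasis R K B.M₁) (P₂ : PseudoBasis R K B.M₂) (P₃ : PseudoBasis R K B.M₃) (D : K),
      D ≠ 0 ∧ cubeP (coeffCube P₁ P₂ P₃ B.β) D ≠ 0 ∧
      cubeP (cubeTwo (coeffCube P₁ P₂ P₃ B.β)) D ≠ 0 ∧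
      IsIntegralCube 𝔞 P₁.b P₂.b P₃.b (coeffCube P₁ P₂ P₃ B.β) D ∧
      ∀ x₁ y₁ x₂ y₂ x₃ y₃,
        (B.θ (wedge R x₁ y₁ ⊗ₜ[R] wedge R x₂ y₂ ⊗ₜ[R] wedge R x₃ y₃) : K) =
          P₁.det x₁ y₁ * P₂.det x₂ y₂ * P₃.det x₃ y₃ * D := by
  obtain ⟨Q₁⟩ := B.lattice₁.nonempty_pseudoBasis (K := K)
  obtain ⟨Q₂⟩ := B.lattice₂.nonempty_pseudoBasis (K := K)
  obtain ⟨P₃⟩ := B.lattice₃.nonempty_pseudoBasis (K := K)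
  have h₁ := (partialDual₁_iff B.β h𝔞 Q₁).1 B.nondeg₁
  have h₂ := (partialDual₂_iff B.β h𝔞 Q₂).1 B.nondeg₂
  have h₃ := (partialDual₃_iff B.β h𝔞 P₃).1 B.nondeg₃
  obtain ⟨x, y₁, y₁', z₁, z₁', hx⟩ := exists_bilinear_nondegenerate Q₁ Q₂ P₃ B.β h₁ h₂ h₃
  obtain ⟨y, x₂, x₂', z₂, z₂', hy⟩ := exists_bilinear_nondegenerate Q₂ Q₁ P₃ B.β.flip h₂ h₁
    fun s hs => h₃ s fun x y => hs y x
  have hx0 : x ≠ 0 := fun h => hx (by simp [h])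
  have hy0 : y ≠ 0 := fun h => hy (by simp [h])
  obtain ⟨P₁, rfl⟩ := exists_pseudoBasis (K := K) B.lattice₁ x hx0
  obtain ⟨P₂, rfl⟩ := exists_pseudoBasis (K := K) B.lattice₂ y hy0
  have hθ := triple_wedge_eq P₁ P₂ P₃
    (((𝔞 ^ 3 : FractionalIdeal R⁰ K) : Submodule R K).subtype ∘ₗ B.θ.toLinearMap)
  set D : K := (((𝔞 ^ 3 : FractionalIdeal R⁰ K) : Submodule R K).subtype ∘ₗ B.θ.toLinearMap)
    (wedge R (P₁.e 0) (P₁.e 1) ⊗ₜ[R] wedge R (P₂.e 0) (P₂.e 1) ⊗ₜ[R] wedge R (P₃.e 0) (P₃.e 1))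
  replace hθ : ∀ x₁ y₁ x₂ y₂ x₃ y₃,
      (B.θ (wedge R x₁ y₁ ⊗ₜ[R] wedge R x₂ y₂ ⊗ₜ[R] wedge R x₃ y₃) : K) =
        P₁.det x₁ y₁ * P₂.det x₂ y₂ * P₃.det x₃ y₃ * D := hθ
  have h𝔞3 : 𝔞 ^ 3 ≠ 0 := pow_ne_zero 3 h𝔞
  have hD : D ≠ 0 := fun h0 => h𝔞3 <| by
    rw [← FractionalIdeal.coeToSubmodule_eq_bot, ← B.span_theta, Submodule.span_eq_bot]
    rintro t ⟨x₁, y₁, x₂, y₂, x₃, y₃, rfl⟩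
    rw [hθ, h0, mul_zero]
  refine ⟨P₁, P₂, P₃, D, hD, cubeP_coeffCube_ne_zero P₁ P₂ P₃ B.β hD hx,
    cubeP_coeffCube_ne_zero P₂ P₁ P₃ B.β.flip hD hy,
    ⟨h𝔞, P₁.b_ne_zero, P₂.b_ne_zero, P₃.b_ne_zero, coeffCube_mem P₁ P₂ P₃ B.β, ?_⟩, hθ⟩
  rw [FractionalIdeal.mem_div_iff_of_ne_zero h𝔞3]
  intro t ht
  rw [← FractionalIdeal.mem_coe, ← B.span_theta] at ht
  induction ht using Submodule.span_induction with
  | zero => rw [mul_zero]; exact FractionalIdeal.zero_mem _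
  | add t t' _ _ h h' => rw [mul_add]; exact add_mem (S := Submodule R K) h h'
  | smul r t _ h => rw [mul_smul_comm]; exact Submodule.smul_mem _ r h
  | mem t ht =>
    obtain ⟨x₁, y₁, x₂, y₂, x₃, y₃, rfl⟩ := ht
    rw [hθ, mul_comm D⁻¹, mul_assoc _ D, mul_inv_cancel₀ hD, mul_one]
    exact FractionalIdeal.mul_mem_mul (FractionalIdeal.mul_mem_mul (P₁.det_mem _ _)
      (P₂.det_mem _ _)) (P₃.det_mem _ _)

end Coordinates

/-! ### The balanced triple of a box -/

section Triple

variable {R K : Type u} [CommRing R] [IsDedekindDomain R] [Field K] [Algebra R K]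
  [IsFractionRing R K] {𝔞 : FractionalIdeal R⁰ K}

theorem area_combination {a b : K} (v : Fin 2 → QuadraticAlgebra K a b) (p q p' q' : K) :
    area (p • v 0 + q • v 1) (p' • v 0 + q' • v 1) = (p * q' - q * p') * area (v 0) (v 1) := by
  simp only [area, QuadraticAlgebra.re_add, QuadraticAlgebra.im_add, QuadraticAlgebra.re_smul,
    QuadraticAlgebra.im_smul, smul_eq_mul]
  ring

theorem mul_combination {a b : K} (v₁ v₂ v₃ : Fin 2 → QuadraticAlgebra K a b)
    (x y z : Fin 2 → K) :
    (x 0 • v₁ 0 + x 1 • v₁ 1) * (y 0 • v₂ 0 + y 1 • v₂ 1) * (z 0 • v₃ 0 + z 1 • v₃ 1) =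
      ∑ i, ∑ j, ∑ k, (x i * y j * z k) • (v₁ i * v₂ j * v₃ k) := by
  simp only [Fin.sum_univ_two, Algebra.smul_def, map_mul]
  ring

/-- Every box arises from a balanced triple, in the algebra `R ⊕ 𝔞 ω` attached to its cube. -/
theorem exists_balancedTriple (h𝔞 : 𝔞 ≠ 0) (B : BhargavaBox 𝔞) :
    ∃ T : BalancedTriple 𝔞, B.ArisesFrom T := by
  obtain ⟨P₁, P₂, P₃, D, hD, hP, hP', hc, hθ⟩ := B.exists_adapted h𝔞
  set c := coeffCube P₁ P₂ P₃ B.β with hcdef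
  obtain ⟨S, iS, iA, hS, α, e, hα, hU⟩ := exists_orientedAlgebra (a := -(cubeP c D * cubeR c D))
    (b := cubeT c D) h𝔞 (fun x hx y hy => hc.norm_mul_mem hx hy) fun x hx => hc.cubeT_mul_mem hx
  have hareas := area_cubeVec hD hP hP'
  have hv₁ : area (cubeVecOne c D 0) (cubeVecOne c D 1) ≠ 0 := fun h => hD <| by
    rw [← hareas, h, zero_mul, zero_mul]
  have hv₂ : area (cubeVecTwo c D 0) (cubeVecTwo c D 1) ≠ 0 := fun h => hD <| by
    rw [← hareas, h, mul_zero, zero_mul]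
  have hv₃ : area (cubeVecThree c D 0) (cubeVecThree c D 1) ≠ 0 := fun h => hD <| by
    rw [← hareas, h, mul_zero]
  have := B.lattice₁.finite
  have := B.lattice₂.finite
  have := B.lattice₃.finite
  obtain ⟨I₁, ι₁, h₁⟩ := exists_fracIdeal h𝔞 e (fun x hx => (hU x).1 hx) P₁ _ hv₁ _
    (omega_mul_cubeVecOne hP) hc.cubeMatOne_mem
  obtain ⟨I₂, ι₂, h₂⟩ := exists_fracIdeal h𝔞 e (fun x hx => (hU x).1 hx) P₂ _ hv₂ _
    (omega_mul_cubeVecTwo hP') hc.cubeMatTwo_mem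
  obtain ⟨I₃, ι₃, h₃⟩ := exists_fracIdeal h𝔞 e (fun x hx => (hU x).1 hx) P₃ _ hv₃ _
    omega_mul_cubeVecThree hc.cubeMatThree_mem
  have hprod : ∀ x y z, e ((ι₁ x : K ⊗[R] S) * ι₂ y * ι₃ z) =
      ∑ i, ∑ j, ∑ k, (P₁.c i x * P₂.c j y * P₃.c k z) •
        (⟨cubeRe c D i j k, c i j k⟩ : CubeAlgebra c D) := by
    intro x y z
    rw [map_mul, map_mul, h₁, h₂, h₃,
      mul_combination _ _ _ (fun i => P₁.c i x) (fun j => P₂.c j y) (fun k => P₃.c k z)]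
    simp only [cubeVec_mul hP hP']
  have him : ∀ x y z, (e ((ι₁ x : K ⊗[R] S) * ι₂ y * ι₃ z)).im = B.β x y z := by
    intro x y z
    rw [hprod, trilinear_eq_sum P₁ P₂ P₃]
    simp only [Fin.sum_univ_two, QuadraticAlgebra.im_add, QuadraticAlgebra.im_smul, smul_eq_mul]
    rfl
  have hre : ∀ x y z, (e ((ι₁ x : K ⊗[R] S) * ι₂ y * ι₃ z)).re ∈ (1 : FractionalIdeal R⁰ K) := by
    intro x y z
    have hterm : ∀ i j k, P₁.c i x * P₂.c j y * P₃.c k z * cubeRe c D i j k ∈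
        (1 : FractionalIdeal R⁰ K) := fun i j k => by
      refine mem_mul_of_mem 1 ?_ (FractionalIdeal.mul_mem_mul (FractionalIdeal.mul_mem_mul
        (P₁.c_mem i x) (P₂.c_mem j y)) (P₃.c_mem k z)) (hc.cubeRe_mem i j k)
      have := P₁.b_ne_zero i; have := P₂.b_ne_zero j; have := P₃.b_ne_zero k
      field_simp
    rw [hprod]
    simp only [Fin.sum_univ_two, QuadraticAlgebra.re_add, QuadraticAlgebra.re_smul, smul_eq_mul]
    have hadd : ∀ {s t : K}, s ∈ (1 : FractionalIdeal R⁰ K) → t ∈ (1 : FractionalIdeal R⁰ K) →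
      s + t ∈ (1 : FractionalIdeal R⁰ K) := fun hs ht => add_mem (S := Submodule R K) hs ht
    exact hadd (hadd (hadd (hterm ..) (hterm ..)) (hadd (hterm ..) (hterm ..)))
      (hadd (hadd (hterm ..) (hterm ..)) (hadd (hterm ..) (hterm ..)))
  have harea : ∀ x₁ y₁ x₂ y₂ x₃ y₃,
      (B.θ (wedge R x₁ y₁ ⊗ₜ[R] wedge R x₂ y₂ ⊗ₜ[R] wedge R x₃ y₃) : K) =
        orientationForm α (ι₁ x₁) (ι₁ y₁) * orientationForm α (ι₂ x₂) (ι₂ y₂) *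
          orientationForm α (ι₃ x₃) (ι₃ y₃) := by
    intro x₁ y₁ x₂ y₂ x₃ y₃
    rw [hθ, hα, hα, hα, h₁, h₁, h₂, h₂, h₃, h₃, area_combination, area_combination,
      area_combination]
    simp only [PseudoBasis.det]
    linear_combination -(P₁.c 0 x₁ * P₁.c 1 y₁ - P₁.c 1 x₁ * P₁.c 0 y₁) *
      (P₂.c 0 x₂ * P₂.c 1 y₂ - P₂.c 1 x₂ * P₂.c 0 y₂) *
      (P₃.c 0 x₃ * P₃.c 1 y₃ - P₃.c 1 x₃ * P₃.c 0 y₃) * hareas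
  have hβ : ∀ x y z, (B.β x y z : K) = orientationForm α 1 ((ι₁ x : K ⊗[R] S) * ι₂ y * ι₃ z) := by
    intro x y z
    rw [hα, map_one, ← him]
    simp only [area, QuadraticAlgebra.re_one, QuadraticAlgebra.im_one, zero_mul, one_mul, sub_zero]
  refine ⟨⟨S, hS, α, I₁, I₂, I₃, (isBalanced_iff α hS h𝔞 _ _ _).2 ⟨?_, ?_⟩⟩, ι₁, ι₂, ι₃, hβ,
    harea⟩
  · rw [Submodule.mul_le]
    intro w hw z hz
    obtain ⟨z, rfl⟩ : ∃ z', (ι₃ z' : K ⊗[R] S) = z :=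
      ⟨ι₃.symm ⟨z, hz⟩, by rw [ι₃.apply_symm_apply]⟩
    induction hw using Submodule.mul_induction_on' with
    | mem_mul_mem x hx y hy =>
      obtain ⟨x, rfl⟩ : ∃ x', (ι₁ x' : K ⊗[R] S) = x :=
        ⟨ι₁.symm ⟨x, hx⟩, by rw [ι₁.apply_symm_apply]⟩
      obtain ⟨y, rfl⟩ : ∃ y', (ι₂ y' : K ⊗[R] S) = y :=
        ⟨ι₂.symm ⟨y, hy⟩, by rw [ι₂.apply_symm_apply]⟩
      exact (hU _).2 ⟨hre x y z, by rw [him]; exact (B.β x y z).2⟩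
    | add w _ w' _ h h' => rw [add_mul]; exact add_mem h h'
  · rw [valueSpan_mul_mul, ← B.span_theta]
    congr 1
    ext t
    constructor
    · rintro ⟨x₁, hx₁, y₁, hy₁, x₂, hx₂, y₂, hy₂, x₃, hx₃, y₃, hy₃, rfl⟩
      refine ⟨ι₁.symm ⟨x₁, hx₁⟩, ι₁.symm ⟨y₁, hy₁⟩, ι₂.symm ⟨x₂, hx₂⟩, ι₂.symm ⟨y₂, hy₂⟩,
        ι₃.symm ⟨x₃, hx₃⟩, ι₃.symm ⟨y₃, hy₃⟩, ?_⟩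
      rw [harea]
      simp only [LinearEquiv.apply_symm_apply]
    · rintro ⟨x₁, y₁, x₂, y₂, x₃, y₃, rfl⟩
      exact ⟨_, (ι₁ x₁).2, _, (ι₁ y₁).2, _, (ι₂ x₂).2, _, (ι₂ y₂).2, _, (ι₃ x₃).2, _, (ι₃ y₃).2,
        harea ..⟩

end Triple

end

end IdealTriples

open IdealTriples in
theorem theorem5p3 {R K : Type u} [CommRing R] [IsDedekindDomain R] [Field K] [Algebra R K]
    [IsFractionRing R K] (𝔞 : FractionalIdeal R⁰ K) (h𝔞 : 𝔞 ≠ 0) :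
    ∃ Φ : Quotient (IdealTriples.BalancedTriple.setoid 𝔞) ≃
        Quotient (IdealTriples.BhargavaBox.setoid 𝔞),
      ∀ (T : IdealTriples.BalancedTriple 𝔞) (B : IdealTriples.BhargavaBox 𝔞),
        Φ (Quotient.mk _ T) = Quotient.mk _ B ↔ B.ArisesFrom T := by
  -- the box of a triple; it is well defined and injective on classes because a box and a triple
  -- determine each other's class through `ArisesFrom`
  choose box hbox using fun T : BalancedTriple 𝔞 => exists_arisesFrom h𝔞 T
  have hiff : ∀ T T', box T ≈ box T' ↔ T ≈ T' := fun T T' =>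
    ⟨fun h => equivalent_of_arisesFrom h𝔞 (hbox T) (arisesFrom_of_isomorphic (hbox T') h),
      fun h => isomorphic_of_arisesFrom (arisesFrom_of_equivalent h𝔞 (hbox T) h) (hbox T')⟩
  let φ : Quotient (BalancedTriple.setoid 𝔞) → Quotient (BhargavaBox.setoid 𝔞) :=
    Quotient.map box fun T T' h => (hiff T T').2 h
  have hφ : ∀ T, φ (Quotient.mk _ T) = Quotient.mk _ (box T) := fun T => rfl
  have hφ_iff : ∀ T B, φ (Quotient.mk _ T) = Quotient.mk _ B ↔ B.ArisesFrom T := fun T B => by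
    rw [hφ, Quotient.eq]
    exact ⟨fun h => arisesFrom_of_isomorphic (hbox T) (Setoid.symm h),
      fun h => isomorphic_of_arisesFrom (hbox T) h⟩
  refine ⟨Equiv.ofBijective φ ⟨?_, ?_⟩, hφ_iff⟩
  · intro t t' h
    induction t using Quotient.inductionOn with | _ T
    induction t' using Quotient.inductionOn with | _ T'
    rw [hφ, hφ, Quotient.eq] at h
    exact Quotient.sound ((hiff T T').1 h)
  · intro b
    induction b using Quotient.inductionOn with | _ B
    obtain ⟨T, hT⟩ := exists_balancedTriple h𝔞 B
    exact ⟨Quotient.mk _ T, (hφ_iff T B).2 hT⟩
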